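/- Let $R_0=\{\pm e_i\pm e_j : i\neq j\}\cup\{\pm e_i\}$ be the root system of type $B_n$ with simple roots $e_1-e_2,\dots,e_{n-1}-e_n,e_n$, let $X$ be its root lattice or its weight lattice, and let $\mathcal H$ be the affine Hecke algebra with positive root labels, $q_1=q_{\check\alpha}$ for $\alpha=\pm e_i\pm e_j$ and $q_2=q_{\check\alpha}q_{\check\alpha/2}^{1/2}$ for $\alpha=\pm e_i$ (where $q_{\check\alpha/2}=1$ unless $\check\alpha$ is divisible by $2$ in the lattice dual to $X$). Assume $q_1\neq 1$ and let $m\in\mathbb R$ be such that $q_2=q_1^m$. Let $\Pi_L$ be the set of simple roots of a standard parabolic root system of type $A_{\kappa_1-1}\times\cdots\times A_{\kappa_r-1}\times B_l$ with $\kappa_1+\dots+\kappa_r+l=n$ (the factors in this order), and let $\delta$ be an irreducible discrete series representation of the parabolic quotient algebra $\mathcal H_L$ with central character $W_Lr_L$, where $r_L$ is the real point whose coordinates are $q_1^{-(\kappa_i-1)/2},q_1^{-(\kappa_i-3)/2},\dots,q_1^{(\kappa_i-1)/2}$ on the $i$-th block ($i=1,\dots,r$), and, on the last $l$ coordinates,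 the numbers $q_1^{c(\Box)}q_2$ for the boxes $\Box$ of a partition $\mu$ of $l$, with $c(\Box)$ the content (column minus row). Let $\xi=(\Pi_L,\delta,1)$ and let $R(\xi)$ be its $R$-group: the group of those $g=k\times w\in (T^L\cap T_L)\times W_0$ with $w(\Pi_L)=\Pi_L$ and $g\cdot\xi\simeq\xi$ which preserve $R_{0,+}(\xi)$, the positive part of the root system $R_0(\xi)$ formed by the primitive restricted roots $\beta=[\alpha]^L$ for which $c_\beta=\prod_{[\alpha]^L\in\mathbb R_{>0}\beta}c_\alpha$, with $c_\alpha=\frac{(1+q_{\check\alpha/2}^{-1/2}\theta_{-\alpha})(1-q_{\check\alpha/2}^{-1/2}q_{\check\alpha}^{-1}\theta_{-\alpha})}{(1+\theta_{-\alpha})(1-\theta_{-\alpha})}$, has a pole at $r_L$. Say that the strip $|S(p)|$, with $p$ boxes filled with $|-(p-1)/2|,|-(p-3)/2|,\dots,|(p-1)/2|$, can be glued to $T_m(\mu)$ (the Young diagram of $\mu$ with each box $\Box$ filled with $|c(\Box)+m|$) if there is a partition $\nu\supseteq\mu$ such that the boxes of $\nu\setminus\mu$ form a strip (each box to the right of or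 above the previous one) whose entries $|c(\Box)+m|$ are successively those of $|S(p)|$. Let $d$ be the number of distinct integers $p$ among $\kappa_1,\dots,\kappa_r$ for which $|S(p)|$ can be glued to $T_m(\mu)$. Then $R(\xi)$ is a group and $$R(\xi)\simeq(\mathbb Z/2)^d .$$ More precisely, $R(\xi)$ is generated by commuting involutions $w_p$, one for each such $p$: if the last block of length $p$ has coordinates $a+1,\dots,a+p$, then $w_p(e_{a+j})=-e_{a+p+1-j}$ for $1\le j\le p$, and $w_p$ fixes all other $e_i$. -/

import Mathlib

/-! Affine Hecke algebras of type `B_n` and their parabolic quotients, discrete series,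
the R-group of a standard induction datum, and gluing of strips to `m`-tableaux. -/

noncomputable section

namespace HeckeB

/-! ### The root system of type `B_n` and its Weyl group -/

/-- The ambient Euclidean space, with orthonormal basis `e 0, …, e (n-1)`. -/
abbrev E (n : ℕ) : Type := EuclideanSpace ℝ (Fin n)

def e {n : ℕ} (i : Fin n) : E n := EuclideanSpace.single i 1

/-- The roots `± e_i ± e_j`, `i ≠ j`. -/
def longRoots (n : ℕ) : Set (E n) :=
  {α | ∃ i j : Fin n, i ≠ j ∧ (α = e i + e j ∨ α = e i - e j ∨ α = -(e i + e j))}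

/-- The roots `± e_i`. -/
def shortRoots (n : ℕ) : Set (E n) := {α | ∃ i : Fin n, α = e i ∨ α = -e i}

/-- `R_0`. -/
def roots (n : ℕ) : Set (E n) := longRoots n ∪ shortRoots n

/-- `R_0^+`, with respect to the simple roots below. -/
def posRoots (n : ℕ) : Set (E n) :=
  {α | (∃ i j : Fin n, i < j ∧ (α = e i + e j ∨ α = e i - e j)) ∨ ∃ i : Fin n, α = e i}

/-- The simple roots `e_i - e_{i+1}` and (last one) `e_n`. -/
def simpleRoot {n : ℕ} (i : Fin n) : E n :=
  if h : (i : ℕ) + 1 < n then e i - e ⟨(i : ℕ) + 1, h⟩ else e i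

/-- The pairing `⟨x, α^∨⟩` with the coroot of `α`. -/
def coPair {n : ℕ} (x α : E n) : ℝ := 2 * inner ℝ x α / inner ℝ α α

/-- The orthogonal reflection `s_α`. -/
def refl {n : ℕ} (α : E n) : E n ≃ₗᵢ[ℝ] E n := (Submodule.span ℝ {α})ᗮ.reflection

theorem refl_apply {n : ℕ} (α x : E n) : refl α x = x - coPair x α • α := by
  have h1 := Submodule.reflection_orthogonal_apply (K := Submodule.span ℝ {α}) x
  rw [refl, h1, Submodule.reflection_singleton_apply, coPair]
  rw [real_inner_comm, real_inner_self_eq_norm_sq]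
  simp only [smul_smul, neg_sub, ← Nat.cast_smul_eq_nsmul ℝ]
  congr 2
  push_cast
  simp
  ring

/-- The group generated by the reflections in a set of roots. -/
def reflGroup {n : ℕ} (S : Set (E n)) : Subgroup (E n ≃ₗᵢ[ℝ] E n) :=
  Subgroup.closure (refl '' S)

/-- The Weyl group `W_0`. -/
abbrev W0 (n : ℕ) : Subgroup (E n ≃ₗᵢ[ℝ] E n) := reflGroup (roots n)

/-- The root lattice `Q`. -/
def rootLattice (n : ℕ) : AddSubgroup (E n) := AddSubgroup.closure (roots n)

/-- `x` pairs integrally with all coroots, i.e. `x` lies in the weight lattice. -/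
def IsWeight {n : ℕ} (x : E n) : Prop := ∀ α ∈ roots n, ∃ k : ℤ, coPair x α = k

/-! ### Labelled root data -/

/-- A semisimple root datum with root system of type `B_n` (given by its lattice `X`, with `Y` the
dual lattice), and root labels: `q₁ = q_{α^∨}` for the long roots `α = ± e_i ± e_j`,
`qs = q_{α^∨}` and `qh = q_{α^∨/2}` for the short roots `α = ± e_i`.
The condition `α^∨ ∈ 2Y` says that `⟨x, α^∨⟩` is even for all `x ∈ X`;
it fails for all long roots, for which `q_{α^∨/2} = 1`. -/
structure Datum (n : ℕ) where
  X : AddSubgroup (E n)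
  root_le : rootLattice n ≤ X
  le_weight : ∀ x ∈ X, IsWeight x
  q₁ : ℝ
  qs : ℝ
  qh : ℝ
  q₁_pos : 0 < q₁
  qs_pos : 0 < qs
  qh_pos : 0 < qh
  qh_eq_one : ∀ α ∈ shortRoots n, (¬ ∀ x ∈ X, ∃ j : ℤ, coPair x α = 2 * j) → qh = 1

variable {n : ℕ} (D : Datum n)

/-- `q₂ = q_{α^∨} q_{α^∨/2}^{1/2}` for `α` short. -/
def Datum.q₂ : ℝ := D.qs * √D.qh

open Classical in
/-- `q_{α^∨}` -/
def Datum.q (α : E n) : ℝ := if α ∈ longRoots n then D.q₁ else D.qs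

open Classical in
/-- `q_{α^∨/2}` -/
def Datum.qHalf (α : E n) : ℝ := if α ∈ longRoots n then 1 else D.qh

theorem Datum.root_mem {α : E n} (h : α ∈ roots n) : α ∈ D.X :=
  D.root_le (AddSubgroup.subset_closure h)

theorem Datum.W0_apply_mem {w : E n ≃ₗᵢ[ℝ] E n} (hw : w ∈ W0 n) :
    ∀ x ∈ D.X, w x ∈ D.X := by
  have key : ∀ α ∈ roots n, ∀ x ∈ D.X, refl α x ∈ D.X := by
    intro α hα x hx
    obtain ⟨k, hk⟩ := D.le_weight x hx α hα
    rw [refl_apply, hk, Int.cast_smul_eq_zsmul]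
    exact D.X.sub_mem hx (D.X.zsmul_mem (D.root_mem hα) k)
  induction hw using Subgroup.closure_induction'' with
  | mem g hg =>
    obtain ⟨α, hα, rfl⟩ := hg
    exact key α hα
  | inv_mem g hg =>
    obtain ⟨α, hα, rfl⟩ := hg
    have : (refl α)⁻¹ = refl α := (Submodule.span ℝ {α})ᗮ.reflection_symm
    rw [this]
    exact key α hα
  | one => exact fun x hx => hx
  | mul g h _ _ ig ih => exact fun x hx => ig _ (ih x hx)

/-! ### Standard parabolic root subsystems

A set `Π_L` of simple roots is given by the set `L` of their indices. -/

variable (L : Set (Fin n))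

/-- `Π_L` -/
def simples : Set (E n) := simpleRoot '' L

/-- The real span of `R_L`. -/
def spanL : Submodule ℝ (E n) := Submodule.span ℝ (simples L)

/-- `R_L` -/
def rootsL : Set (E n) := {α | α ∈ roots n ∧ α ∈ spanL L}

/-- `W_L` -/
abbrev WL : Subgroup (E n ≃ₗᵢ[ℝ] E n) := reflGroup (rootsL L)

/-- `x ↦ x̄`, the orthogonal projection to the span of `R_L`; its kernel on `X` is
`X ∩ (R_L^∨)^⊥`. -/
def projL : E n →+ E n := (spanL L).starProjection.toLinearMap.toAddMonoidHom

/-- `[x]^L`, the component of `x` that vanishes on the coroots of `R_L`. -/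
def res (x : E n) : E n := (spanL L)ᗮ.starProjection x

/-- `X_L = X / (X ∩ (R_L^∨)^⊥)`, realized as the image of `X` in the span of `R_L`. -/
def XL : AddSubgroup (E n) := D.X.map (projL L)

/-- The quotient map `X → X_L`. -/
def toXL : D.X →+ XL D L := (projL L).addSubgroupMap D.X

theorem simpleRoot_mem_roots (i : Fin n) : simpleRoot i ∈ roots n := by
  unfold simpleRoot
  split_ifs with h
  · exact Or.inl ⟨i, ⟨i + 1, h⟩, by simp [Fin.ext_iff], Or.inr (Or.inl rfl)⟩
  · exact Or.inr ⟨i, Or.inl rfl⟩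

theorem simpleRoot_mem_XL (i : L) : simpleRoot (i : Fin n) ∈ XL D L :=
  ⟨simpleRoot (i : Fin n), D.root_mem (simpleRoot_mem_roots _),
    Submodule.starProjection_eq_self_iff.2 (Submodule.subset_span ⟨i, i.2, rfl⟩)⟩

/-- The simple root with index `i`, as an element of `X_L`. -/
def simpleXL (i : L) : XL D L := ⟨simpleRoot (i : Fin n), simpleRoot_mem_XL D L i⟩

/-! ### The affine Hecke algebra `H_L` of the root datum `(R_L, X_L, R_L^∨, Y_L, Π_L)` -/

inductive Gen : Type
  | T (i : L) : Gen
  | θ (x : XL D L) : Gen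

/-- The alternating product `a b a …` with `k` factors. -/
def altProd {A : Type*} [Monoid A] (a b : A) : ℕ → A
  | 0 => 1
  | k + 1 => a * altProd b a k

/-- `q(s_i) = q_{α^∨} q_{α^∨/2}` for the simple root `α` with index `i`. -/
def Datum.qSimple (i : Fin n) : ℝ := D.q (simpleRoot i) * D.qHalf (simpleRoot i)

/-- The coefficients of the cross relation: with `α` the simple root with index `i`, `s = s_α`,
and `k = ⟨x, α^∨⟩ ≥ 0`,
`((q_{α^∨} q_{α^∨/2} - 1) + q_{α^∨/2}^{1/2} (q_{α^∨} - 1) θ_{-α}) (θ_x - θ_{s x}) / (1 - θ_{-2α})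
  = ∑_{a < k} crossCoef i a θ_{x - a α}`.
If `q_{α^∨/2} = 1` all coefficients are `q_{α^∨} - 1`; otherwise `k` is even. -/
def Datum.crossCoef (i : Fin n) (a : ℕ) : ℝ :=
  if Even a then D.q (simpleRoot i) * D.qHalf (simpleRoot i) - 1
  else √(D.qHalf (simpleRoot i)) * (D.q (simpleRoot i) - 1)

/-- The defining relations (Bernstein presentation). The cross relation for `⟨x, α^∨⟩ < 0` follows
from the one for `⟨x, α^∨⟩ ≥ 0`. -/
inductive Rel : FreeAlgebra ℂ (Gen D L) → FreeAlgebra ℂ (Gen D L) → Prop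
  | quadratic (i : L) :
      Rel ((FreeAlgebra.ι ℂ (.T i) + 1) *
        (FreeAlgebra.ι ℂ (.T i) - algebraMap ℂ _ (D.qSimple i : ℂ))) 0
  | braid (i j : L) :
      Rel (altProd (FreeAlgebra.ι ℂ (.T i)) (FreeAlgebra.ι ℂ (.T j))
          (orderOf (refl (simpleRoot (i : Fin n)) * refl (simpleRoot (j : Fin n)))))
        (altProd (FreeAlgebra.ι ℂ (.T j)) (FreeAlgebra.ι ℂ (.T i))
          (orderOf (refl (simpleRoot (i : Fin n)) * refl (simpleRoot (j : Fin n)))))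
  | theta_zero : Rel (FreeAlgebra.ι ℂ (.θ 0)) 1
  | theta_add (x y : XL D L) :
      Rel (FreeAlgebra.ι ℂ (.θ (x + y))) (FreeAlgebra.ι ℂ (.θ x) * FreeAlgebra.ι ℂ (.θ y))
  | cross (i : L) (x : XL D L) (k : ℕ) (hk : coPair (x : E n) (simpleRoot (i : Fin n)) = k) :
      Rel (FreeAlgebra.ι ℂ (.θ x) * FreeAlgebra.ι ℂ (.T i)
          - FreeAlgebra.ι ℂ (.T i) * FreeAlgebra.ι ℂ (.θ (x - k • simpleXL D L i)))
        (∑ a ∈ Finset.range k,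
          (D.crossCoef i a : ℂ) • FreeAlgebra.ι ℂ (.θ (x - a • simpleXL D L i)))

/-- The affine Hecke algebra `H_L`. -/
abbrev Hecke : Type := RingQuot (Rel D L)

/-- The generator `T_s` for the simple reflection with index `i ∈ L`. -/
def T (i : L) : Hecke D L := RingQuot.mkAlgHom ℂ (Rel D L) (FreeAlgebra.ι ℂ (.T i))

/-- The element `θ_x`, `x ∈ X_L`. -/
def θ (x : XL D L) : Hecke D L := RingQuot.mkAlgHom ℂ (Rel D L) (FreeAlgebra.ι ℂ (.θ x))

/-! ### Representations of `H_L` -/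

section Rep

variable {D L}
variable {V : Type*} [AddCommGroup V] [Module ℂ V] (δ : Hecke D L →ₐ[ℂ] Module.End ℂ V)

def IsIrreducible : Prop :=
  Nontrivial V ∧ ∀ U : Submodule ℂ V, (∀ h, ∀ u ∈ U, δ h u ∈ U) → U = ⊥ ∨ U = ⊤

/-- `t ∈ T_L = Hom(X_L, ℂˣ)` is a weight of `δ`. -/
def IsWeightOf (t : AddChar (XL D L) ℂ) : Prop :=
  ∃ v : V, v ≠ 0 ∧ ∀ x, δ (θ D L x) v = t x • v

/-- All weights `t` satisfy `|t(x)| < 1` for the nonzero dominant `x ∈ X_L`. -/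
def IsDiscreteSeries : Prop :=
  ∀ t, IsWeightOf δ t → ∀ x : XL D L, x ≠ 0 →
    (∀ α ∈ rootsL L, α ∈ posRoots n → 0 ≤ coPair (x : E n) α) → ‖t x‖ < 1

/-- `δ` has central character `W_L r`: every `W_L`-invariant element `∑ f(x) θ_x` of the span of
the `θ_x` (these form the center) acts by the scalar `∑ f(x) r(x)`. -/
def HasCentralChar (r : AddChar (XL D L) ℂ) : Prop :=
  ∀ f : XL D L →₀ ℂ,
    (∀ w ∈ WL L, ∀ x y : XL D L, (y : E n) = w (x : E n) → f y = f x) →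
    δ (f.sum fun x a => a • θ D L x) = (f.sum fun x a => a * r x) • 1

end Rep

/-! ### The R-group of an induction datum `ξ = (Π_L, δ, t)` -/

/-- The torus `T = Hom(X, ℂˣ)`. -/
abbrev Torus : Type := AddChar D.X ℂ

/-- The action of `W_0` on `X`. -/
def actX (w : W0 n) : D.X →+ D.X where
  toFun x := ⟨(w : E n ≃ₗᵢ[ℝ] E n) x, D.W0_apply_mem w.2 x x.2⟩
  map_zero' := by ext1; simp
  map_add' x y := by ext1; simp

/-- The action of `W_0` on `T`, `(w t)(x) = t (w⁻¹ x)`. -/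
def actT : W0 n →* MulAut (Torus D) where
  toFun w :=
    { toFun := fun t => t.compAddMonoidHom (actX D w⁻¹)
      invFun := fun t => t.compAddMonoidHom (actX D w)
      left_inv := fun t => by
        ext x
        have : actX D w⁻¹ (actX D w x) = x := by
          ext1
          exact (w : E n ≃ₗᵢ[ℝ] E n).symm_apply_apply x
        simp [this]
      right_inv := fun t => by
        ext x
        have : actX D w (actX D w⁻¹ x) = x := by
          ext1
          exact (w : E n ≃ₗᵢ[ℝ] E n).apply_symm_apply x
        simp [this]
      map_mul' := fun s t => by ext x; simp }
  map_one' := by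
    ext t x
    exact congrArg t (by ext1; simp [actX] : actX D (1 : W0 n)⁻¹ x = x)
  map_mul' v w := by
    ext t x
    have : actX D (v * w)⁻¹ x = actX D w⁻¹ (actX D v⁻¹ x) := by
      rw [mul_inv_rev]; rfl
    exact congrArg t this

/-- The group `T ⋊ W_0` of pairs `k × w`. -/
abbrev TW : Type := Torus D ⋊[actT D] W0 n

/-- `T_L ⊆ T`: characters trivial on the kernel of `X → X_L`. -/
def InTsubL (k : Torus D) : Prop := ∀ x : D.X, toXL D L x = 0 → k x = 1

/-- `T^L ⊆ T`: characters trivial on `X ∩ ℝ R_L`. -/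
def InTsupL (k : Torus D) : Prop := ∀ x : D.X, (x : E n) ∈ spanL L → k x = 1

section RGroup

variable {V : Type*} [AddCommGroup V] [Module ℂ V] (δ : Hecke D L →ₐ[ℂ] Module.End ℂ V)

/-- `Ψ_g(δ) ≃ δ` for `g = k × w` with `w(Π_L) = Π_L` and `k ∈ T^L ∩ T_L`. The automorphism
`ψ_g = ψ_k ∘ ψ_w` of `H_L` is given on generators by `T_i ↦ T_j` if `w(α_i) = α_j`,
and `θ_{x̄} ↦ k(w x) θ_{w x̄}`; the map `f` intertwines `δ` with `δ ∘ ψ_g`. -/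
def FixesRep (g : TW D) : Prop :=
  ∃ f : V ≃ₗ[ℂ] V,
    (∀ i j : L, (g.right : E n ≃ₗᵢ[ℝ] E n) (simpleRoot (i : Fin n)) = simpleRoot (j : Fin n) →
      ∀ v, f (δ (T D L i) v) = δ (T D L j) (f v)) ∧
    ∀ (x : D.X) (v : V), f (δ (θ D L (toXL D L x)) v) =
      g.left (actX D g.right x) • δ (θ D L (toXL D L (actX D g.right x))) (f v)

/-- `𝒲_{ξ,ξ}` for `ξ = (Π_L, δ, t)`: pairs `g = k × w` with `k ∈ T^L ∩ T_L`, `w(Π_L) = Π_L`,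
`Ψ_g(δ) ≃ δ` and `k w(t) = t`. -/
def Wxixi (t : Torus D) : Set (TW D) :=
  {g | (InTsubL D L g.left ∧ InTsupL D L g.left) ∧
    (g.right : E n ≃ₗᵢ[ℝ] E n) '' simples L = simples L ∧
    FixesRep D L δ g ∧ g.left * actT D g.right t = t}

end RGroup

/-- The rational function `c_α` in terms of the value `z` of `θ_{-α}`. -/
def cVal (α : E n) (z : ℂ) : ℂ :=
  ((1 + ((√(D.qHalf α))⁻¹ : ℝ) * z) * (1 - ((√(D.qHalf α))⁻¹ * (D.q α)⁻¹ : ℝ) * z)) /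
    ((1 + z) * (1 - z))

/-- `c_β = ∏ c_α` over the roots `α` with `[α]^L ∈ ℝ_{>0} β`, at the point `p · exp(s β)` of `T`. -/
def cBeta (p : Torus D) (β : E n) (s : ℂ) : ℂ :=
  ∏ᶠ (α : D.X) (_ : (α : E n) ∈ roots n ∧ ∃ a : ℝ, 0 < a ∧ res L (α : E n) = a • β),
    cVal D α ((p α)⁻¹ * Complex.exp (-(s * (inner ℝ (α : E n) β : ℝ))))

/-- `c_β` has a pole at `p`. On the coset `p T^L` the function `c_β` depends on the coordinate `β`
only, so its pole order is read off along the one-parameter subgroup `exp(s β)` of `T^L`. -/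
def HasPole (p : Torus D) (β : E n) : Prop :=
  meromorphicOrderAt (cBeta D L p β) 0 < 0

/-- `β = [α]^L`, for some `α ∈ R_0 \ R_L`, is primitive. -/
def IsPrimitive (β : E n) : Prop :=
  (∃ α ∈ roots n, α ∉ rootsL L ∧ β = res L α) ∧
    ∀ α ∈ roots n, α ∉ rootsL L → (∃ a : ℝ, 0 < a ∧ res L α = a • β) →
      ∃ k : ℕ, 0 < k ∧ res L α = (k : ℝ) • β

/-- `R_0(ξ)` for `ξ = (Π_L, δ, t)`, where `δ` has central character `W_L r`:
the primitive `β` such that `c_β` has a pole at `r t`. -/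
def R0xi (r : AddChar (XL D L) ℂ) (t : Torus D) : Set (E n) :=
  {β | IsPrimitive L β ∧ HasPole D L (r.compAddMonoidHom (toXL D L) * t) β}

/-- `R_{0,+}(ξ)`: the elements of `R_0(ξ)` that are restrictions of positive roots. -/
def R0xiPos (r : AddChar (XL D L) ℂ) (t : Torus D) : Set (E n) :=
  {β | β ∈ R0xi D L r t ∧ ∃ α ∈ posRoots n, α ∉ rootsL L ∧ β = res L α}

/-- The R-group `R(ξ)`, as a subset of `T ⋊ W_0`, for `ξ = (Π_L, δ, t)`, where `δ` has central
character `W_L r`. -/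
def RGroup {V : Type*} [AddCommGroup V] [Module ℂ V] (δ : Hecke D L →ₐ[ℂ] Module.End ℂ V)
    (r : AddChar (XL D L) ℂ) (t : Torus D) : Set (TW D) :=
  {g | g ∈ Wxixi D L δ t ∧
    (g.right : E n ≃ₗᵢ[ℝ] E n) '' R0xiPos D L r t = R0xiPos D L r t}

/-! ### Standard parabolics of type `A_κ × B_l` and the points `r_L` -/

section Blocks

variable {k : ℕ} (κ : Composition k) (l : ℕ)

/-- The standard parabolic of type `A_{κ_1-1} × ⋯ × A_{κ_r-1} × B_l` in `B_{k+l}`: all simple roots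
are taken, except those with (one-based) index `K_i = κ_1 + ⋯ + κ_i`, `i = 1, …, r`. -/
def levi : Set (Fin (k + l)) := {j | ∀ i : ℕ, (j : ℕ) + 1 ≠ κ.sizeUpTo i}

/-- The content (column minus row) of a box of a Young diagram. -/
def content (b : ℕ × ℕ) : ℤ := (b.2 : ℤ) - b.1

/-- The exponents of `q₁` in the coordinates of `r_L`: on the block `p` they are
`-(κ_p - 1)/2, …, (κ_p - 1)/2`, on the last `l` coordinates they are the `c(□) + m` for the boxes
`□` of `μ`, in the order given by `num`. -/
def exponent (m : ℝ) {μ : YoungDiagram} (num : Fin l ≃ μ.cells) (j : Fin (k + l)) : ℝ :=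
  Fin.addCases (motive := fun _ => ℝ)
    (fun a => -(((κ.blocksFun (κ.index a) : ℝ) - 1) / 2) + (κ.invEmbedding a : ℕ))
    (fun b => (content (num b : ℕ × ℕ) : ℝ) + m) j

/-- `w` acts by `e_d ↦ -e_{κ_i + 1 - d}` on the coordinates of the `i`-th block, and fixes all other
coordinates. -/
def IsBlockFlip (i : Fin κ.length) (w : E (k + l) ≃ₗᵢ[ℝ] E (k + l)) : Prop :=
  (∀ d, w (e (Fin.castAdd l (κ.embedding i d))) = -e (Fin.castAdd l (κ.embedding i d.rev))) ∧
    (∀ i', i' ≠ i → ∀ d, w (e (Fin.castAdd l (κ.embedding i' d))) =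
      e (Fin.castAdd l (κ.embedding i' d))) ∧
    ∀ b : Fin l, w (e (Fin.natAdd k b)) = e (Fin.natAdd k b)

end Blocks

/-! ### Gluing strips -/

/-- The `A`-strip `|S(p)|`, with entries `|-(p-1)/2|, |-(p-3)/2|, …, |(p-1)/2|`, can be glued to the
`m`-tableau `T_m(μ)`: there is a partition `ν ⊇ μ` such that `ν \ μ` is a strip of `p` boxes (each
next box is to the right of or above the previous one), in which the entries `|c(□) + m|` of
`T_m(ν)` are successively those of `|S(p)|`. -/
def CanGlue (m : ℝ) (μ : YoungDiagram) (p : ℕ) : Prop :=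
  ∃ (ν : YoungDiagram) (b : Fin p → ℕ × ℕ), μ ≤ ν ∧ Function.Injective b ∧
    Set.range b = {x | x ∈ ν ∧ x ∉ μ} ∧
    (∀ d d' : Fin p, (d' : ℕ) = d + 1 →
      ((b d').1 = (b d).1 ∧ (b d').2 = (b d).2 + 1) ∨
      ((b d').1 + 1 = (b d).1 ∧ (b d').2 = (b d).2)) ∧
    ∀ d : Fin p, |(content (b d) : ℝ) + m| = |-(((p : ℝ) - 1) / 2) + (d : ℕ)|

/-- The lengths `p` occurring in `κ` (each counted once) such that `|S(p)|` can be glued to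
`T_m(μ)`. -/
def gluable {k : ℕ} (κ : Composition k) (m : ℝ) (μ : YoungDiagram) : Set ℕ :=
  {p | p ∈ κ.blocks ∧ CanGlue m μ p}

end HeckeB

end

/-! The `R`-group consists of isometries of `ℝⁿ` that permute the simple roots of the Levi, preserve
the positive system `R_{0,+}(ξ)` and fix `δ`. The proof determines the two conditions separately.

*The root system `R_0(ξ)`.* The restriction of `e_a` is the center `c_i` of the block of `a`, or `0`
if `a` is one of the last `l` coordinates; so the primitive restricted roots are `± c_i` and
`± c_i ± c_j`. The value of each factor of `c_β` along the line `r_L exp(sβ)` is meromorphic with an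
order that is read off from the exponents of `q₁` in `r_L`, see `hasPole_iff_sum_rootOrder`. For
`β = c_i ± c_j` the sum of these orders telescopes, and it is negative exactly if the two blocks have
the same length (`hasPole_center_sub_center`, `hasPole_center_add_center`). For `β = c_i` it counts
boxes of `μ` by content, which describes the boundary of `μ` at the two places where the ends of the
strip would have to be attached, and it is negative exactly if the strip cannot be glued
(`hasPole_center`, resting on the combinatorial lemma `poleOrder_pos_iff_not_canGlue`). So the blocks
of a given length contribute a root system of type `D` if the strip can be glued, and of type `B`
otherwise (`mem_R0xiPos_iff`).

*The isometries.* An element of `W_0` that preserves the simple roots of the Levi fixes the last `l`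
coordinates and permutes the centers up to sign. If it also preserves the positive system, then it
fixes all centers except that it may change the sign of the last center of a component of type `D`;
on the block itself it is then determined, as the block has to be reversed (`exists_eq_flip`). This
leaves the products of the involutions `w_p`.

*The representation.* It remains to see that each `w_p` fixes `δ`. The central character forces the
weights of `δ` on a block to be permutations of the entries of a centred strip. Intertwining
elements `T_s - c` move a weight to its reflection unless the two exchanged entries differ by one.
If the entries of a weight were not in their natural order, such moves would bring the large ones to
the front and so violate the discrete series condition (`perm_eq_one_of_partial_sums`); hence only
one order of the entries occurs (`weight_eBar`). As `δ` is irreducible, the simple reflections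
of all blocks then act by a single scalar, and the `θ_y` for `y` supported on the blocks act by a
character (`block_action`). These data are invariant under `w_p`, and the identity map of `V`
intertwines `δ` with its twist (`fixesRep_flip`). -/

noncomputable section

namespace HeckeB

/-! ### Signed permutations of the coordinates -/

section SignedPermutations

variable {n : ℕ}

lemma e_apply (i j : Fin n) : (e i : E n) j = if j = i then 1 else 0 := by
  simp [e]

lemma inner_e_left (i : Fin n) (x : E n) : inner ℝ (e i) x = x i := by
  simp [e, EuclideanSpace.inner_single_left]

lemma inner_e_right (i : Fin n) (x : E n) : inner ℝ x (e i) = x i := by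
  rw [real_inner_comm, inner_e_left]

lemma norm_e (i : Fin n) : ‖(e i : E n)‖ = 1 := by simp [e]

lemma e_injective : Function.Injective (e : Fin n → E n) := by
  intro i j h
  have := congrArg (fun v : E n => v i) h
  by_contra hij
  simp [e_apply, hij] at this

lemma e_ne_neg (i j : Fin n) : (e i : E n) ≠ -e j := by
  intro h
  have := congrArg (fun v : E n => v i) h
  by_cases hij : i = j
  · subst hij
    simp [e_apply] at this
    linarith
  · simp [e_apply, hij] at this

lemma sum_smul_e (x : E n) : ∑ i, x i • (e i : E n) = x := by
  ext j
  simp [e_apply]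

lemma isometry_ext {w w' : E n ≃ₗᵢ[ℝ] E n} (h : ∀ i, w (e i) = w' (e i)) : w = w' := by
  ext1 x
  rw [← sum_smul_e x]
  simp only [map_sum, map_smul, h]

/-- An isometry that permutes the vectors `± e_i`. -/
def IsSigned (w : E n ≃ₗᵢ[ℝ] E n) : Prop := ∀ i, ∃ j, w (e i) = e j ∨ w (e i) = -e j

lemma IsSigned.mul {v w : E n ≃ₗᵢ[ℝ] E n} (hv : IsSigned v) (hw : IsSigned w) :
    IsSigned (v * w) := by
  intro i
  obtain ⟨j, hj⟩ := hw i
  obtain ⟨a, ha⟩ := hv j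
  refine ⟨a, ?_⟩
  have : (v * w) (e i) = v (w (e i)) := rfl
  rw [this]
  rcases hj with hj | hj <;> rcases ha with ha | ha <;> simp [hj, ha]

lemma coPair_e_long {i j : Fin n} (hij : i ≠ j) (x : E n) (s t : ℝ) (hs : s ^ 2 = 1)
    (ht : t ^ 2 = 1) : coPair x (s • e i + t • e j) = s * x i + t * x j := by
  have h : inner ℝ (s • e i + t • e j : E n) (s • e i + t • e j) = 2 := by
    simp only [inner_add_left, inner_add_right, inner_smul_left, inner_smul_right, inner_e_left]
    simp [e_apply, hij, hij.symm]
    linarith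
  rw [coPair, h]
  simp only [inner_add_right, inner_smul_right, inner_e_right]
  ring

lemma coPair_e (i : Fin n) (x : E n) : coPair x (e i) = 2 * x i := by
  simp [coPair, inner_e_right, norm_e]

lemma refl_neg (α : E n) : refl (-α) = refl α := by
  ext1 x
  simp [refl_apply, coPair, neg_div]

lemma coPair_e_sub {i j : Fin n} (hij : i ≠ j) (x : E n) : coPair x (e i - e j) = x i - x j := by
  have := coPair_e_long hij x 1 (-1) (by norm_num) (by norm_num)
  simpa [sub_eq_add_neg] using this

lemma coPair_e_add {i j : Fin n} (hij : i ≠ j) (x : E n) : coPair x (e i + e j) = x i + x j := by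
  simpa using coPair_e_long hij x 1 1 (by norm_num) (by norm_num)

lemma refl_sub_e {i j : Fin n} (hij : i ≠ j) (x : E n) :
    refl (e i - e j) x = x - (x i - x j) • (e i - e j) := by
  rw [refl_apply, coPair_e_sub hij]

lemma refl_add_e {i j : Fin n} (hij : i ≠ j) (x : E n) :
    refl (e i + e j) x = x - (x i + x j) • (e i + e j) := by
  rw [refl_apply, coPair_e_add hij]

lemma refl_e (i : Fin n) (x : E n) : refl (e i) x = x - (2 * x i) • e i := by
  rw [refl_apply, coPair_e]

lemma isSigned_refl {α : E n} (hα : α ∈ roots n) : IsSigned (refl α) := by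
  have sub : ∀ i j : Fin n, i ≠ j → IsSigned (refl (e i - e j)) := by
    intro i j hij a
    rw [refl_sub_e hij]
    by_cases hi : a = i
    · subst hi
      exact ⟨j, Or.inl (by simp [e_apply, hij.symm])⟩
    · by_cases hj : a = j
      · subst hj
        exact ⟨i, Or.inl (by simp [e_apply, hij])⟩
      · exact ⟨a, Or.inl (by simp [e_apply, Ne.symm hi, Ne.symm hj])⟩
  have add : ∀ i j : Fin n, i ≠ j → IsSigned (refl (e i + e j)) := by
    intro i j hij a
    rw [refl_add_e hij]
    by_cases hi : a = i
    · subst hi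
      exact ⟨j, Or.inr (by simp [e_apply, hij.symm])⟩
    · by_cases hj : a = j
      · subst hj
        exact ⟨i, Or.inr (by simp [e_apply, hij])⟩
      · exact ⟨a, Or.inl (by simp [e_apply, Ne.symm hi, Ne.symm hj])⟩
  have single : ∀ i : Fin n, IsSigned (refl (e i)) := by
    intro i a
    rw [refl_e]
    by_cases hi : a = i
    · subst hi
      exact ⟨a, Or.inr (by simp [e_apply, two_smul])⟩
    · exact ⟨a, Or.inl (by simp [e_apply, Ne.symm hi])⟩
  rcases hα with ⟨i, j, hij, rfl | rfl | rfl⟩ | ⟨i, rfl | rfl⟩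
  · exact add i j hij
  · exact sub i j hij
  · rw [refl_neg]; exact add i j hij
  · exact single i
  · rw [refl_neg]; exact single i

lemma refl_inv (α : E n) : (refl α)⁻¹ = refl α := (Submodule.span ℝ {α})ᗮ.reflection_symm

lemma refl_mul_self (α : E n) : refl α * refl α = 1 := by
  nth_rw 1 [← refl_inv]
  exact inv_mul_cancel _

lemma isSigned_of_mem_W0 {w : E n ≃ₗᵢ[ℝ] E n} (hw : w ∈ W0 n) : IsSigned w := by
  induction hw using Subgroup.closure_induction'' with
  | mem g hg =>
    obtain ⟨α, hα, rfl⟩ := hg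
    exact isSigned_refl hα
  | inv_mem g hg =>
    obtain ⟨α, hα, rfl⟩ := hg
    rw [refl_inv]
    exact isSigned_refl hα
  | one => exact fun i => ⟨i, Or.inl rfl⟩
  | mul g h _ _ ig ih => exact ig.mul ih

lemma e_sub_mem_roots {i j : Fin n} (h : i ≠ j) : (e i - e j : E n) ∈ roots n :=
  Or.inl ⟨i, j, h, Or.inr (Or.inl rfl)⟩

lemma e_add_mem_roots {i j : Fin n} (h : i ≠ j) : (e i + e j : E n) ∈ roots n :=
  Or.inl ⟨i, j, h, Or.inl rfl⟩

lemma e_mem_roots (i : Fin n) : (e i : E n) ∈ roots n := Or.inr ⟨i, Or.inl rfl⟩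

lemma refl_mem_W0 {α : E n} (h : α ∈ roots n) : refl α ∈ W0 n :=
  Subgroup.subset_closure ⟨α, h, rfl⟩

/-- Every signed permutation lies in the Weyl group: multiplying by the reflection that takes
`w e_i` to `e_i` enlarges the set of basis vectors that are fixed. -/
lemma mem_W0_of_isSigned {w : E n ≃ₗᵢ[ℝ] E n} (hw : IsSigned w) : w ∈ W0 n := by
  have key : ∀ A : Finset (Fin n), ∀ w : E n ≃ₗᵢ[ℝ] E n, IsSigned w →
      (∀ i ∉ A, w (e i) = e i) → w ∈ W0 n := by
    intro A
    induction A using Finset.induction_on with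
    | empty =>
      intro w _ h
      have : w = 1 := isometry_ext fun i => h i (Finset.notMem_empty i)
      exact this ▸ one_mem _
    | insert i A hi ih =>
      intro w hw h
      by_cases hfix : w (e i) = e i
      · refine ih w hw fun a ha => ?_
        by_cases hai : a = i
        · exact hai ▸ hfix
        · exact h a (by simp [hai, ha])
      · -- a root whose reflection exchanges `w e_i` and `e_i`
        obtain ⟨α, hα, h1, h2⟩ : ∃ α ∈ roots n, refl α (w (e i)) = e i ∧
            ∀ a, a ∉ insert i A → refl α (e a) = e a := by
          obtain ⟨j, hj⟩ := hw i
          by_cases hij : i = j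
          · subst hij
            have hj : w (e i) = -e i := hj.resolve_left hfix
            refine ⟨e i, e_mem_roots i, ?_, fun a ha => ?_⟩
            · rw [hj, map_neg, refl_e]
              simp [e_apply, two_smul]
            · have : i ≠ a := fun h => ha (by simp [h])
              simp [refl_e, e_apply, this]
          · have hjA : ∀ a, a ∉ insert i A → j ≠ a := by
              rintro a ha rfl
              have hja := h j ha
              have : w (e i) = w (e j) ∨ w (e i) = w (-e j) := by
                rw [map_neg, hja]; exact hj
              rcases this with h' | h'
              · exact hij (e_injective (w.injective h'))
              · exact e_ne_neg _ _ (w.injective h')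
            rcases hj with hj | hj
            · refine ⟨e i - e j, e_sub_mem_roots hij, ?_, fun a ha => ?_⟩
              · rw [hj, refl_sub_e hij]
                simp [e_apply, hij]
              · have h1 : i ≠ a := fun h => ha (by simp [h])
                simp [refl_sub_e hij, e_apply, h1, hjA a ha]
            · refine ⟨e i + e j, e_add_mem_roots hij, ?_, fun a ha => ?_⟩
              · rw [hj, refl_add_e hij]
                simp [e_apply, hij]
              · have h1 : i ≠ a := fun h => ha (by simp [h])
                simp [refl_add_e hij, e_apply, h1, hjA a ha]
        have hmem : refl α * w ∈ W0 n := by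
          refine ih _ ((isSigned_refl hα).mul hw) fun a ha => ?_
          change refl α (w (e a)) = e a
          by_cases hai : a = i
          · rw [hai, h1]
          · have ha' : a ∉ insert i A := by simp [hai, ha]
            rw [h a ha', h2 a ha']
        have := (W0 n).mul_mem (refl_mem_W0 hα) hmem
        rwa [← mul_assoc, refl_mul_self, one_mul] at this
  exact key Finset.univ w hw fun i hi => absurd (Finset.mem_univ i) hi

instance finite_W0 : Finite (W0 n) := by
  classical
  let S : Set (E n) := Set.range (e : Fin n → E n) ∪ Set.range fun i : Fin n => -(e i : E n)
  have hS : S.Finite := (Set.finite_range _).union (Set.finite_range _)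
  have : Finite S := hS
  let f : W0 n → (Fin n → S) := fun w i => ⟨(w : E n ≃ₗᵢ[ℝ] E n) (e i), by
    obtain ⟨j, hj | hj⟩ := isSigned_of_mem_W0 w.2 i
    · exact Or.inl ⟨j, hj.symm⟩
    · exact Or.inr ⟨j, hj.symm⟩⟩
  refine Finite.of_injective f fun v w h => Subtype.ext (isometry_ext fun i => ?_)
  exact congrArg Subtype.val (congrFun h i)

lemma norm_sq_longRoot {β : E n} (hβ : β ∈ longRoots n) : inner ℝ β β = (2 : ℝ) := by
  rcases hβ with ⟨i, j, hij, rfl | rfl | rfl⟩ <;>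
  · simp only [inner_add_left, inner_add_right, inner_sub_left, inner_sub_right, inner_neg_left,
      inner_neg_right, inner_e_left]
    simp [e_apply, hij, hij.symm]
    norm_num

lemma posRoots_subset_roots : posRoots n ⊆ roots n := by
  rintro α (⟨i, j, hij, rfl | rfl⟩ | ⟨i, rfl⟩)
  · exact e_add_mem_roots hij.ne
  · exact e_sub_mem_roots hij.ne
  · exact e_mem_roots i

end SignedPermutations

/-! ### Blocks of coordinates and restricted roots -/

section Blocks

variable {k : ℕ} (κ : Composition k) (l : ℕ)

/-- The coordinate at position `d` of the `i`-th block. -/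
def pos (i : Fin κ.length) (d : Fin (κ.blocksFun i)) : Fin (k + l) :=
  Fin.castAdd l (κ.embedding i d)

lemma val_pos (i : Fin κ.length) (d : Fin (κ.blocksFun i)) :
    (pos κ l i d : ℕ) = κ.sizeUpTo i + d := rfl

lemma pos_lt (i : Fin κ.length) (d : Fin (κ.blocksFun i)) : (pos κ l i d : ℕ) < k :=
  (κ.embedding i d).2

lemma pos_or_natAdd (j : Fin (k + l)) :
    (∃ i d, j = pos κ l i d) ∨ ∃ b, j = Fin.natAdd k b := by
  induction j using Fin.addCases with
  | left a => exact Or.inl ⟨κ.index a, κ.invEmbedding a, by rw [pos, κ.embedding_comp_inv]⟩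
  | right b => exact Or.inr ⟨b, rfl⟩

lemma pos_ne_natAdd (i : Fin κ.length) (d : Fin (κ.blocksFun i)) (b : Fin l) :
    pos κ l i d ≠ Fin.natAdd k b := by
  intro h
  have := congrArg Fin.val h
  have := pos_lt κ l i d
  simp_all

lemma pos_block_eq {i i' : Fin κ.length} {d : Fin (κ.blocksFun i)} {d' : Fin (κ.blocksFun i')}
    (h : pos κ l i d = pos κ l i' d') : i = i' := by
  have h' : κ.embedding i d = κ.embedding i' d' := Fin.castAdd_injective k l h
  rw [← κ.index_embedding i d, h', κ.index_embedding]

lemma pos_injective (i : Fin κ.length) : Function.Injective (pos κ l i) :=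
  (Fin.castAdd_injective k l).comp (κ.embedding i).injective

lemma pos_inj {i : Fin κ.length} {d d' : Fin (κ.blocksFun i)} :
    pos κ l i d = pos κ l i d' ↔ d = d' := (pos_injective κ l i).eq_iff

lemma blocksFun_pos (i : Fin κ.length) : 0 < κ.blocksFun i := κ.one_le_blocksFun i

lemma pos_lt_pos_of_block_lt {i i' : Fin κ.length} (h : i < i') (d : Fin (κ.blocksFun i))
    (d' : Fin (κ.blocksFun i')) : pos κ l i d < pos κ l i' d' := by
  rw [Fin.lt_def, val_pos, val_pos]
  have h1 : κ.sizeUpTo (i + 1) ≤ κ.sizeUpTo i' := κ.monotone_sizeUpTo h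
  have h2 := κ.sizeUpTo_succ' i
  have := d.2
  omega

lemma block_le_of_pos_lt {i i' : Fin κ.length} {d : Fin (κ.blocksFun i)}
    {d' : Fin (κ.blocksFun i')} (h : pos κ l i d < pos κ l i' d') : i ≤ i' := by
  by_contra hlt
  exact absurd (pos_lt_pos_of_block_lt κ l (not_le.1 hlt) d' d) (not_lt.2 h.le)

lemma sum_coords {M : Type*} [AddCommMonoid M] (f : Fin (k + l) → M) :
    ∑ j, f j = (∑ i, ∑ d, f (pos κ l i d)) + ∑ b, f (Fin.natAdd k b) := by
  rw [Fin.sum_univ_add, ← κ.blocksFinEquiv.sum_comp, Fintype.sum_sigma]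
  rfl

/-- The sum of the coordinates in the `i`-th block. -/
def blockSum (i : Fin κ.length) : E (k + l) →ₗ[ℝ] ℝ where
  toFun x := ∑ d, x (pos κ l i d)
  map_add' x y := by simp [Finset.sum_add_distrib]
  map_smul' a x := by simp [Finset.mul_sum]

/-- The centre of the `i`-th block: the average of its basis vectors. It is the restriction
`[e_a]^L` for each `a` in the block. -/
def center (i : Fin κ.length) : E (k + l) := (κ.blocksFun i : ℝ)⁻¹ • ∑ d, e (pos κ l i d)

lemma blockSum_apply (i : Fin κ.length) (x : E (k + l)) :
    blockSum κ l i x = ∑ d, x (pos κ l i d) := rfl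

lemma blockSum_e_pos (i i' : Fin κ.length) (d : Fin (κ.blocksFun i')) :
    blockSum κ l i (e (pos κ l i' d)) = if i = i' then 1 else 0 := by
  rw [blockSum_apply]
  split_ifs with h
  · subst h
    simp [e_apply, pos_inj]
  · refine Finset.sum_eq_zero fun d' _ => ?_
    rw [e_apply, if_neg]
    exact fun h' => h (pos_block_eq κ l h')

lemma blockSum_e_natAdd (i : Fin κ.length) (b : Fin l) :
    blockSum κ l i (e (Fin.natAdd k b)) = 0 := by
  rw [blockSum_apply]
  refine Finset.sum_eq_zero fun d' _ => ?_
  rw [e_apply, if_neg (pos_ne_natAdd κ l i d' b)]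

lemma blockSum_e_nonneg (i : Fin κ.length) (a : Fin (k + l)) : 0 ≤ blockSum κ l i (e a) := by
  rcases pos_or_natAdd κ l a with ⟨i', d, rfl⟩ | ⟨b, rfl⟩
  · rw [blockSum_e_pos]
    split_ifs <;> norm_num
  · rw [blockSum_e_natAdd]

lemma exists_pos_of_blockSum_pos {i : Fin κ.length} {a : Fin (k + l)}
    (h : 0 < blockSum κ l i (e a)) : ∃ d, a = pos κ l i d := by
  rcases pos_or_natAdd κ l a with ⟨i', d, rfl⟩ | ⟨b, rfl⟩
  · rw [blockSum_e_pos] at h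
    split_ifs at h with hi
    · subst hi
      exact ⟨d, rfl⟩
    · exact absurd h (lt_irrefl _)
  · rw [blockSum_e_natAdd] at h
    exact absurd h (lt_irrefl _)

lemma blockSum_center (i i' : Fin κ.length) :
    blockSum κ l i (center κ l i') = if i = i' then 1 else 0 := by
  have : (κ.blocksFun i' : ℝ) ≠ 0 := by exact_mod_cast (blocksFun_pos κ i').ne'
  rw [center, map_smul, map_sum]
  simp only [blockSum_e_pos]
  split_ifs with h <;> simp [this]

lemma inner_center (i : Fin κ.length) (x : E (k + l)) :
    inner ℝ x (center κ l i) = (κ.blocksFun i : ℝ)⁻¹ * blockSum κ l i x := by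
  rw [center, inner_smul_right, inner_sum, blockSum_apply]
  simp only [inner_e_right]

lemma pos_mem_levi (i : Fin κ.length) (a : ℕ) (h : a + 1 < κ.blocksFun i) :
    pos κ l i ⟨a, by omega⟩ ∈ levi κ l := by
  intro i' h'
  rw [val_pos] at h'
  dsimp at h'
  rcases le_or_gt i' (i : ℕ) with hle | hgt
  · have := κ.monotone_sizeUpTo hle
    omega
  · have := κ.monotone_sizeUpTo (show (i : ℕ) + 1 ≤ i' from hgt)
    have := κ.sizeUpTo_succ' i
    omega

lemma simpleRoot_pos (i : Fin κ.length) (a : ℕ) (h : a + 1 < κ.blocksFun i) :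
    simpleRoot (pos κ l i ⟨a, by omega⟩) =
      (e (pos κ l i ⟨a, by omega⟩) - e (pos κ l i ⟨a + 1, h⟩) : E (k + l)) := by
  have hlt : (pos κ l i ⟨a, by omega⟩ : ℕ) + 1 < k + l := by
    have := pos_lt κ l i ⟨a + 1, h⟩
    rw [val_pos] at this ⊢
    dsimp at this ⊢
    omega
  rw [simpleRoot, dif_pos hlt]
  rfl

lemma e_sub_e_mem_spanL {i : Fin κ.length} (d d' : Fin (κ.blocksFun i)) :
    (e (pos κ l i d) - e (pos κ l i d') : E (k + l)) ∈ spanL (levi κ l) := by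
  -- neighbouring coordinates differ by a simple root of the Levi
  have step : ∀ (a : ℕ) (h : a + 1 < κ.blocksFun i),
      (e (pos κ l i ⟨a, by omega⟩) - e (pos κ l i ⟨a + 1, h⟩) : E (k + l)) ∈
        spanL (levi κ l) := fun a h =>
    Submodule.subset_span ⟨_, pos_mem_levi κ l i a h, simpleRoot_pos κ l i a h⟩
  have key : ∀ (a : ℕ) (h : a < κ.blocksFun i),
      (e (pos κ l i ⟨0, by omega⟩) - e (pos κ l i ⟨a, h⟩) : E (k + l)) ∈ spanL (levi κ l) := by
    intro a
    induction a with
    | zero => intro h; simp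
    | succ a ih =>
      intro h
      have := Submodule.add_mem _ (ih (by omega)) (step a h)
      simpa using this
  have := Submodule.sub_mem _ (key d' d'.2) (key d d.2)
  simpa using this

lemma natAdd_mem_levi (b : Fin l) : Fin.natAdd k b ∈ levi κ l := by
  intro i h
  have := κ.sizeUpTo_le i
  simp at h
  omega

lemma e_natAdd_mem_spanL (b : Fin l) : (e (Fin.natAdd k b) : E (k + l)) ∈ spanL (levi κ l) := by
  -- descending induction, starting from the short simple root
  have key : ∀ (c : ℕ) (b : Fin l), (b : ℕ) + 1 + c = l →
      (e (Fin.natAdd k b) : E (k + l)) ∈ spanL (levi κ l) := by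
    intro c
    induction c with
    | zero =>
      intro b hb
      refine Submodule.subset_span ⟨_, natAdd_mem_levi κ l b, ?_⟩
      rw [simpleRoot, dif_neg (by simp; omega)]
    | succ c ih =>
      intro b hb
      have h1 := ih ⟨b + 1, by omega⟩ (by simp; omega)
      have h2 : simpleRoot (Fin.natAdd k b) ∈ spanL (levi κ l) :=
        Submodule.subset_span ⟨_, natAdd_mem_levi κ l b, rfl⟩
      rw [simpleRoot, dif_pos (by simp; omega)] at h2
      have h3 := Submodule.add_mem _ h2 h1
      have h4 : (⟨(Fin.natAdd k b : ℕ) + 1, by simp; omega⟩ : Fin (k + l)) =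
          Fin.natAdd k ⟨b + 1, by omega⟩ := by ext; simp; omega
      rw [h4] at h3
      simpa using h3
  exact key (l - 1 - b) b (by omega)

/-- A simple root of the Levi is short, or the difference of neighbouring coordinates in a block or
among the last `l` coordinates. -/
lemma simpleRoot_cases {j : Fin (k + l)} (hj : j ∈ levi κ l) :
    (∃ (i : Fin κ.length) (a : ℕ) (h : a + 1 < κ.blocksFun i), j = pos κ l i ⟨a, by omega⟩ ∧
      simpleRoot j = e (pos κ l i ⟨a, by omega⟩) - e (pos κ l i ⟨a + 1, h⟩)) ∨
    (∃ (b : ℕ) (h : b + 1 < l), j = Fin.natAdd k ⟨b, by omega⟩ ∧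
      simpleRoot j = e (Fin.natAdd k ⟨b, by omega⟩) - e (Fin.natAdd k ⟨b + 1, h⟩)) ∨
    ∃ b : Fin l, (b : ℕ) + 1 = l ∧ j = Fin.natAdd k b ∧ simpleRoot j = e (Fin.natAdd k b) := by
  rcases pos_or_natAdd κ l j with ⟨i, d, rfl⟩ | ⟨b, rfl⟩
  · left
    have h1 : (d : ℕ) + 1 < κ.blocksFun i := by
      have := hj ((i : ℕ) + 1)
      rw [val_pos, κ.sizeUpTo_succ' i] at this
      have := d.2
      omega
    exact ⟨i, d, h1, rfl, simpleRoot_pos κ l i d h1⟩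
  · right
    by_cases hb : (b : ℕ) + 1 < l
    · left
      refine ⟨b, hb, rfl, ?_⟩
      rw [simpleRoot, dif_pos (by simp; omega)]
      congr 2
    · right
      refine ⟨b, by omega, rfl, ?_⟩
      rw [simpleRoot, dif_neg (by simp; omega)]

lemma mem_spanL_iff {x : E (k + l)} : x ∈ spanL (levi κ l) ↔ ∀ i, blockSum κ l i x = 0 := by
  constructor
  · intro hx i
    have : spanL (levi κ l) ≤ LinearMap.ker (blockSum κ l i) := by
      refine Submodule.span_le.2 ?_
      rintro _ ⟨j, hj, rfl⟩
      rcases simpleRoot_cases κ l hj with ⟨i', a, h, -, h'⟩ | ⟨b, h, -, h'⟩ | ⟨b, h, -, h'⟩ <;>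
        simp only [SetLike.mem_coe, LinearMap.mem_ker, h', map_sub, blockSum_e_pos,
          blockSum_e_natAdd, sub_self]
    exact this hx
  · intro hx
    rw [← sum_smul_e x, sum_coords κ l]
    refine Submodule.add_mem _ (Submodule.sum_mem _ fun i _ => ?_) (Submodule.sum_mem _ fun b _ =>
      Submodule.smul_mem _ _ (e_natAdd_mem_spanL κ l b))
    have h0 := blocksFun_pos κ i
    have : ∑ d, x (pos κ l i d) • (e (pos κ l i d) : E (k + l)) =
        ∑ d, x (pos κ l i d) • (e (pos κ l i d) - e (pos κ l i ⟨0, h0⟩) : E (k + l)) := by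
      simp only [smul_sub, Finset.sum_sub_distrib]
      rw [← Finset.sum_smul, ← blockSum_apply, hx i, zero_smul, sub_zero]
    rw [this]
    exact Submodule.sum_mem _ fun d _ => Submodule.smul_mem _ _ (e_sub_e_mem_spanL κ l _ _)

lemma res_eq (x : E (k + l)) : res (levi κ l) x = ∑ i, blockSum κ l i x • center κ l i := by
  rw [res]
  have hmem : ∑ i, blockSum κ l i x • center κ l i ∈ (spanL (levi κ l))ᗮ := by
    refine Submodule.sum_mem _ fun i _ => Submodule.smul_mem _ _ ?_
    rw [Submodule.mem_orthogonal]
    intro u hu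
    rw [inner_center, (mem_spanL_iff κ l).1 hu i, mul_zero]
  have hsub : x - ∑ i, blockSum κ l i x • center κ l i ∈ (spanL (levi κ l))ᗮᗮ := by
    refine Submodule.le_orthogonal_orthogonal _ ?_
    rw [mem_spanL_iff]
    intro i
    simp [blockSum_center]
  exact (Submodule.eq_starProjection_of_mem_orthogonal hmem hsub)

lemma blockSum_res (i : Fin κ.length) (x : E (k + l)) :
    blockSum κ l i (res (levi κ l) x) = blockSum κ l i x := by
  simp [res_eq, blockSum_center]

lemma projL_eq (x : E (k + l)) : projL (levi κ l) x = x - res (levi κ l) x := by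
  have : (spanL (levi κ l)).starProjection x + res (levi κ l) x = x :=
    Submodule.starProjection_add_starProjection_orthogonal x
  exact eq_sub_of_add_eq this

lemma res_e_pos (i : Fin κ.length) (d : Fin (κ.blocksFun i)) :
    res (levi κ l) (e (pos κ l i d)) = center κ l i := by
  rw [res_eq]
  simp [blockSum_e_pos]

lemma res_e_natAdd (b : Fin l) : res (levi κ l) (e (Fin.natAdd k b)) = 0 := by
  rw [res_eq]
  simp [blockSum_e_natAdd]

lemma res_add (L : Set (Fin (k + l))) (x y : E (k + l)) : res L (x + y) = res L x + res L y :=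
  map_add _ x y

lemma res_sub (L : Set (Fin (k + l))) (x y : E (k + l)) : res L (x - y) = res L x - res L y :=
  map_sub _ x y

lemma center_apply_pos (i i' : Fin κ.length) (d : Fin (κ.blocksFun i')) :
    center κ l i (pos κ l i' d) = if i = i' then (κ.blocksFun i : ℝ)⁻¹ else 0 := by
  have h := inner_center κ l i (e (pos κ l i' d))
  rw [inner_e_left, blockSum_e_pos] at h
  rw [h]
  simp

lemma center_apply_natAdd (i : Fin κ.length) (b : Fin l) :
    center κ l i (Fin.natAdd k b) = 0 := by
  have h := inner_center κ l i (e (Fin.natAdd k b))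
  rw [inner_e_left, blockSum_e_natAdd] at h
  rw [h, mul_zero]

lemma inner_center_center (i : Fin κ.length) :
    inner ℝ (center κ l i) (center κ l i) = (κ.blocksFun i : ℝ)⁻¹ := by
  rw [inner_center, blockSum_center, if_pos rfl, mul_one]

lemma mem_rootsL_iff {α : E (k + l)} :
    α ∈ rootsL (levi κ l) ↔ α ∈ roots (k + l) ∧ ∀ i, blockSum κ l i α = 0 := by
  rw [← mem_spanL_iff]
  rfl

/-- A vector which is a root takes integral values under all block sums. -/
lemma exists_int_blockSum {α : E (k + l)} (hα : α ∈ roots (k + l)) (i : Fin κ.length) :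
    ∃ z : ℤ, blockSum κ l i α = z := by
  have he : ∀ j : Fin (k + l), ∃ z : ℤ, blockSum κ l i (e j) = z := by
    intro j
    rcases pos_or_natAdd κ l j with ⟨i', d, rfl⟩ | ⟨b, rfl⟩
    · rw [blockSum_e_pos]
      split_ifs
      · exact ⟨1, by simp⟩
      · exact ⟨0, by simp⟩
    · exact ⟨0, by simp [blockSum_e_natAdd]⟩
  rcases hα with ⟨a, b, -, h⟩ | ⟨a, h⟩
  · obtain ⟨y, hy⟩ := he a
    obtain ⟨z, hz⟩ := he b
    rcases h with rfl | rfl | rfl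
    · exact ⟨y + z, by simp [hy, hz]⟩
    · exact ⟨y - z, by simp [hy, hz]⟩
    · exact ⟨-(y + z), by simp [hy, hz]⟩
  · obtain ⟨y, hy⟩ := he a
    rcases h with rfl | rfl
    · exact ⟨y, hy⟩
    · exact ⟨-y, by simp [hy]⟩

/-- A restricted root on which some block sum is `1` is primitive, because block sums of roots are
integral. -/
lemma isPrimitive_of_blockSum_eq_one {α : E (k + l)} (hα : α ∈ roots (k + l)) (i : Fin κ.length)
    (h : blockSum κ l i α = 1) : IsPrimitive (levi κ l) (res (levi κ l) α) := by
  refine ⟨⟨α, hα, fun h' => ?_, rfl⟩, ?_⟩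
  · have := ((mem_rootsL_iff κ l).1 h').2 i
    linarith
  · rintro γ hγ - ⟨a, ha, hγa⟩
    obtain ⟨z, hz⟩ := exists_int_blockSum κ l hγ i
    have h1 := congrArg (blockSum κ l i) hγa
    rw [map_smul, blockSum_res, blockSum_res, h, hz, smul_eq_mul, mul_one] at h1
    have hz0 : 0 < z := by rw [← h1] at ha; exact_mod_cast ha
    refine ⟨z.toNat, by omega, ?_⟩
    have : ((z.toNat : ℕ) : ℝ) = (z : ℝ) := by
      exact_mod_cast congrArg (Int.cast (R := ℝ)) (Int.toNat_of_nonneg hz0.le)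
    rw [hγa, this, h1]

end Blocks

/-! ### Gluing strips: the boxes just outside a Young diagram -/

section Gluing

variable (μ : YoungDiagram)

lemma exists_notMem_diagonal (z : ℤ) :
    ∃ i : ℕ, 0 ≤ (i : ℤ) + z ∧ (i, ((i : ℤ) + z).toNat) ∉ μ := by
  refine ⟨μ.colLen 0 + z.natAbs, by omega, fun h => ?_⟩
  have h1 := YoungDiagram.mem_iff_lt_colLen.1 h
  have h2 := μ.colLen_anti 0 _ (Nat.zero_le ((((μ.colLen 0 + z.natAbs : ℕ) : ℤ) + z).toNat))
  omega

open Classical in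
/-- The row of the first box outside `μ` on the diagonal of boxes with content `z`. -/
def outerRow (z : ℤ) : ℕ := Nat.find (exists_notMem_diagonal μ z)

lemma outerRow_add_nonneg (z : ℤ) : 0 ≤ (outerRow μ z : ℤ) + z := by
  classical
  exact (Nat.find_spec (exists_notMem_diagonal μ z)).1

lemma mem_iff_lt_outerRow (i j : ℕ) : (i, j) ∈ μ ↔ i < outerRow μ (j - i) := by
  classical
  constructor
  · intro h
    by_contra hle
    have hs := (Nat.find_spec (exists_notMem_diagonal μ ((j : ℤ) - i))).2
    refine hs (μ.up_left_mem (not_lt.1 hle) ?_ h)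
    have : (Nat.find (exists_notMem_diagonal μ ((j : ℤ) - i)) : ℤ) ≤ i := by
      exact_mod_cast not_lt.1 hle
    omega
  · intro h
    have h1 := Nat.find_min (exists_notMem_diagonal μ ((j : ℤ) - i)) h
    by_contra h2
    exact h1 ⟨by omega, by simpa using h2⟩

lemma outerRow_succ_le (z : ℤ) : outerRow μ (z + 1) ≤ outerRow μ z := by
  by_contra hlt
  have h0 := outerRow_add_nonneg μ z
  have h1 := (mem_iff_lt_outerRow μ (outerRow μ z) (outerRow μ z + z + 1).toNat).2 (by
    rw [show (((outerRow μ z + z + 1).toNat : ℕ) : ℤ) - outerRow μ z = z + 1 by omega]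
    omega)
  have h2 := μ.up_left_mem le_rfl
    (show ((outerRow μ z : ℤ) + z).toNat ≤ ((outerRow μ z : ℤ) + z + 1).toNat by omega) h1
  rw [mem_iff_lt_outerRow, show ((((outerRow μ z : ℤ) + z).toNat : ℕ) : ℤ) - outerRow μ z = z by
    omega] at h2
  exact lt_irrefl _ h2

lemma outerRow_le_succ (z : ℤ) : outerRow μ z ≤ outerRow μ (z + 1) + 1 := by
  by_contra hlt
  set R := outerRow μ (z + 1) with hR
  have h0 := outerRow_add_nonneg μ (z + 1)
  have h1 := (mem_iff_lt_outerRow μ (R + 1) (R + 1 + z).toNat).2 (by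
    rw [show ((((R : ℤ) + 1 + z).toNat : ℕ) : ℤ) - ((R + 1 : ℕ) : ℤ) = z by push_cast; omega]
    omega)
  have h2 := μ.up_left_mem (Nat.le_succ R) le_rfl h1
  rw [mem_iff_lt_outerRow, show ((((R : ℤ) + 1 + z).toNat : ℕ) : ℤ) - R = z + 1 by omega] at h2
  exact lt_irrefl _ h2

/-- The first box outside `μ` on the diagonal of boxes with content `z`. -/
def outerBox (z : ℤ) : ℕ × ℕ := (outerRow μ z, ((outerRow μ z : ℤ) + z).toNat)

lemma content_outerBox (z : ℤ) : content (outerBox μ z) = z := by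
  have := outerRow_add_nonneg μ z
  simp only [content, outerBox]
  omega

lemma outerBox_notMem (z : ℤ) : outerBox μ z ∉ μ := by
  have := outerRow_add_nonneg μ z
  rw [outerBox, mem_iff_lt_outerRow,
    show ((((outerRow μ z : ℤ) + z).toNat : ℕ) : ℤ) - outerRow μ z = z by omega]
  exact lt_irrefl _

lemma outerBox_injective : Function.Injective (outerBox μ) := by
  intro y z h
  rw [← content_outerBox μ y, h, content_outerBox]

/-- A box outside `μ` lies weakly below the first one on its diagonal. -/
lemma outerBox_le {x : ℕ × ℕ} (hx : x ∉ μ) : outerBox μ (content x) ≤ x := by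
  obtain ⟨i, j⟩ := x
  rw [mem_iff_lt_outerRow] at hx
  have := outerRow_add_nonneg μ ((j : ℤ) - i)
  refine ⟨by simpa [outerBox, content] using hx, ?_⟩
  simp only [outerBox, content]
  omega

/-- The number of boxes of `μ` whose content is the real number `x`. -/
def contentCount (x : ℝ) : ℤ := ((μ.cells.filter fun b => (content b : ℝ) = x).card : ℤ)

lemma contentCount_intCast (z : ℤ) :
    contentCount μ z = outerRow μ z - max 0 (-z) := by
  have h0 := outerRow_add_nonneg μ z
  have : (μ.cells.filter fun b => (content b : ℝ) = (z : ℝ)) =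
      (Finset.Ico (max 0 (-z)).toNat (outerRow μ z)).image
        fun i : ℕ => (i, ((i : ℤ) + z).toNat) := by
    ext ⟨i, j⟩
    simp only [Finset.mem_filter, YoungDiagram.mem_cells, Finset.mem_image, Finset.mem_Ico,
      Int.cast_inj, Prod.mk.injEq]
    constructor
    · rintro ⟨h, hc⟩
      rw [mem_iff_lt_outerRow] at h
      simp only [content] at hc
      rw [hc] at h
      exact ⟨i, ⟨by omega, h⟩, rfl, by omega⟩
    · rintro ⟨a, ⟨h1, h2⟩, rfl, rfl⟩
      have : (((a : ℤ) + z).toNat : ℤ) - a = z := by omega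
      rw [mem_iff_lt_outerRow, this]
      exact ⟨h2, by simpa [content] using this⟩
  rw [contentCount, this, Finset.card_image_of_injective _ fun a b h => (Prod.mk.inj h).1,
    Nat.card_Ico]
  omega

lemma contentCount_eq_zero {x : ℝ} (hx : ∀ z : ℤ, (z : ℝ) ≠ x) : contentCount μ x = 0 := by
  rw [contentCount, Finset.filter_false_of_mem fun b _ => hx _]
  rfl

/-- Going up one diagonal in the rim: to the right if `outerRow` does not change, and up otherwise. -/
lemma outerBox_succ (z : ℤ) :
    ((outerBox μ (z + 1)).1 = (outerBox μ z).1 ∧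
      (outerBox μ (z + 1)).2 = (outerBox μ z).2 + 1) ∨
    ((outerBox μ (z + 1)).1 + 1 = (outerBox μ z).1 ∧
      (outerBox μ (z + 1)).2 = (outerBox μ z).2) := by
  have h1 := outerRow_succ_le μ z
  have h2 := outerRow_le_succ μ z
  have h3 := outerRow_add_nonneg μ z
  have h4 := outerRow_add_nonneg μ (z + 1)
  simp only [outerBox]
  omega

variable {μ}

/-- The rim hook with contents `c, …, c + p - 1` can be added to `μ` as soon as the boundary of `μ`
goes up before it and to the right after it. -/
lemma canGlue_of_outerRow {m : ℝ} {p : ℕ} {c : ℤ}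
    (hc : (c : ℝ) + m = -(((p : ℝ) - 1) / 2)) (h1 : outerRow μ (c - 1) = outerRow μ c + 1)
    (h2 : outerRow μ (c + p - 1) = outerRow μ (c + p)) : CanGlue m μ p := by
  classical
  have hlower : IsLowerSet
      ((μ.cells ∪ (Finset.Ico c (c + p)).image (outerBox μ) : Finset (ℕ × ℕ)) :
        Set (ℕ × ℕ)) := by
    -- a box of the diagram together with the strip has its left and upper neighbours there
    have left : ∀ i j, (i, j + 1) ∈ μ.cells ∪ (Finset.Ico c (c + p)).image (outerBox μ) →
        (i, j) ∈ μ.cells ∪ (Finset.Ico c (c + p)).image (outerBox μ) := by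
      intro i j h
      rw [Finset.mem_union, Finset.mem_image] at h ⊢
      rcases h with h | ⟨z, hz, hb⟩
      · exact Or.inl (μ.up_left_mem le_rfl (Nat.le_succ j) h)
      · rw [Finset.mem_Ico] at hz
        have e1 : outerRow μ z = i := congrArg Prod.fst hb
        have e2 : ((outerRow μ z : ℤ) + z).toNat = j + 1 := congrArg Prod.snd hb
        have hj : (j : ℤ) - i = z - 1 := by omega
        have s1 := outerRow_succ_le μ (z - 1)
        rw [sub_add_cancel] at s1
        rcases s1.lt_or_eq with hlt | heq
        · left
          rw [YoungDiagram.mem_cells, mem_iff_lt_outerRow, hj, ← e1]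
          exact hlt
        · right
          refine ⟨z - 1, ?_, ?_⟩
          · rw [Finset.mem_Ico]
            refine ⟨?_, by omega⟩
            by_contra hlt
            have : z = c := by omega
            subst this
            omega
          · ext
            · simp only [outerBox]; omega
            · simp only [outerBox]; omega
    have up : ∀ i j, (i + 1, j) ∈ μ.cells ∪ (Finset.Ico c (c + p)).image (outerBox μ) →
        (i, j) ∈ μ.cells ∪ (Finset.Ico c (c + p)).image (outerBox μ) := by
      intro i j h
      rw [Finset.mem_union, Finset.mem_image] at h ⊢
      rcases h with h | ⟨z, hz, hb⟩
      · exact Or.inl (μ.up_left_mem (Nat.le_succ i) le_rfl h)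
      · rw [Finset.mem_Ico] at hz
        have e1 : outerRow μ z = i + 1 := congrArg Prod.fst hb
        have e2 : ((outerRow μ z : ℤ) + z).toNat = j := congrArg Prod.snd hb
        have h0 := outerRow_add_nonneg μ z
        have hj : (j : ℤ) - i = z + 1 := by omega
        have s2 := outerRow_le_succ μ z
        by_cases hlt : i < outerRow μ (z + 1)
        · left
          rw [YoungDiagram.mem_cells, mem_iff_lt_outerRow, hj]
          exact hlt
        · right
          refine ⟨z + 1, ?_, ?_⟩
          · rw [Finset.mem_Ico]
            refine ⟨by omega, ?_⟩
            by_contra hge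
            have hz' : z = c + p - 1 := by omega
            rw [hz', sub_add_cancel] at hlt
            rw [hz'] at e1
            omega
          · ext
            · simp only [outerBox]; omega
            · simp only [outerBox]; omega
    have leftn : ∀ i j t, (i, j + t) ∈ μ.cells ∪ (Finset.Ico c (c + p)).image (outerBox μ) →
        (i, j) ∈ μ.cells ∪ (Finset.Ico c (c + p)).image (outerBox μ) := by
      intro i j t
      induction t with
      | zero => exact id
      | succ t ih => exact fun h => ih (left i (j + t) h)
    have upn : ∀ i j t, (i + t, j) ∈ μ.cells ∪ (Finset.Ico c (c + p)).image (outerBox μ) →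
        (i, j) ∈ μ.cells ∪ (Finset.Ico c (c + p)).image (outerBox μ) := by
      intro i j t
      induction t with
      | zero => exact id
      | succ t ih => exact fun h => ih (up (i + t) j h)
    rintro ⟨i', j'⟩ ⟨i, j⟩ ⟨hi, hj⟩ hmem
    obtain ⟨s, rfl⟩ := Nat.exists_eq_add_of_le (show i ≤ i' from hi)
    obtain ⟨t, rfl⟩ := Nat.exists_eq_add_of_le (show j ≤ j' from hj)
    exact leftn i j t (upn i (j + t) s hmem)
  refine ⟨⟨_, hlower⟩, fun d => outerBox μ (c + d), Finset.subset_union_left, ?_, ?_, ?_, ?_⟩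
  · intro d d' h
    have := outerBox_injective μ h
    exact Fin.ext (by omega)
  · ext x
    simp only [Set.mem_range, Set.mem_ofPred_eq, ← YoungDiagram.mem_cells, Finset.mem_union,
      Finset.mem_image, Finset.mem_Ico]
    constructor
    · rintro ⟨d, rfl⟩
      exact ⟨Or.inr ⟨c + d, by omega, rfl⟩, outerBox_notMem μ _⟩
    · rintro ⟨h | ⟨z, hz, rfl⟩, hx⟩
      · exact absurd h hx
      · exact ⟨⟨(z - c).toNat, by omega⟩, by congr 1; dsimp; omega⟩
  · intro d d' h
    dsimp only
    rw [show c + ((d' : ℕ) : ℤ) = c + ((d : ℕ) : ℤ) + 1 by omega]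
    exact outerBox_succ μ _
  · intro d
    rw [content_outerBox, ← hc]
    push_cast
    congr 1
    ring

lemma outerRow_of_canGlue {m : ℝ} {p : ℕ} (hp : 0 < p) (h : CanGlue m μ p) :
    ∃ c : ℤ, (c : ℝ) + m = -(((p : ℝ) - 1) / 2) ∧ outerRow μ (c - 1) = outerRow μ c + 1 ∧
      outerRow μ (c + p - 1) = outerRow μ (c + p) := by
  obtain ⟨ν, b, hle, -, hran, hstep, hval⟩ := h
  have hcont : ∀ (d : ℕ) (hd : d < p), content (b ⟨d, hd⟩) = content (b ⟨0, hp⟩) + d := by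
    intro d
    induction d with
    | zero => intro _; simp
    | succ d ih =>
      intro hd
      have h1 := ih (by omega)
      have h2 := hstep ⟨d, by omega⟩ ⟨d + 1, hd⟩ rfl
      simp only [content] at h1 ⊢
      push_cast
      omega
  set c := content (b ⟨0, hp⟩) with hcdef
  have hc : (c : ℝ) + m = -(((p : ℝ) - 1) / 2) := by
    have h0 := hval ⟨0, hp⟩
    rw [← hcdef] at h0
    simp only [Nat.cast_zero, add_zero] at h0
    rcases abs_eq_abs.1 h0 with h0 | h0
    · exact h0
    · -- a strip starting at the other end would have a second entry that is too large
      rcases Nat.lt_or_ge 1 p with hp1 | hp1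
      · have h1 := hval ⟨1, hp1⟩
        have hp2 : (2 : ℝ) ≤ p := by exact_mod_cast hp1
        rw [hcont 1 hp1] at h1
        push_cast at h1
        rcases abs_eq_abs.1 h1 with h1 | h1 <;> linarith
      · have : p = 1 := by omega
        subst this
        simp at h0 ⊢
        linarith
  have hbox : ∀ x, x ∈ ν → x ∉ μ → ∃ d : ℕ, d < p ∧ content x = c + d := by
    intro x hx hx'
    have : x ∈ Set.range b := by rw [hran]; exact ⟨hx, hx'⟩
    obtain ⟨d, rfl⟩ := this
    exact ⟨d, d.2, hcont d d.2⟩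
  -- on each of its diagonals, the strip contains the first box outside `μ`
  have hout : ∀ d : ℕ, d < p → outerBox μ (c + d) ∈ ν := by
    intro d hd
    have hb : b ⟨d, hd⟩ ∈ {x | x ∈ ν ∧ x ∉ μ} := hran ▸ Set.mem_range_self _
    rw [← hcont d hd]
    have := outerBox_le μ hb.2
    exact ν.up_left_mem this.1 this.2 hb.1
  refine ⟨c, hc, ?_, ?_⟩
  · have h1 := outerRow_succ_le μ (c - 1)
    have h2 := outerRow_le_succ μ (c - 1)
    rw [sub_add_cancel] at h1 h2
    by_contra hne
    have heq : outerRow μ (c - 1) = outerRow μ c := by omega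
    have h3 := hout 0 hp
    rw [Nat.cast_zero, add_zero] at h3
    have h4 : outerBox μ (c - 1) ∈ ν := by
      refine ν.up_left_mem heq.le ?_ h3
      omega
    obtain ⟨d, -, hd⟩ := hbox _ h4 (outerBox_notMem μ _)
    rw [content_outerBox] at hd
    omega
  · have h1 := outerRow_succ_le μ (c + p - 1)
    have h2 := outerRow_le_succ μ (c + p - 1)
    rw [sub_add_cancel] at h1 h2
    by_contra hne
    have h3 := hout (p - 1) (by omega)
    rw [show c + ((p - 1 : ℕ) : ℤ) = c + p - 1 by omega] at h3
    have h4 : outerBox μ (c + p) ∈ ν := by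
      have := outerRow_add_nonneg μ (c + p)
      refine ν.up_left_mem h1 ?_ h3
      omega
    obtain ⟨d, hd', hd⟩ := hbox _ h4 (outerBox_notMem μ _)
    rw [content_outerBox] at hd
    omega

open Classical in
/-- The number on the left is the pole order of `c_β` for `β` the center of a block of length
`p`. It is `1 - ε(c - 1) + ε(c + p - 1)` with `c + m = -(p - 1) / 2` and
`ε(z) = outerRow z - outerRow (z + 1) ∈ {0, 1}`, provided that `c` is an integer. -/
lemma poleOrder_pos_iff_not_canGlue {m : ℝ} {p : ℕ} (hp : 0 < p) :
    0 < 1 - (if ∃ d : Fin p, -(((p : ℝ) - 1) / 2) + (d : ℕ) = -m then 1 else 0 : ℤ)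
      + (contentCount μ (-(((p : ℝ) - 1) / 2) - m) - contentCount μ (((p : ℝ) - 1) / 2 + 1 - m))
      + (contentCount μ (((p : ℝ) - 1) / 2 - m) - contentCount μ (-(((p : ℝ) - 1) / 2) - 1 - m))
    ↔ ¬ CanGlue m μ p := by
  by_cases hint : ∃ c : ℤ, (c : ℝ) + m = -(((p : ℝ) - 1) / 2)
  · obtain ⟨c, hc⟩ := hint
    have e1 : -(((p : ℝ) - 1) / 2) - m = (c : ℤ) := by linarith
    have e2 : ((p : ℝ) - 1) / 2 + 1 - m = ((c + p : ℤ) : ℝ) := by push_cast; linarith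
    have e3 : ((p : ℝ) - 1) / 2 - m = ((c + p - 1 : ℤ) : ℝ) := by push_cast; linarith
    have e4 : -(((p : ℝ) - 1) / 2) - 1 - m = ((c - 1 : ℤ) : ℝ) := by push_cast; linarith
    have hd : (∃ d : Fin p, -(((p : ℝ) - 1) / 2) + (d : ℕ) = -m) ↔ 0 ≤ c + p - 1 ∧ c ≤ 0 := by
      constructor
      · rintro ⟨d, hd⟩
        have : (d : ℝ) = ((c + p - 1 : ℤ) : ℝ) := by push_cast; linarith
        have : ((d : ℕ) : ℤ) = c + p - 1 := by exact_mod_cast this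
        omega
      · rintro ⟨h1, h2⟩
        refine ⟨⟨(c + p - 1).toNat, by omega⟩, ?_⟩
        have : (((c + p - 1).toNat : ℕ) : ℝ) = ((c + p - 1 : ℤ) : ℝ) := by
          exact_mod_cast congrArg (Int.cast (R := ℝ)) (Int.toNat_of_nonneg h1)
        simp only [this]
        push_cast
        linarith
    rw [e1, e2, e3, e4]
    simp only [contentCount_intCast, hd]
    have a1 := outerRow_succ_le μ (c - 1)
    have a2 := outerRow_le_succ μ (c - 1)
    have a3 := outerRow_succ_le μ (c + p - 1)
    have a4 := outerRow_le_succ μ (c + p - 1)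
    rw [sub_add_cancel] at a1 a2 a3 a4
    have hiff : CanGlue m μ p ↔ outerRow μ (c - 1) = outerRow μ c + 1 ∧
        outerRow μ (c + p - 1) = outerRow μ (c + p) := by
      constructor
      · intro h
        obtain ⟨c', hc', h'⟩ := outerRow_of_canGlue hp h
        have : c' = c := by
          have : (c' : ℝ) = c := by linarith
          exact_mod_cast this
        exact this ▸ h'
      · rintro ⟨h1, h2⟩
        exact canGlue_of_outerRow hc h1 h2
    rw [hiff]
    split_ifs <;> omega
  · have hno : ∀ (x : ℝ) (a : ℤ), x + m = -(((p : ℝ) - 1) / 2) + a → contentCount μ x = 0 := by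
      intro x a hx
      refine contentCount_eq_zero μ fun z hz => hint ⟨z - a, ?_⟩
      push_cast
      linarith
    have hd : ¬ ∃ d : Fin p, -(((p : ℝ) - 1) / 2) + (d : ℕ) = -m := by
      rintro ⟨d, hd⟩
      refine hint ⟨d - p + 1, ?_⟩
      push_cast
      linarith
    rw [if_neg hd, hno _ 0 (by push_cast; ring), hno _ p (by push_cast; ring),
      hno _ (p - 1) (by push_cast; ring), hno _ (-1) (by push_cast; ring)]
    simp only [sub_zero, add_zero, zero_lt_one, true_iff]
    intro h
    obtain ⟨c, hc, -⟩ := outerRow_of_canGlue hp h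
    exact hint ⟨c, hc⟩

end Gluing

/-! ### Orders of the factors of the `c`-function -/

section Orders

lemma meromorphicOrderAt_one_sub_mul_exp {A a : ℂ} (ha : a ≠ 0) [Decidable (A = 1)] :
    meromorphicOrderAt (fun s : ℂ => 1 - A * Complex.exp (-(s * a))) 0 =
      ((if A = 1 then 1 else 0 : ℤ) : WithTop ℤ) := by
  have han : AnalyticAt ℂ (fun s : ℂ => 1 - A * Complex.exp (-(s * a))) 0 := by fun_prop
  rw [han.meromorphicOrderAt_eq]
  split_ifs with h
  · subst h
    have hd : HasDerivAt (fun s : ℂ => 1 - 1 * Complex.exp (-(s * a))) a 0 := by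
      have h1 : HasDerivAt (fun s : ℂ => -(s * a)) (-(1 * a)) 0 :=
        ((hasDerivAt_id (0 : ℂ)).mul_const a).neg
      have := (h1.cexp.const_mul 1).const_sub 1
      simpa using this
    rw [han.analyticOrderAt_eq_one_of_zero_deriv_ne_zero (by simp) (by rw [hd.deriv]; exact ha)]
    rfl
  · rw [han.analyticOrderAt_eq_zero.2 (by simpa [sub_eq_zero] using Ne.symm h)]
    rfl

variable {n : ℕ} (D : Datum n)

lemma Datum.qHalf_pos (α : E n) : 0 < D.qHalf α := by
  unfold Datum.qHalf
  split_ifs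
  exacts [one_pos, D.qh_pos]

open Classical in
/-- The exponent `j` such that `q_{α^∨} q_{α^∨/2}^{1/2} = q₁ ^ j`, given that `q₂ = q₁ ^ m`. -/
def labelExp (m : ℝ) (α : E n) : ℝ := if α ∈ longRoots n then 1 else m

lemma Datum.q_mul_sqrt_qHalf {m : ℝ} (hm : D.q₂ = D.q₁ ^ m) (α : E n) :
    √(D.qHalf α) * D.q α = D.q₁ ^ labelExp m α := by
  unfold Datum.qHalf Datum.q labelExp
  split_ifs
  · simp
  · rw [← hm, Datum.q₂, mul_comm]

lemma Datum.rpow_eq_iff (hq₁ : D.q₁ ≠ 1) (x y : ℝ) : D.q₁ ^ x = D.q₁ ^ y ↔ x = y := by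
  rw [← Real.logb_eq_iff_rpow_eq D.q₁_pos hq₁ (Real.rpow_pos_of_pos D.q₁_pos y),
    Real.logb_rpow D.q₁_pos hq₁, eq_comm]

open Classical in
/-- If `α` takes the value `q₁ ^ y` at the base point, the order of `c_α` there. -/
def rootOrder (m : ℝ) (α : E n) (y : ℝ) : ℤ :=
  (if y = -labelExp m α then 1 else 0) - (if y = 0 then 1 else 0)

/-- At a point where the root takes a positive real value, only the factors `1 - z` and
`1 - q_{α^∨/2}^{-1/2} q_{α^∨}^{-1} z` of `c_α` can vanish. -/
lemma meromorphicOrderAt_cVal {m : ℝ} (hq₁ : D.q₁ ≠ 1) (hm : D.q₂ = D.q₁ ^ m) (α : E n) (y : ℝ)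
    {a : ℂ} (ha : a ≠ 0) :
    MeromorphicAt (fun s => cVal D α (((D.q₁ ^ y : ℝ) : ℂ)⁻¹ * Complex.exp (-(s * a)))) 0 ∧
    meromorphicOrderAt
      (fun s => cVal D α (((D.q₁ ^ y : ℝ) : ℂ)⁻¹ * Complex.exp (-(s * a)))) 0 =
      (rootOrder m α y : WithTop ℤ) := by
  classical
  set A : ℂ := ((D.q₁ ^ y : ℝ) : ℂ)⁻¹ with hA
  have hApos : 0 < (D.q₁ ^ y)⁻¹ := inv_pos.2 (Real.rpow_pos_of_pos D.q₁_pos y)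
  have hAre : A = (((D.q₁ ^ y)⁻¹ : ℝ) : ℂ) := by push_cast; rfl
  set h : ℝ := (√(D.qHalf α))⁻¹ with hh
  have hhpos : 0 < h := inv_pos.2 (Real.sqrt_pos.2 (D.qHalf_pos α))
  set f : ℝ → ℂ → ℂ := fun B s => 1 - ((B * (D.q₁ ^ y)⁻¹ : ℝ) : ℂ) * Complex.exp (-(s * a))
    with hf
  have hfm : ∀ B, MeromorphicAt (f B) 0 := fun B => by
    have : AnalyticAt ℂ (f B) 0 := by simp only [hf]; fun_prop
    exact this.meromorphicAt
  have hford : ∀ B, meromorphicOrderAt (f B) 0 =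
      ((if B * (D.q₁ ^ y)⁻¹ = 1 then 1 else 0 : ℤ) : WithTop ℤ) := by
    intro B
    rw [hf]
    simp only
    rw [meromorphicOrderAt_one_sub_mul_exp ha]
    congr 2
    simp only [eq_iff_iff]
    norm_cast
  have heq : (fun s => cVal D α (A * Complex.exp (-(s * a)))) =
      (f (-h) * f (h * (D.q α)⁻¹)) / (f (-1) * f 1) := by
    funext s
    simp only [cVal, hf, Pi.div_apply, Pi.mul_apply, hAre, hh]
    push_cast
    ring
  have hneg : ∀ B : ℝ, B < 0 → B * (D.q₁ ^ y)⁻¹ ≠ 1 := fun B hB h1 => by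
    have := mul_neg_of_neg_of_pos hB hApos
    linarith
  have hone : 1 * (D.q₁ ^ y)⁻¹ = 1 ↔ y = 0 := by
    rw [one_mul, inv_eq_one,
      ← D.rpow_eq_iff hq₁ y 0, Real.rpow_zero]
  have hnum : h * (D.q α)⁻¹ * (D.q₁ ^ y)⁻¹ = 1 ↔ y = -labelExp m α := by
    rw [hh, ← mul_inv, D.q_mul_sqrt_qHalf hm, ← mul_inv, ← Real.rpow_add D.q₁_pos, inv_eq_one, ← Real.rpow_zero D.q₁, D.rpow_eq_iff hq₁]
    constructor <;> intro h <;> linarith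
  rw [heq]
  refine ⟨((hfm _).mul (hfm _)).div ((hfm _).mul (hfm _)), ?_⟩
  rw [meromorphicOrderAt_div ((hfm _).mul (hfm _)) ((hfm _).mul (hfm _)),
    meromorphicOrderAt_mul (hfm _) (hfm _), meromorphicOrderAt_mul (hfm _) (hfm _)]
  simp only [hford, if_neg (hneg (-h) (by linarith)), if_neg (hneg (-1) (by norm_num)), hone,
    hnum, rootOrder]
  split_ifs <;> rfl

/-- If the roots over `β` form the family `g`, then the order of `c_β` is the sum of the orders of
the `c_α`. -/
lemma hasPole_iff_sum_rootOrder {m : ℝ} (hq₁ : D.q₁ ≠ 1) (hm : D.q₂ = D.q₁ ^ m)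
    (L : Set (Fin n)) (p : Torus D) (X β : E n)
    (hp : ∀ α : D.X, p α = ((D.q₁ ^ (inner ℝ (α : E n) X) : ℝ) : ℂ))
    {ι : Type*} [Fintype ι] (g : ι → E n) (hg : Function.Injective g)
    (hgβ : ∀ i, inner ℝ (g i) β ≠ 0)
    (hrange : ∀ α, (α ∈ roots n ∧ ∃ a : ℝ, 0 < a ∧ res L α = a • β) ↔ α ∈ Set.range g) :
    HasPole D L p β ↔ ∑ i, rootOrder m (g i) (inner ℝ (g i) X) < 0 := by
  have hmem : ∀ i, g i ∈ D.X := fun i => D.root_mem ((hrange _).2 ⟨i, rfl⟩).1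
  let g' : ι → D.X := fun i => ⟨g i, hmem i⟩
  have hg' : Function.Injective g' := fun i j h => hg (congrArg Subtype.val h)
  have hset : {α : D.X | (α : E n) ∈ roots n ∧ ∃ a : ℝ, 0 < a ∧ res L (α : E n) = a • β} =
      Set.range g' := by
    ext α
    refine (hrange α).trans ⟨?_, ?_⟩
    · rintro ⟨i, hi⟩
      exact ⟨i, Subtype.ext hi⟩
    · rintro ⟨i, rfl⟩
      exact ⟨i, rfl⟩
  have heq : cBeta D L p β = fun s => ∏ i, cVal D (g i)
      (((D.q₁ ^ (inner ℝ (g i) X) : ℝ) : ℂ)⁻¹ *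
        Complex.exp (-(s * ((inner ℝ (g i) β : ℝ) : ℂ)))) := by
    funext s
    have h1 : cBeta D L p β s = ∏ᶠ α ∈ Set.range g', cVal D (α : E n)
        ((p α)⁻¹ * Complex.exp (-(s * (inner ℝ (α : E n) β : ℝ)))) := by
      rw [← hset]
      rfl
    rw [h1, finprod_mem_range hg', finprod_eq_prod_of_fintype]
    refine Finset.prod_congr rfl fun i _ => ?_
    rw [hp]
  have hord := fun i => meromorphicOrderAt_cVal D hq₁ hm (g i) (inner ℝ (g i) X)
    (a := ((inner ℝ (g i) β : ℝ) : ℂ)) (by exact_mod_cast hgβ i)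
  rw [HasPole, heq, meromorphicOrderAt_fun_prod fun i _ => (hord i).1,
    Finset.sum_congr rfl fun i _ => (hord i).2, ← WithTop.coe_sum, ← WithTop.coe_zero,
    WithTop.coe_lt_coe]

end Orders

/-! ### Poles of the `c`-functions of restricted roots -/

section Counting

lemma sum_ite_of_unique {ι : Type*} [Fintype ι] (P : ι → Prop) [DecidablePred P]
    [Decidable (∃ a, P a)]
    (h : ∀ a b, P a → P b → a = b) :
    ∑ a, (if P a then 1 else 0 : ℤ) = if ∃ a, P a then 1 else 0 := by
  split_ifs with hex
  · obtain ⟨a, ha⟩ := hex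
    rw [Finset.sum_eq_single a (fun b _ hb => if_neg fun hP => hb (h b a hP ha)) (by simp),
      if_pos ha]
  · exact Finset.sum_eq_zero fun a _ => if_neg fun ha => hex ⟨a, ha⟩

open Classical in
/-- Counting entries of a centred strip of length `p` that equal `x`, minus those that equal
`x - 1`: all but the two ends cancel. -/
lemma sum_strip_telescope (p : ℕ) (x : ℝ) :
    ∑ d : Fin p, ((if -(((p : ℝ) - 1) / 2) + (d : ℕ) = x - 1 then 1 else 0 : ℤ) -
      (if -(((p : ℝ) - 1) / 2) + (d : ℕ) = x then 1 else 0)) =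
    (if x = ((p : ℝ) - 1) / 2 + 1 then 1 else 0) - (if x = -(((p : ℝ) - 1) / 2) then 1 else 0) := by
  set F : ℕ → ℤ := fun d => if -(((p : ℝ) - 1) / 2) + (d : ℕ) = x then 1 else 0 with hF
  have h1 : ∀ d : ℕ, (if -(((p : ℝ) - 1) / 2) + (d : ℕ) = x - 1 then 1 else 0 : ℤ) = F (d + 1) := by
    intro d
    simp only [hF]
    congr 1
    rw [eq_iff_iff]
    push_cast
    constructor <;> intro h <;> linarith
  have h2 : ∑ d : Fin p, (F (d + 1) - F d) = F p - F 0 := by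
    rw [Fin.sum_univ_eq_sum_range fun d => F (d + 1) - F d]
    exact Finset.sum_range_sub F p
  simp only [h1]
  rw [h2]
  simp only [hF]
  congr 2
  · rw [eq_iff_iff]
    constructor <;> intro h <;> linarith
  · rw [eq_iff_iff, Nat.cast_zero, add_zero, eq_comm]

open Classical in
/-- The contribution of the pairs of entries of one strip to the pole order, in integral form. -/
lemma sum_pairs_strip {p : ℕ} (hp : 0 < p) :
    ∑ d : Fin p, (if 2 * (d : ℕ) + 1 = p then 1 else 0 : ℤ) +
      ∑ d : Fin p, ∑ d' : Fin p, (if d < d' then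
        (if (d : ℕ) + d' + 1 = p then 1 else 0 : ℤ) - (if (d : ℕ) + d' + 2 = p then 1 else 0)
        else 0) = 1 := by
  have h1 : ∀ d : Fin p, ∑ d' : Fin p, (if d < d' then
        (if (d : ℕ) + d' + 1 = p then 1 else 0 : ℤ) - (if (d : ℕ) + d' + 2 = p then 1 else 0)
        else 0) = (if 2 * (d : ℕ) + 1 < p then 1 else 0) - (if 2 * (d : ℕ) + 2 < p then 1 else 0) := by
    intro d
    have e1 : ∀ d' : Fin p, (if d < d' then
        (if (d : ℕ) + d' + 1 = p then 1 else 0 : ℤ) - (if (d : ℕ) + d' + 2 = p then 1 else 0)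
        else 0) = (if d < d' ∧ (d : ℕ) + d' + 1 = p then 1 else 0) -
          (if d < d' ∧ (d : ℕ) + d' + 2 = p then 1 else 0) := by
      intro d'
      by_cases h : d < d' <;> simp [h]
    rw [Finset.sum_congr rfl fun d' _ => e1 d', Finset.sum_sub_distrib,
      sum_ite_of_unique _ fun a b ha hb => Fin.ext (by omega),
      sum_ite_of_unique _ fun a b ha hb => Fin.ext (by omega)]
    congr 2
    · rw [eq_iff_iff]
      constructor
      · rintro ⟨a, ha, h⟩
        rw [Fin.lt_def] at ha
        omega
      · intro h
        exact ⟨⟨p - 1 - d, by omega⟩, by rw [Fin.lt_def]; dsimp; omega, by dsimp; omega⟩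
    · rw [eq_iff_iff]
      constructor
      · rintro ⟨a, ha, h⟩
        rw [Fin.lt_def] at ha
        omega
      · intro h
        exact ⟨⟨p - 2 - d, by omega⟩, by rw [Fin.lt_def]; dsimp; omega, by dsimp; omega⟩
  rw [Finset.sum_congr rfl fun d _ => h1 d, ← Finset.sum_add_distrib]
  set F : ℕ → ℤ := fun d => if 2 * d + 1 ≤ p then 1 else 0 with hF
  have h2 : ∀ d : Fin p, (if 2 * (d : ℕ) + 1 = p then 1 else 0 : ℤ) +
      ((if 2 * (d : ℕ) + 1 < p then 1 else 0) - (if 2 * (d : ℕ) + 2 < p then 1 else 0)) =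
      F d - F (d + 1) := by
    intro d
    simp only [hF]
    split_ifs <;> omega
  rw [Finset.sum_congr rfl fun d _ => h2 d, Fin.sum_univ_eq_sum_range fun d => F d - F (d + 1),
    Finset.sum_range_sub']
  simp only [hF]
  rw [if_pos (by omega), if_neg (by omega)]
  rfl

end Counting

section Poles

variable {k l : ℕ} (κ : Composition k) (D : Datum (k + l)) (m : ℝ) {μ : YoungDiagram}
  (num : Fin l ≃ μ.cells)

lemma exponent_pos (i : Fin κ.length) (d : Fin (κ.blocksFun i)) :
    exponent κ l m num (pos κ l i d) = -(((κ.blocksFun i : ℝ) - 1) / 2) + (d : ℕ) := by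
  simp only [exponent, pos, Fin.addCases_left, κ.index_embedding, κ.invEmbedding_comp]

lemma exponent_natAdd (b : Fin l) :
    exponent κ l m num (Fin.natAdd k b) = (content (num b : ℕ × ℕ) : ℝ) + m := by
  simp only [exponent, Fin.addCases_right]

/-- The logarithm of the real point `r_L` to the base `q₁`. -/
def logPoint : E (k + l) := WithLp.toLp 2 (exponent κ l m num)

lemma inner_logPoint (x : E (k + l)) :
    inner ℝ x (logPoint κ m num) = ∑ j, x j * exponent κ l m num j := by
  simp only [logPoint, PiLp.inner_apply]
  exact Finset.sum_congr rfl fun j _ => mul_comm _ _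

lemma logPoint_pos (i : Fin κ.length) (d : Fin (κ.blocksFun i)) :
    logPoint κ m num (pos κ l i d) = -(((κ.blocksFun i : ℝ) - 1) / 2) + (d : ℕ) :=
  exponent_pos κ m num i d

lemma logPoint_natAdd (b : Fin l) :
    logPoint κ m num (Fin.natAdd k b) = (content (num b : ℕ × ℕ) : ℝ) + m :=
  exponent_natAdd κ m num b

lemma sum_strip_eq_zero (p : ℕ) : ∑ d : Fin p, (-(((p : ℝ) - 1) / 2) + (d : ℕ)) = 0 := by
  rw [Finset.sum_add_distrib, Fin.sum_univ_eq_sum_range fun d => (d : ℝ)]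
  have h : ∀ q : ℕ, ∑ d ∈ Finset.range q, (d : ℝ) = (q : ℝ) * (q - 1) / 2 := by
    intro q
    induction q with
    | zero => simp
    | succ q ih => rw [Finset.sum_range_succ, ih]; push_cast; ring
  rw [h]
  simp
  ring

lemma logPoint_mem_spanL : logPoint κ m num ∈ spanL (levi κ l) := by
  rw [mem_spanL_iff]
  intro i
  rw [blockSum_apply]
  simp only [logPoint_pos]
  exact sum_strip_eq_zero _

lemma inner_projL_logPoint (x : E (k + l)) :
    inner ℝ (projL (levi κ l) x) (logPoint κ m num) = inner ℝ x (logPoint κ m num) := by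
  rw [projL_eq, inner_sub_left]
  have : inner ℝ (res (levi κ l) x) (logPoint κ m num) = (0 : ℝ) := by
    rw [real_inner_comm]
    exact Submodule.inner_right_of_mem_orthogonal (logPoint_mem_spanL κ m num)
      (Submodule.starProjection_apply_mem _ _)
  rw [this, sub_zero]

lemma basePoint_apply {r : AddChar (XL D (levi κ l)) ℂ}
    (hr : ∀ x, r x =
      ((D.q₁ ^ (∑ j, (x : E (k + l)) j * exponent κ l m num j) : ℝ) : ℂ)) (α : D.X) :
    (r.compAddMonoidHom (toXL D (levi κ l)) * 1 : Torus D) α =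
      ((D.q₁ ^ (inner ℝ (α : E (k + l)) (logPoint κ m num)) : ℝ) : ℂ) := by
  rw [mul_one, ← inner_projL_logPoint, inner_logPoint]
  exact hr (toXL D (levi κ l) α)

lemma labelExp_e {n : ℕ} (a : Fin n) : labelExp m (e a) = m := by
  rw [labelExp, if_neg]
  intro h
  have := norm_sq_longRoot h
  rw [inner_e_left, e_apply, if_pos rfl] at this
  norm_num at this

lemma labelExp_add {n : ℕ} {a b : Fin n} (h : a ≠ b) : labelExp m (e a + e b) = 1 :=
  if_pos ⟨a, b, h, Or.inl rfl⟩

lemma labelExp_sub {n : ℕ} {a b : Fin n} (h : a ≠ b) : labelExp m (e a - e b) = 1 :=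
  if_pos ⟨a, b, h, Or.inr (Or.inl rfl)⟩

lemma e_add_e_inj {n : ℕ} {a b c d : Fin n} (hab : a ≠ b) (h : (e a + e b : E n) = e c + e d) :
    (a = c ∧ b = d) ∨ (a = d ∧ b = c) := by
  have h1 := congrArg (fun v : E n => v a) h
  have h2 := congrArg (fun v : E n => v b) h
  simp only [PiLp.add_apply, e_apply, if_pos, if_neg hab, if_neg hab.symm] at h1 h2
  by_cases hac : a = c
  · left
    refine ⟨hac, ?_⟩
    by_contra hbd
    have hbc : b ≠ c := fun h => hab (hac.trans h.symm)
    simp [hbd, hbc] at h2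
  · right
    have had : a = d := by
      by_contra had
      simp [hac, had] at h1
    refine ⟨had, ?_⟩
    by_contra hbc
    have hbd : b ≠ d := fun h => hab (had.trans h.symm)
    simp [hbd, hbc] at h2

lemma e_sub_e_inj {n : ℕ} {a b c d : Fin n} (hab : a ≠ b) (h : (e a - e b : E n) = e c - e d) :
    a = c ∧ b = d := by
  by_cases hcd : c = d
  · subst hcd
    rw [sub_self, sub_eq_zero] at h
    exact absurd (e_injective h) hab
  have h' : (e a + e d : E n) = e c + e b := by
    rw [sub_eq_sub_iff_add_eq_add] at h
    exact h
  by_cases had : a = d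
  · subst had
    have h1 := congrArg (fun v : E n => v a) h
    simp [e_apply, hab] at h1
    split_ifs at h1 with h2
    · exact absurd h2.symm hcd
    · norm_num at h1
  · rcases e_add_e_inj had h' with ⟨h1, h2⟩ | ⟨h1, -⟩
    · exact ⟨h1, h2.symm⟩
    · exact absurd h1 hab

lemma res_eq_smul_iff {α β : E (k + l)} {a : ℝ} :
    res (levi κ l) α = a • res (levi κ l) β ↔
      ∀ i, blockSum κ l i α = a * blockSum κ l i β := by
  constructor
  · intro h i
    have := congrArg (blockSum κ l i) h
    rwa [map_smul, blockSum_res, blockSum_res] at this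
  · intro h
    rw [res_eq, res_eq, Finset.smul_sum]
    exact Finset.sum_congr rfl fun i _ => by rw [h i, mul_smul]

lemma center_eq_res (i : Fin κ.length) :
    center κ l i = res (levi κ l) (e (pos κ l i ⟨0, blocksFun_pos κ i⟩)) :=
  (res_e_pos κ l i _).symm

/-- The part of the pole count common to `c_β` for `β = center i ± center j`: the pairs of entries
of two strips of lengths `p` and `p'`. -/
lemma sum_two_strips_neg_iff {p p' : ℕ} (hp : 0 < p) {t : ℝ} (ht : t = 1 ∨ t = -1) :
    open Classical in
    ∑ x : Fin p × Fin p',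
      ((if (-(((p : ℝ) - 1) / 2) + (x.1 : ℕ)) + t * (-(((p' : ℝ) - 1) / 2) + (x.2 : ℕ)) = -1
        then 1 else 0 : ℤ) -
      (if (-(((p : ℝ) - 1) / 2) + (x.1 : ℕ)) + t * (-(((p' : ℝ) - 1) / 2) + (x.2 : ℕ)) = 0
        then 1 else 0)) < 0 ↔ p = p' := by
  classical
  -- by the symmetry of the second strip, the sign `t` does not matter
  have hsum : ∑ x : Fin p × Fin p',
      ((if (-(((p : ℝ) - 1) / 2) + (x.1 : ℕ)) + t * (-(((p' : ℝ) - 1) / 2) + (x.2 : ℕ)) = -1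
        then 1 else 0 : ℤ) -
      (if (-(((p : ℝ) - 1) / 2) + (x.1 : ℕ)) + t * (-(((p' : ℝ) - 1) / 2) + (x.2 : ℕ)) = 0
        then 1 else 0)) =
      ∑ d' : Fin p', ((if 2 * (d' : ℕ) = p + p' then 1 else 0 : ℤ) -
        (if 2 * (d' : ℕ) + p = p' then 1 else 0)) := by
    have hinner : ∀ y : ℝ, ∑ d : Fin p,
        ((if (-(((p : ℝ) - 1) / 2) + (d : ℕ)) - y = -1 then 1 else 0 : ℤ) -
        (if (-(((p : ℝ) - 1) / 2) + (d : ℕ)) - y = 0 then 1 else 0)) =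
        (if y = ((p : ℝ) - 1) / 2 + 1 then 1 else 0) -
          (if y = -(((p : ℝ) - 1) / 2) then 1 else 0) := by
      intro y
      rw [← sum_strip_telescope]
      refine Finset.sum_congr rfl fun d _ => ?_
      congr 2
      · rw [eq_iff_iff]; constructor <;> intro h <;> linarith
      · rw [eq_iff_iff]; constructor <;> intro h <;> linarith
    have hfinal : ∀ d' : Fin p',
        ((if (-(((p' : ℝ) - 1) / 2) + (d' : ℕ)) = ((p : ℝ) - 1) / 2 + 1 then 1 else 0 : ℤ) -
          (if (-(((p' : ℝ) - 1) / 2) + (d' : ℕ)) = -(((p : ℝ) - 1) / 2) then 1 else 0)) =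
        ((if 2 * (d' : ℕ) = p + p' then 1 else 0 : ℤ) -
        (if 2 * (d' : ℕ) + p = p' then 1 else 0)) := by
      intro d'
      congr 2
      · rw [eq_iff_iff]
        constructor
        · intro h
          have : (2 * (d' : ℕ) : ℝ) = p + p' := by linarith
          exact_mod_cast this
        · intro h
          have : (2 * (d' : ℕ) : ℝ) = p + p' := by exact_mod_cast h
          linarith
      · rw [eq_iff_iff]
        constructor
        · intro h
          have : (2 * (d' : ℕ) : ℝ) + p = p' := by linarith
          exact_mod_cast this
        · intro h
          have : (2 * (d' : ℕ) : ℝ) + p = p' := by exact_mod_cast h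
          linarith
    rw [Fintype.sum_prod_type_right]
    rcases ht with rfl | rfl
    · rw [← Equiv.sum_comp Fin.revPerm, ← Finset.sum_congr rfl fun d' _ => hfinal d']
      refine Finset.sum_congr rfl fun d' _ => ?_
      rw [← hinner]
      refine Finset.sum_congr rfl fun d _ => ?_
      have hrev : ((d'.rev : ℕ) : ℝ) = (p' : ℝ) - 1 - (d' : ℕ) := by
        have : (d'.rev : ℕ) + d' + 1 = p' := by rw [Fin.val_rev]; omega
        have : ((d'.rev : ℕ) : ℝ) + d' + 1 = p' := by exact_mod_cast this
        linarith
      simp only [Fin.revPerm_apply, hrev]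
      congr 2
      · rw [eq_iff_iff]; constructor <;> intro h <;> linarith
      · rw [eq_iff_iff]; constructor <;> intro h <;> linarith
    · rw [← Finset.sum_congr rfl fun d' _ => hfinal d']
      refine Finset.sum_congr rfl fun d' _ => ?_
      rw [← hinner]
      refine Finset.sum_congr rfl fun d _ => ?_
      congr 2
      · rw [eq_iff_iff]; constructor <;> intro h <;> linarith
      · rw [eq_iff_iff]; constructor <;> intro h <;> linarith
  rw [hsum, Finset.sum_sub_distrib, sum_ite_of_unique _ fun a b ha hb => Fin.ext (by omega),
    sum_ite_of_unique _ fun a b ha hb => Fin.ext (by omega)]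
  have e1 : (∃ a : Fin p', 2 * (a : ℕ) = p + p') ↔ p < p' ∧ (p + p') % 2 = 0 :=
    ⟨fun ⟨a, ha⟩ => by omega, fun h => ⟨⟨(p + p') / 2, by omega⟩, by dsimp; omega⟩⟩
  have e2 : (∃ a : Fin p', 2 * (a : ℕ) + p = p') ↔ p ≤ p' ∧ (p + p') % 2 = 0 :=
    ⟨fun ⟨a, ha⟩ => by omega, fun h => ⟨⟨(p' - p) / 2, by omega⟩, by dsimp; omega⟩⟩
  simp only [e1, e2]
  split_ifs <;> omega

section WithPoint

variable {κ m D}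
variable (hq₁ : D.q₁ ≠ 1) (hm : D.q₂ = D.q₁ ^ m) {r : AddChar (XL D (levi κ l)) ℂ}
  (hr : ∀ x, r x = ((D.q₁ ^ (∑ j, (x : E (k + l)) j * exponent κ l m num j) : ℝ) : ℂ))

include hq₁ hm hr

lemma hasPole_center_sub_center {i j : Fin κ.length} (hij : i ≠ j) :
    HasPole D (levi κ l) (r.compAddMonoidHom (toXL D (levi κ l)) * 1)
      (center κ l i - center κ l j) ↔ κ.blocksFun i = κ.blocksFun j := by
  have hne : ∀ (d : Fin (κ.blocksFun i)) (d' : Fin (κ.blocksFun j)),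
      pos κ l i d ≠ pos κ l j d' := fun d d' h => hij (pos_block_eq κ l h)
  have hβ : center κ l i - center κ l j = res (levi κ l)
      (e (pos κ l i ⟨0, blocksFun_pos κ i⟩) - e (pos κ l j ⟨0, blocksFun_pos κ j⟩)) := by
    rw [res_sub, res_e_pos, res_e_pos]
  rw [hasPole_iff_sum_rootOrder D hq₁ hm _ _ (logPoint κ m num) _
    (basePoint_apply κ D m num hr)
    (fun x : Fin (κ.blocksFun i) × Fin (κ.blocksFun j) =>
      e (pos κ l i x.1) - e (pos κ l j x.2))]
  · rw [← sum_two_strips_neg_iff (blocksFun_pos κ i) (Or.inr rfl)]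
    refine iff_of_eq (congrArg (· < 0) (Finset.sum_congr rfl fun x _ => ?_))
    rw [rootOrder, labelExp_sub m (hne _ _), inner_sub_left, inner_e_left, inner_e_left,
      logPoint_pos, logPoint_pos, neg_one_mul, ← sub_eq_add_neg]
  · rintro ⟨d, d'⟩ ⟨a, a'⟩ h
    obtain ⟨h1, h2⟩ := e_sub_e_inj (hne _ _) h
    rw [pos_inj] at h1 h2
    exact Prod.ext h1 h2
  · rintro ⟨d, d'⟩
    rw [inner_sub_right, inner_center, inner_center]
    simp only [map_sub, blockSum_e_pos, hij, hij.symm, if_true, if_false]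
    have h1 : (0 : ℝ) < (κ.blocksFun i : ℝ)⁻¹ := by
      exact_mod_cast inv_pos.2 (Nat.cast_pos.2 (blocksFun_pos κ i))
    have h2 : (0 : ℝ) < (κ.blocksFun j : ℝ)⁻¹ := by
      exact_mod_cast inv_pos.2 (Nat.cast_pos.2 (blocksFun_pos κ j))
    linarith
  · intro α
    rw [hβ]
    simp only [res_eq_smul_iff]
    constructor
    · rintro ⟨hα, a, ha, h⟩
      have hi := h i
      have hj := h j
      simp only [map_sub, blockSum_e_pos, hij, hij.symm, if_true, if_false] at hi hj
      rcases hα with ⟨b, c, hbc, rfl | rfl | rfl⟩ | ⟨b, rfl | rfl⟩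
      · have := blockSum_e_nonneg κ l j b
        have := blockSum_e_nonneg κ l j c
        rw [map_add] at hj
        linarith
      · have h1 := blockSum_e_nonneg κ l i c
        have h2 := blockSum_e_nonneg κ l j b
        rw [map_sub] at hi hj
        obtain ⟨d, rfl⟩ := exists_pos_of_blockSum_pos κ l (show 0 < blockSum κ l i (e b) by linarith)
        obtain ⟨d', rfl⟩ := exists_pos_of_blockSum_pos κ l
          (show 0 < blockSum κ l j (e c) by linarith)
        exact ⟨(d, d'), rfl⟩
      · have := blockSum_e_nonneg κ l i b
        have := blockSum_e_nonneg κ l i c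
        rw [map_neg, map_add] at hi
        linarith
      · have := blockSum_e_nonneg κ l j b
        linarith
      · have := blockSum_e_nonneg κ l i b
        rw [map_neg] at hi
        linarith
    · rintro ⟨⟨d, d'⟩, rfl⟩
      refine ⟨e_sub_mem_roots (hne _ _), 1, one_pos, fun i' => ?_⟩
      simp only [map_sub, blockSum_e_pos, one_mul]

lemma hasPole_center_add_center {i j : Fin κ.length} (hij : i ≠ j) :
    HasPole D (levi κ l) (r.compAddMonoidHom (toXL D (levi κ l)) * 1)
      (center κ l i + center κ l j) ↔ κ.blocksFun i = κ.blocksFun j := by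
  have hne : ∀ (d : Fin (κ.blocksFun i)) (d' : Fin (κ.blocksFun j)),
      pos κ l i d ≠ pos κ l j d' := fun d d' h => hij (pos_block_eq κ l h)
  have hβ : center κ l i + center κ l j = res (levi κ l)
      (e (pos κ l i ⟨0, blocksFun_pos κ i⟩) + e (pos κ l j ⟨0, blocksFun_pos κ j⟩)) := by
    rw [res_add, res_e_pos, res_e_pos]
  rw [hasPole_iff_sum_rootOrder D hq₁ hm _ _ (logPoint κ m num) _
    (basePoint_apply κ D m num hr)
    (fun x : Fin (κ.blocksFun i) × Fin (κ.blocksFun j) =>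
      e (pos κ l i x.1) + e (pos κ l j x.2))]
  · rw [← sum_two_strips_neg_iff (blocksFun_pos κ i) (Or.inl rfl)]
    refine iff_of_eq (congrArg (· < 0) (Finset.sum_congr rfl fun x _ => ?_))
    rw [rootOrder, labelExp_add m (hne _ _), inner_add_left, inner_e_left, inner_e_left,
      logPoint_pos, logPoint_pos, one_mul]
  · rintro ⟨d, d'⟩ ⟨a, a'⟩ h
    rcases e_add_e_inj (hne _ _) h with ⟨h1, h2⟩ | ⟨h1, -⟩
    · rw [pos_inj] at h1 h2
      exact Prod.ext h1 h2
    · exact absurd h1 (hne _ _)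
  · rintro ⟨d, d'⟩
    rw [inner_add_right, inner_center, inner_center]
    simp only [map_add, blockSum_e_pos, hij, hij.symm, if_true, if_false]
    have h1 : (0 : ℝ) < (κ.blocksFun i : ℝ)⁻¹ := by
      exact_mod_cast inv_pos.2 (Nat.cast_pos.2 (blocksFun_pos κ i))
    have h2 : (0 : ℝ) < (κ.blocksFun j : ℝ)⁻¹ := by
      exact_mod_cast inv_pos.2 (Nat.cast_pos.2 (blocksFun_pos κ j))
    linarith
  · intro α
    rw [hβ]
    simp only [res_eq_smul_iff]
    constructor
    · rintro ⟨hα, a, ha, h⟩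
      have hi := h i
      have hj := h j
      simp only [map_add, blockSum_e_pos, hij, hij.symm, if_true, if_false] at hi hj
      -- no basis vector contributes to both block sums
      have hexcl : ∀ b, 0 < blockSum κ l i (e b) → 0 < blockSum κ l j (e b) → False := by
        intro b h1 h2
        obtain ⟨d, rfl⟩ := exists_pos_of_blockSum_pos κ l h1
        obtain ⟨d', h'⟩ := exists_pos_of_blockSum_pos κ l h2
        exact hne _ _ h'
      rcases hα with ⟨b, c, hbc, rfl | rfl | rfl⟩ | ⟨b, rfl | rfl⟩
      · have h1 := (blockSum_e_nonneg κ l i b).lt_or_eq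
        have h2 := (blockSum_e_nonneg κ l j b).lt_or_eq
        rw [map_add] at hi hj
        rcases h1 with h1 | h1
        · have h2 := h2.resolve_left (hexcl b h1)
          obtain ⟨d, rfl⟩ := exists_pos_of_blockSum_pos κ l h1
          obtain ⟨d', rfl⟩ := exists_pos_of_blockSum_pos κ l
            (show 0 < blockSum κ l j (e c) by linarith)
          exact ⟨(d, d'), rfl⟩
        · have h3 : 0 < blockSum κ l i (e c) := by linarith
          have h4 : 0 < blockSum κ l j (e b) := by
            refine h2.resolve_right fun h2 => hexcl c h3 ?_
            linarith
          obtain ⟨d, rfl⟩ := exists_pos_of_blockSum_pos κ l h3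
          obtain ⟨d', rfl⟩ := exists_pos_of_blockSum_pos κ l h4
          exact ⟨(d, d'), add_comm _ _⟩
      · have h1 := blockSum_e_nonneg κ l i c
        have h2 := blockSum_e_nonneg κ l j c
        rw [map_sub] at hi hj
        exact (hexcl b (by linarith) (by linarith)).elim
      · have := blockSum_e_nonneg κ l i b
        have := blockSum_e_nonneg κ l i c
        rw [map_neg, map_add] at hi
        linarith
      · exact (hexcl b (by linarith) (by linarith)).elim
      · have := blockSum_e_nonneg κ l i b
        rw [map_neg] at hi
        linarith
    · rintro ⟨⟨d, d'⟩, rfl⟩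
      refine ⟨e_add_mem_roots (hne _ _), 1, one_pos, fun i' => ?_⟩
      simp only [map_add, blockSum_e_pos, one_mul]

end WithPoint

end Poles

section CenterPole

variable {k l : ℕ} {κ : Composition k} {D : Datum (k + l)} {m : ℝ} {μ : YoungDiagram}
  (num : Fin l ≃ μ.cells)

/-- The roots whose restriction is a positive multiple of the center of the `i`-th block: `e_a`,
`e_a + e_{a'}` and `e_a ± e_b` with `a, a'` in the block and `b` among the last `l` coordinates. -/
def rootsOverCenter (l : ℕ) (i : Fin κ.length) :
    Fin (κ.blocksFun i) ⊕
      {x : Fin (κ.blocksFun i) × Fin (κ.blocksFun i) // x.1 < x.2} ⊕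
      (Fin (κ.blocksFun i) × Fin l) ⊕ (Fin (κ.blocksFun i) × Fin l) → E (k + l)
  | .inl d => e (pos κ l i d)
  | .inr (.inl x) => e (pos κ l i x.1.1) + e (pos κ l i x.1.2)
  | .inr (.inr (.inl x)) => e (pos κ l i x.1) + e (Fin.natAdd k x.2)
  | .inr (.inr (.inr x)) => e (pos κ l i x.1) - e (Fin.natAdd k x.2)

lemma coordSum_e {n : ℕ} (a : Fin n) : ∑ j, (e a : E n) j = 1 := by simp [e_apply]

lemma rootsOverCenter_injective (i : Fin κ.length) :
    Function.Injective (rootsOverCenter (κ := κ) l i) := by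
  -- the sum of all coordinates separates `e_a`, `e_a + e_b` and `e_a - e_b`
  have hcs : ∀ x y, rootsOverCenter (κ := κ) l i x = rootsOverCenter l i y →
      ∑ j, rootsOverCenter l i x j = ∑ j, rootsOverCenter l i y j := fun x y h => by rw [h]
  rintro (d | ⟨⟨a, b⟩, hab⟩ | ⟨a, b⟩ | ⟨a, b⟩) (d' | ⟨⟨a', b'⟩, hab'⟩ | ⟨a', b'⟩ | ⟨a', b'⟩) h
  · rw [(pos_injective κ l i) (e_injective h)]
  all_goals
    have hsum := hcs _ _ h
    simp only [rootsOverCenter, PiLp.add_apply, PiLp.sub_apply, Finset.sum_add_distrib,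
      Finset.sum_sub_distrib, coordSum_e] at hsum h
    try (norm_num at hsum; done)
  · rcases e_add_e_inj (fun h => hab.ne ((pos_inj κ l).1 h)) h with ⟨h1, h2⟩ | ⟨h1, h2⟩
    · rw [pos_inj] at h1 h2
      dsimp only at h1 h2
      subst h1 h2
      rfl
    · rw [pos_inj] at h1 h2
      dsimp only at h1 h2 hab hab'
      subst h1 h2
      exact absurd hab hab'.asymm
  · rcases e_add_e_inj (fun h => hab.ne ((pos_inj κ l).1 h)) h with ⟨h1, h2⟩ | ⟨h1, h2⟩
    · exact absurd h2 (pos_ne_natAdd κ l _ _ _)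
    · exact absurd h1 (pos_ne_natAdd κ l _ _ _)
  · rcases e_add_e_inj (pos_ne_natAdd κ l _ _ _) h with ⟨h1, h2⟩ | ⟨h1, h2⟩
    · exact absurd h2.symm (pos_ne_natAdd κ l _ _ _)
    · exact absurd h2.symm (pos_ne_natAdd κ l _ _ _)
  · rcases e_add_e_inj (pos_ne_natAdd κ l _ _ _) h with ⟨h1, h2⟩ | ⟨h1, h2⟩
    · rw [pos_inj] at h1
      have h2 := Fin.natAdd_injective l k h2
      subst h1 h2
      rfl
    · exact absurd h1 (pos_ne_natAdd κ l _ _ _)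
  · obtain ⟨h1, h2⟩ := e_sub_e_inj (pos_ne_natAdd κ l _ _ _) h
    rw [pos_inj] at h1
    have h2 := Fin.natAdd_injective l k h2
    subst h1 h2
    rfl

lemma mem_range_rootsOverCenter (i : Fin κ.length) (α : E (k + l)) :
    (α ∈ roots (k + l) ∧ ∃ a : ℝ, 0 < a ∧ res (levi κ l) α = a • center κ l i) ↔
      α ∈ Set.range (rootsOverCenter (κ := κ) l i) := by
  rw [center_eq_res]
  simp only [res_eq_smul_iff, blockSum_e_pos]
  constructor
  · rintro ⟨hα, a, ha, h⟩
    have hi := h i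
    have hj : ∀ j, j ≠ i → blockSum κ l j α = 0 := fun j hj => by
      have := h j
      rwa [if_neg hj, mul_zero] at this
    rw [if_pos rfl, mul_one] at hi
    rcases hα with ⟨b, c, hbc, rfl | rfl | rfl⟩ | ⟨b, rfl | rfl⟩
    · -- one of the two basis vectors lies in the block; by symmetry it is the first
      have key : ∀ b c : Fin (k + l), b ≠ c →
          (∀ j, j ≠ i → blockSum κ l j (e b + e c) = 0) → 0 < blockSum κ l i (e b) →
          (e b + e c) ∈ Set.range (rootsOverCenter (κ := κ) l i) := by
        intro b c hbc hj hb
        obtain ⟨d, rfl⟩ := exists_pos_of_blockSum_pos κ l hb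
        rcases pos_or_natAdd κ l c with ⟨i', d', rfl⟩ | ⟨c, rfl⟩
        · by_cases hi' : i' = i
          · subst hi'
            rcases lt_trichotomy d d' with hlt | rfl | hlt
            · exact ⟨.inr (.inl ⟨(d, d'), hlt⟩), rfl⟩
            · exact absurd rfl hbc
            · exact ⟨.inr (.inl ⟨(d', d), hlt⟩), add_comm _ _⟩
          · have := hj i' hi'
            rw [map_add, blockSum_e_pos, blockSum_e_pos, if_neg hi', if_pos rfl] at this
            norm_num at this
        · exact ⟨.inr (.inr (.inl (d, c))), rfl⟩
      rcases (blockSum_e_nonneg κ l i b).lt_or_eq with hb | hb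
      · exact key b c hbc hj hb
      · rw [map_add] at hi
        rw [add_comm (e b) (e c)]
        refine key c b hbc.symm (fun j hj' => ?_) (by linarith)
        rw [add_comm (e c) (e b)]
        exact hj j hj'
    · rw [map_sub] at hi
      have hc := blockSum_e_nonneg κ l i c
      obtain ⟨d, rfl⟩ := exists_pos_of_blockSum_pos κ l (show 0 < blockSum κ l i (e b) by linarith)
      rcases pos_or_natAdd κ l c with ⟨i', d', rfl⟩ | ⟨c, rfl⟩
      · by_cases hi' : i' = i
        · subst hi'
          rw [blockSum_e_pos, blockSum_e_pos, if_pos rfl] at hi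
          linarith
        · have := hj i' hi'
          rw [map_sub, blockSum_e_pos, blockSum_e_pos, if_neg hi', if_pos rfl] at this
          norm_num at this
      · exact ⟨.inr (.inr (.inr (d, c))), rfl⟩
    · have := blockSum_e_nonneg κ l i b
      have := blockSum_e_nonneg κ l i c
      rw [map_neg, map_add] at hi
      linarith
    · obtain ⟨d, rfl⟩ := exists_pos_of_blockSum_pos κ l (show 0 < blockSum κ l i (e b) by linarith)
      exact ⟨.inl d, rfl⟩
    · have := blockSum_e_nonneg κ l i b
      rw [map_neg] at hi
      linarith
  · rintro ⟨d | ⟨⟨a, b⟩, hab⟩ | ⟨a, b⟩ | ⟨a, b⟩, rfl⟩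
    · refine ⟨e_mem_roots _, 1, one_pos, fun j => ?_⟩
      rw [rootsOverCenter, blockSum_e_pos, one_mul]
    · refine ⟨e_add_mem_roots fun h => hab.ne ((pos_inj κ l).1 h), 2, two_pos, fun j => ?_⟩
      rw [rootsOverCenter, map_add, blockSum_e_pos, blockSum_e_pos]
      ring
    · refine ⟨e_add_mem_roots (pos_ne_natAdd κ l _ _ _), 1, one_pos, fun j => ?_⟩
      rw [rootsOverCenter, map_add, blockSum_e_pos, blockSum_e_natAdd]
      ring
    · refine ⟨e_sub_mem_roots (pos_ne_natAdd κ l _ _ _), 1, one_pos, fun j => ?_⟩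
      rw [rootsOverCenter, map_sub, blockSum_e_pos, blockSum_e_natAdd]
      ring

lemma sum_ite_content (x : ℝ) :
    open Classical in
    ∑ b : Fin l, (if (content (num b : ℕ × ℕ) : ℝ) = x then 1 else 0 : ℤ) =
      contentCount μ x := by
  classical
  rw [num.sum_comp fun b : μ.cells => (if (content (b : ℕ × ℕ) : ℝ) = x then 1 else 0 : ℤ),
    Finset.sum_coe_sort μ.cells fun b => (if (content b : ℝ) = x then 1 else 0 : ℤ),
    contentCount, Finset.sum_boole]

lemma sum_rootOrder_short (p : ℕ) :
    open Classical in
    ∑ d : Fin p, ((if -(((p : ℝ) - 1) / 2) + (d : ℕ) = -m then 1 else 0 : ℤ) -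
      (if -(((p : ℝ) - 1) / 2) + (d : ℕ) = 0 then 1 else 0)) =
    (if ∃ d : Fin p, -(((p : ℝ) - 1) / 2) + (d : ℕ) = -m then 1 else 0) -
      ∑ d : Fin p, (if 2 * (d : ℕ) + 1 = p then 1 else 0) := by
  classical
  rw [Finset.sum_sub_distrib, sum_ite_of_unique _ fun a b ha hb => Fin.ext (by
    have : (a : ℝ) = (b : ℕ) := by linarith
    exact_mod_cast this)]
  congr 1
  refine Finset.sum_congr rfl fun d _ => ?_
  congr 1
  rw [eq_iff_iff]
  constructor
  · intro h
    have : (2 * (d : ℕ) : ℝ) + 1 = p := by linarith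
    exact_mod_cast this
  · intro h
    have : (2 * (d : ℕ) : ℝ) + 1 = p := by exact_mod_cast h
    linarith

lemma sum_rootOrder_pairs (p : ℕ) :
    open Classical in
    ∑ x : {x : Fin p × Fin p // x.1 < x.2},
      ((if (-(((p : ℝ) - 1) / 2) + (x.1.1 : ℕ)) + (-(((p : ℝ) - 1) / 2) + (x.1.2 : ℕ)) = -1
        then 1 else 0 : ℤ) -
      (if (-(((p : ℝ) - 1) / 2) + (x.1.1 : ℕ)) + (-(((p : ℝ) - 1) / 2) + (x.1.2 : ℕ)) = 0
        then 1 else 0)) =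
    -∑ d : Fin p, ∑ d' : Fin p, (if d < d' then
        (if (d : ℕ) + d' + 1 = p then 1 else 0 : ℤ) - (if (d : ℕ) + d' + 2 = p then 1 else 0)
        else 0) := by
  classical
  rw [← Fintype.sum_prod_type' (f := fun d d' : Fin p => (if d < d' then
        (if (d : ℕ) + d' + 1 = p then 1 else 0 : ℤ) - (if (d : ℕ) + d' + 2 = p then 1 else 0)
        else 0)), ← Finset.sum_filter, ← Finset.sum_neg_distrib,
    Finset.sum_subtype (Finset.univ.filter fun x : Fin p × Fin p => x.1 < x.2)
      (p := fun x : Fin p × Fin p => x.1 < x.2) (by simp)]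
  refine Finset.sum_congr rfl fun x _ => ?_
  rw [neg_sub]
  congr 2
  · rw [eq_iff_iff]
    constructor
    · intro h
      have : ((x.1.1 : ℕ) : ℝ) + (x.1.2 : ℕ) + 2 = p := by linarith
      exact_mod_cast this
    · intro h
      have : ((x.1.1 : ℕ) : ℝ) + (x.1.2 : ℕ) + 2 = p := by exact_mod_cast h
      linarith
  · rw [eq_iff_iff]
    constructor
    · intro h
      have : ((x.1.1 : ℕ) : ℝ) + (x.1.2 : ℕ) + 1 = p := by linarith
      exact_mod_cast this
    · intro h
      have : ((x.1.1 : ℕ) : ℝ) + (x.1.2 : ℕ) + 1 = p := by exact_mod_cast h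
      linarith

lemma sum_rootOrder_box_add (p : ℕ) :
    open Classical in
    ∑ x : Fin p × Fin l,
      ((if (-(((p : ℝ) - 1) / 2) + (x.1 : ℕ)) + ((content (num x.2 : ℕ × ℕ) : ℝ) + m) = -1
        then 1 else 0 : ℤ) -
      (if (-(((p : ℝ) - 1) / 2) + (x.1 : ℕ)) + ((content (num x.2 : ℕ × ℕ) : ℝ) + m) = 0
        then 1 else 0)) =
    contentCount μ (-(((p : ℝ) - 1) / 2) - 1 - m) - contentCount μ (((p : ℝ) - 1) / 2 - m) := by
  classical
  rw [Fintype.sum_prod_type_right, ← sum_ite_content num, ← sum_ite_content num,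
    ← Finset.sum_sub_distrib]
  refine Finset.sum_congr rfl fun b _ => ?_
  have h := sum_strip_telescope p (-((content (num b : ℕ × ℕ) : ℝ) + m))
  trans
  · trans
    swap
    · exact h
    · refine Finset.sum_congr rfl fun d _ => ?_
      congr 2
      · rw [eq_iff_iff]; constructor <;> intro h <;> linarith
      · rw [eq_iff_iff]; constructor <;> intro h <;> linarith
  · congr 2
    · rw [eq_iff_iff]; constructor <;> intro h <;> linarith
    · rw [eq_iff_iff]; constructor <;> intro h <;> linarith

lemma sum_rootOrder_box_sub (p : ℕ) :
    open Classical in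
    ∑ x : Fin p × Fin l,
      ((if (-(((p : ℝ) - 1) / 2) + (x.1 : ℕ)) - ((content (num x.2 : ℕ × ℕ) : ℝ) + m) = -1
        then 1 else 0 : ℤ) -
      (if (-(((p : ℝ) - 1) / 2) + (x.1 : ℕ)) - ((content (num x.2 : ℕ × ℕ) : ℝ) + m) = 0
        then 1 else 0)) =
    contentCount μ (((p : ℝ) - 1) / 2 + 1 - m) - contentCount μ (-(((p : ℝ) - 1) / 2) - m) := by
  classical
  rw [Fintype.sum_prod_type_right, ← sum_ite_content num, ← sum_ite_content num,
    ← Finset.sum_sub_distrib]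
  refine Finset.sum_congr rfl fun b _ => ?_
  have h := sum_strip_telescope p ((content (num b : ℕ × ℕ) : ℝ) + m)
  trans
  · trans
    swap
    · exact h
    · refine Finset.sum_congr rfl fun d _ => ?_
      congr 2
      · rw [eq_iff_iff]; constructor <;> intro h <;> linarith
      · rw [eq_iff_iff]; constructor <;> intro h <;> linarith
  · congr 2
    · rw [eq_iff_iff]; constructor <;> intro h <;> linarith
    · rw [eq_iff_iff]; constructor <;> intro h <;> linarith

/-- The center of a block is a pole exactly when the strip of the same length cannot be glued. -/
lemma hasPole_center (hq₁ : D.q₁ ≠ 1) (hm : D.q₂ = D.q₁ ^ m) {r : AddChar (XL D (levi κ l)) ℂ}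
    (hr : ∀ x, r x = ((D.q₁ ^ (∑ j, (x : E (k + l)) j * exponent κ l m num j) : ℝ) : ℂ))
    (i : Fin κ.length) :
    HasPole D (levi κ l) (r.compAddMonoidHom (toXL D (levi κ l)) * 1) (center κ l i) ↔
      ¬ CanGlue m μ (κ.blocksFun i) := by
  classical
  rw [hasPole_iff_sum_rootOrder D hq₁ hm _ _ (logPoint κ m num) _ (basePoint_apply κ D m num hr)
    (rootsOverCenter l i) (rootsOverCenter_injective i) _ (mem_range_rootsOverCenter i),
    ← poleOrder_pos_iff_not_canGlue (blocksFun_pos κ i)]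
  · rw [Fintype.sum_sum_type, Fintype.sum_sum_type, Fintype.sum_sum_type]
    have e1 : ∀ d : Fin (κ.blocksFun i), rootOrder m (rootsOverCenter (κ := κ) l i (.inl d))
        (inner ℝ (rootsOverCenter (κ := κ) l i (.inl d)) (logPoint κ m num)) =
        (if -(((κ.blocksFun i : ℝ) - 1) / 2) + (d : ℕ) = -m then 1 else 0) -
          (if -(((κ.blocksFun i : ℝ) - 1) / 2) + (d : ℕ) = 0 then 1 else 0) := by
      intro d
      rw [rootOrder, rootsOverCenter, labelExp_e, inner_e_left, logPoint_pos]
    have e2 : ∀ x : {x : Fin (κ.blocksFun i) × Fin (κ.blocksFun i) // x.1 < x.2},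
        rootOrder m (rootsOverCenter (κ := κ) l i (.inr (.inl x)))
          (inner ℝ (rootsOverCenter (κ := κ) l i (.inr (.inl x))) (logPoint κ m num)) =
        (if (-(((κ.blocksFun i : ℝ) - 1) / 2) + (x.1.1 : ℕ)) +
          (-(((κ.blocksFun i : ℝ) - 1) / 2) + (x.1.2 : ℕ)) = -1 then 1 else 0) -
        (if (-(((κ.blocksFun i : ℝ) - 1) / 2) + (x.1.1 : ℕ)) +
          (-(((κ.blocksFun i : ℝ) - 1) / 2) + (x.1.2 : ℕ)) = 0 then 1 else 0) := by
      intro x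
      rw [rootOrder, rootsOverCenter, labelExp_add m fun h => x.2.ne ((pos_inj κ l).1 h),
        inner_add_left, inner_e_left, inner_e_left, logPoint_pos, logPoint_pos]
    have e3 : ∀ x : Fin (κ.blocksFun i) × Fin l,
        rootOrder m (rootsOverCenter (κ := κ) l i (.inr (.inr (.inl x))))
          (inner ℝ (rootsOverCenter (κ := κ) l i (.inr (.inr (.inl x)))) (logPoint κ m num)) =
        (if (-(((κ.blocksFun i : ℝ) - 1) / 2) + (x.1 : ℕ)) +
          ((content (num x.2 : ℕ × ℕ) : ℝ) + m) = -1 then 1 else 0) -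
        (if (-(((κ.blocksFun i : ℝ) - 1) / 2) + (x.1 : ℕ)) +
          ((content (num x.2 : ℕ × ℕ) : ℝ) + m) = 0 then 1 else 0) := by
      intro x
      rw [rootOrder, rootsOverCenter, labelExp_add m (pos_ne_natAdd κ l _ _ _),
        inner_add_left, inner_e_left, inner_e_left, logPoint_pos, logPoint_natAdd]
    have e4 : ∀ x : Fin (κ.blocksFun i) × Fin l,
        rootOrder m (rootsOverCenter (κ := κ) l i (.inr (.inr (.inr x))))
          (inner ℝ (rootsOverCenter (κ := κ) l i (.inr (.inr (.inr x)))) (logPoint κ m num)) =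
        (if (-(((κ.blocksFun i : ℝ) - 1) / 2) + (x.1 : ℕ)) -
          ((content (num x.2 : ℕ × ℕ) : ℝ) + m) = -1 then 1 else 0) -
        (if (-(((κ.blocksFun i : ℝ) - 1) / 2) + (x.1 : ℕ)) -
          ((content (num x.2 : ℕ × ℕ) : ℝ) + m) = 0 then 1 else 0) := by
      intro x
      rw [rootOrder, rootsOverCenter, labelExp_sub m (pos_ne_natAdd κ l _ _ _),
        inner_sub_left, inner_e_left, inner_e_left, logPoint_pos, logPoint_natAdd]
    rw [Finset.sum_congr rfl fun d _ => e1 d, Finset.sum_congr rfl fun d _ => e2 d,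
      Finset.sum_congr rfl fun d _ => e3 d, Finset.sum_congr rfl fun d _ => e4 d,
      sum_rootOrder_short, sum_rootOrder_pairs, sum_rootOrder_box_add, sum_rootOrder_box_sub]
    have hpairs := sum_pairs_strip (blocksFun_pos κ i)
    constructor <;> intro h <;> linarith
  · intro x hx
    obtain ⟨-, a, ha, h⟩ := (mem_range_rootsOverCenter i _).2 ⟨x, rfl⟩
    rw [inner_center] at hx
    have h1 := congrArg (blockSum κ l i) h
    rw [blockSum_res, map_smul, blockSum_center, if_pos rfl, smul_eq_mul, mul_one] at h1
    rw [h1] at hx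
    have h2 : (0 : ℝ) < (κ.blocksFun i : ℝ)⁻¹ := by
      exact_mod_cast inv_pos.2 (Nat.cast_pos.2 (blocksFun_pos κ i))
    exact (mul_pos h2 ha).ne' hx

end CenterPole

/-! ### Weights of irreducible representations -/

section Weights

variable {n : ℕ} {D : Datum n} {L : Set (Fin n)}

lemma θ_zero : θ D L 0 = 1 := by
  rw [θ, RingQuot.mkAlgHom_rel ℂ Rel.theta_zero, map_one]

lemma θ_add (x y : XL D L) : θ D L (x + y) = θ D L x * θ D L y := by
  rw [θ, RingQuot.mkAlgHom_rel ℂ (Rel.theta_add x y), map_mul]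
  rfl

lemma T_quadratic (i : L) : (T D L i + 1) * (T D L i - algebraMap ℂ _ (D.qSimple i : ℂ)) = 0 := by
  have := RingQuot.mkAlgHom_rel ℂ (Rel.quadratic (D := D) i)
  rw [map_mul, map_add, map_sub, map_one, map_zero, AlgHom.commutes] at this
  exact this

lemma T_cross (i : L) (x : XL D L) (k : ℕ)
    (hk : coPair (x : E n) (simpleRoot (i : Fin n)) = k) :
    θ D L x * T D L i - T D L i * θ D L (x - k • simpleXL D L i) =
      ∑ a ∈ Finset.range k, (D.crossCoef i a : ℂ) • θ D L (x - a • simpleXL D L i) := by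
  have := RingQuot.mkAlgHom_rel ℂ (Rel.cross (D := D) i x k hk)
  rw [map_sub, map_mul, map_mul, map_sum] at this
  simp only [map_smul] at this
  exact this

lemma inner_starProjection_of_mem {α : E n} (hα : α ∈ spanL L) (x : E n) :
    inner ℝ (projL L x) α = inner ℝ x α := by
  have h : projL L α = α := Submodule.starProjection_eq_self_iff.2 hα
  conv_rhs => rw [← h]
  exact Submodule.inner_starProjection_left_eq_right _ _ _

lemma rootsL_subset_roots : rootsL L ⊆ roots n := fun _ h => h.1

lemma WL_le_W0 : WL L ≤ W0 n := Subgroup.closure_mono (Set.image_mono rootsL_subset_roots)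

lemma root_mem_XL {α : E n} (hα : α ∈ rootsL L) : α ∈ XL D L :=
  ⟨α, D.root_mem hα.1, Submodule.starProjection_eq_self_iff.2 hα.2⟩

lemma exists_int_coPair {y : E n} (hy : y ∈ XL D L) {α : E n} (hα : α ∈ rootsL L) :
    ∃ z : ℤ, coPair y α = z := by
  obtain ⟨x, hx, rfl⟩ := hy
  obtain ⟨z, hz⟩ := D.le_weight x hx α hα.1
  exact ⟨z, by rw [← hz, coPair, coPair, inner_starProjection_of_mem hα.2]⟩

lemma WL_apply_mem {w : E n ≃ₗᵢ[ℝ] E n} (hw : w ∈ WL L) : ∀ y ∈ XL D L, w y ∈ XL D L := by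
  have key : ∀ α ∈ rootsL L, ∀ y ∈ XL D L, refl α y ∈ XL D L := by
    intro α hα y hy
    obtain ⟨z, hz⟩ := exists_int_coPair hy hα
    rw [refl_apply, hz, Int.cast_smul_eq_zsmul]
    exact (XL D L).sub_mem hy ((XL D L).zsmul_mem (root_mem_XL hα) z)
  induction hw using Subgroup.closure_induction'' with
  | mem g hg =>
    obtain ⟨α, hα, rfl⟩ := hg
    exact key α hα
  | inv_mem g hg =>
    obtain ⟨α, hα, rfl⟩ := hg
    rw [refl_inv]
    exact key α hα
  | one => exact fun y hy => hy
  | mul g h _ _ ig ih => exact fun y hy => ig _ (ih y hy)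

/-- The action of `w ∈ W_L` on `X_L`. -/
def actXL (w : E n ≃ₗᵢ[ℝ] E n) (hw : w ∈ WL L) : XL D L ≃+ XL D L where
  toFun y := ⟨w y, WL_apply_mem hw y y.2⟩
  invFun y := ⟨w⁻¹ y, WL_apply_mem ((WL L).inv_mem hw) y y.2⟩
  left_inv y := Subtype.ext (w.symm_apply_apply y)
  right_inv y := Subtype.ext (w.apply_symm_apply y)
  map_add' x y := Subtype.ext (map_add w (x : E n) y)

instance finite_WL : Finite (WL L) :=
  Finite.of_injective _ (Subgroup.inclusion_injective (WL_le_W0 (L := L)))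

variable {V : Type*} [AddCommGroup V] [Module ℂ V] {δ : Hecke D L →ₐ[ℂ] Module.End ℂ V}

variable (δ) in
/-- The action of the group algebra of `X_L`, spanned by the `θ_x`. -/
def thetaRep : AddMonoidAlgebra ℂ (XL D L) →ₐ[ℂ] Module.End ℂ V :=
  AddMonoidAlgebra.lift ℂ (Module.End ℂ V) (XL D L)
    { toFun := fun x => δ (θ D L x.toAdd)
      map_one' := by rw [toAdd_one, θ_zero, map_one]
      map_mul' := fun x y => by rw [toAdd_mul, θ_add, map_mul] }

/-- The extension of a character of `X_L` to the group algebra. -/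
def charAlg (t : AddChar (XL D L) ℂ) : AddMonoidAlgebra ℂ (XL D L) →ₐ[ℂ] ℂ :=
  AddMonoidAlgebra.lift ℂ ℂ (XL D L)
    { toFun := fun x => t x.toAdd
      map_one' := by rw [toAdd_one, AddChar.map_zero_eq_one]
      map_mul' := fun x y => by rw [toAdd_mul, AddChar.map_add_eq_mul] }

lemma thetaRep_single (x : XL D L) :
    thetaRep δ (AddMonoidAlgebra.single x 1) = δ (θ D L x) := by
  rw [thetaRep, AddMonoidAlgebra.lift_single, one_smul]
  rfl

lemma charAlg_single (t : AddChar (XL D L) ℂ) (x : XL D L) :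
    charAlg t (AddMonoidAlgebra.single x 1) = t x := by
  rw [charAlg, AddMonoidAlgebra.lift_single, one_smul]
  rfl

lemma thetaRep_of_invariant {r : AddChar (XL D L) ℂ} (hcc : HasCentralChar δ r)
    {f : AddMonoidAlgebra ℂ (XL D L)}
    (hf : ∀ w (hw : w ∈ WL L), AddMonoidAlgebra.domCongr ℂ ℂ (actXL w hw) f = f) :
    thetaRep δ f = charAlg r f • 1 := by
  have h := hcc f.coeff fun w hw x y hxy => by
    have h1 := congrArg (fun g => g.coeff y) (hf w hw)
    simp only [AddMonoidAlgebra.coeff_domCongr] at h1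
    have h2 : (actXL w hw).symm y = x := by
      rw [AddEquiv.symm_apply_eq]
      exact Subtype.ext hxy
    rw [h2] at h1
    exact h1.symm
  rw [thetaRep, charAlg, AddMonoidAlgebra.lift_apply, AddMonoidAlgebra.lift_apply]
  refine Eq.trans ?_ h
  rw [Finsupp.sum, Finsupp.sum, map_sum]
  exact Finset.sum_congr rfl fun x _ => (map_smul δ _ _).symm

open Polynomial in
/-- For a finite family `y` in `X_L` that is permuted by `W_L`, the coefficients of
`∏ (Z - θ_{y i})` are `W_L`-invariant, hence act by the scalars prescribed by the central
character. -/
lemma thetaRep_prod {r : AddChar (XL D L) ℂ} (hcc : HasCentralChar δ r) {ι : Type*} [Fintype ι]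
    (y : ι → XL D L)
    (hy : ∀ w ∈ WL L, ∃ σ : Equiv.Perm ι, ∀ i, (y (σ i) : E n) = w (y i)) :
    (∏ i, (X - C (AddMonoidAlgebra.single (y i) (1 : ℂ)))).map (thetaRep δ : _ →+* _) =
      (∏ i, (X - C (r (y i)))).map (algebraMap ℂ (Module.End ℂ V)) := by
  set P : (AddMonoidAlgebra ℂ (XL D L))[X] :=
    ∏ i, (X - C (AddMonoidAlgebra.single (y i) (1 : ℂ))) with hP
  have hinv : ∀ w (hw : w ∈ WL L) j,
      AddMonoidAlgebra.domCongr ℂ ℂ (actXL w hw) (P.coeff j) = P.coeff j := by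
    intro w hw j
    obtain ⟨σ, hσ⟩ := hy w hw
    have hmap : P.map ((AddMonoidAlgebra.domCongr ℂ ℂ (actXL (D := D) w hw) :
        AddMonoidAlgebra ℂ (XL D L) →ₐ[ℂ] AddMonoidAlgebra ℂ (XL D L)) : _ →+* _) = P := by
      rw [hP, Polynomial.map_prod]
      conv_rhs => rw [← Equiv.prod_comp σ]
      refine Finset.prod_congr rfl fun i _ => ?_
      rw [Polynomial.map_sub, map_X, map_C]
      have h1 : actXL w hw (y i) = y (σ i) := Subtype.ext (hσ i).symm
      have h2 : AddMonoidAlgebra.domCongr ℂ ℂ (actXL w hw)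
          (AddMonoidAlgebra.single (y i) (1 : ℂ)) = AddMonoidAlgebra.single (y (σ i)) 1 := by
        rw [AddMonoidAlgebra.domCongr_single, h1]
      exact congrArg (fun z => X - C z) h2
    have := congrArg (fun Q => Q.coeff j) hmap
    rwa [coeff_map] at this
  have hR : ∏ i, (X - C (r (y i))) = P.map (charAlg r : _ →+* _) := by
    rw [hP, Polynomial.map_prod]
    refine Finset.prod_congr rfl fun i _ => ?_
    rw [Polynomial.map_sub, map_X, map_C]
    exact congrArg (fun z => X - C z) (charAlg_single r (y i)).symm
  ext1 j
  rw [hR, coeff_map, coeff_map, coeff_map]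
  refine (thetaRep_of_invariant hcc fun w hw => hinv w hw j).trans ?_
  exact (Algebra.algebraMap_eq_smul_one _).symm

/-- An endomorphism killed by a product of linear factors has an eigenvector. -/
lemma exists_eigenvector_of_prod {ι : Type*} (f : Module.End ℂ V) (U : Submodule ℂ V)
    (hU : ∀ u ∈ U, f u ∈ U) (c : ι → ℂ) (s : Finset ι) (u : V) (hu : u ∈ U) (hu0 : u ≠ 0)
    (h : Polynomial.aeval f (∏ i ∈ s, (Polynomial.X - Polynomial.C (c i))) u = 0) :
    ∃ a : ℂ, ∃ v ∈ U, v ≠ 0 ∧ f v = a • v := by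
  classical
  induction s using Finset.induction_on generalizing u with
  | empty => simp at h; exact absurd h hu0
  | insert i s hi ih =>
    by_cases h1 : f u - c i • u = 0
    · exact ⟨c i, u, hu, hu0, sub_eq_zero.1 h1⟩
    · refine ih (f u - c i • u) (U.sub_mem (hU u hu) (U.smul_mem _ hu)) h1 ?_
      rw [Finset.prod_insert hi, mul_comm, map_mul, Module.End.mul_apply] at h
      simpa [Algebra.algebraMap_eq_smul_one] using h

lemma aeval_theta_prod {r : AddChar (XL D L) ℂ} (hcc : HasCentralChar δ r) {ι : Type*} [Fintype ι]
    (y : ι → XL D L)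
    (hy : ∀ w ∈ WL L, ∃ σ : Equiv.Perm ι, ∀ i, (y (σ i) : E n) = w (y i)) (i : ι) :
    Polynomial.aeval (δ (θ D L (y i))) (∏ i, (Polynomial.X - Polynomial.C (r (y i)))) = 0 := by
  have h := congrArg (Polynomial.eval (δ (θ D L (y i)))) (thetaRep_prod hcc y hy)
  rw [Polynomial.eval_map_algebraMap] at h
  rw [← h, Polynomial.eval_map, ← thetaRep_single]
  -- evaluating at the image of an element of the commutative group algebra is multiplicative
  rw [show Polynomial.eval₂ (thetaRep δ : AddMonoidAlgebra ℂ (XL D L) →+* Module.End ℂ V)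
      (thetaRep δ (AddMonoidAlgebra.single (y i) 1))
      (∏ i, (Polynomial.X - Polynomial.C (AddMonoidAlgebra.single (y i) (1 : ℂ)))) =
      thetaRep δ ((∏ i, (Polynomial.X -
        Polynomial.C (AddMonoidAlgebra.single (y i) (1 : ℂ)))).eval
          (AddMonoidAlgebra.single (y i) 1)) from
    Polynomial.eval₂_at_apply (thetaRep δ : AddMonoidAlgebra ℂ (XL D L) →+* Module.End ℂ V) _]
  rw [Polynomial.eval_prod, Finset.prod_eq_zero (Finset.mem_univ i) (by simp), map_zero]

lemma prod_weight_eq {r t : AddChar (XL D L) ℂ} (hcc : HasCentralChar δ r)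
    (ht : IsWeightOf δ t) {ι : Type*} [Fintype ι]
    (y : ι → XL D L)
    (hy : ∀ w ∈ WL L, ∃ σ : Equiv.Perm ι, ∀ i, (y (σ i) : E n) = w (y i)) :
    ∏ i, (Polynomial.X - Polynomial.C (t (y i))) =
      ∏ i, (Polynomial.X - Polynomial.C (r (y i))) := by
  obtain ⟨v, hv, htv⟩ := ht
  have hact : ∀ f : AddMonoidAlgebra ℂ (XL D L), thetaRep δ f v = charAlg t f • v := by
    intro f
    rw [thetaRep, charAlg, AddMonoidAlgebra.lift_apply, AddMonoidAlgebra.lift_apply, Finsupp.sum,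
      Finsupp.sum, LinearMap.sum_apply, Finset.sum_smul]
    refine Finset.sum_congr rfl fun x _ => ?_
    rw [LinearMap.smul_apply, smul_assoc]
    exact congrArg _ (htv x)
  have hT : ∏ i, (Polynomial.X - Polynomial.C (t (y i))) =
      (∏ i, (Polynomial.X - Polynomial.C (AddMonoidAlgebra.single (y i) (1 : ℂ)))).map
        (charAlg t : AddMonoidAlgebra ℂ (XL D L) →+* ℂ) := by
    rw [Polynomial.map_prod]
    refine Finset.prod_congr rfl fun i _ => ?_
    rw [Polynomial.map_sub, Polynomial.map_X, Polynomial.map_C]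
    exact congrArg (fun z => Polynomial.X - Polynomial.C z) (charAlg_single t (y i)).symm
  ext j
  have h := congrArg (fun Q => Q.coeff j v) (thetaRep_prod hcc y hy)
  simp only [Polynomial.coeff_map] at h
  have h1 : charAlg t ((∏ i, (Polynomial.X -
      Polynomial.C (AddMonoidAlgebra.single (y i) (1 : ℂ)))).coeff j) • v =
      (∏ i, (Polynomial.X - Polynomial.C (r (y i)))).coeff j • v := by
    rw [← hact]
    refine Eq.trans h ?_
    rw [Algebra.algebraMap_eq_smul_one]
    rfl
  rw [hT, Polynomial.coeff_map]
  exact smul_left_injective ℂ hv h1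

lemma fg_XL : (XL D L).FG := by
  have hX : D.X.FG := by
    rw [← D.X.toIntSubmodule_toAddSubgroup, ← Submodule.fg_iff_addSubgroup_fg]
    set M : Submodule ℤ (E n) :=
      Submodule.span ℤ (Set.range fun i : Fin n => ((2 : ℝ)⁻¹ • e i : E n)) with hM
    have : IsNoetherian ℤ M := isNoetherian_span_of_finite ℤ (Set.finite_range _)
    have hle : D.X.toIntSubmodule ≤ M := by
      intro x hx
      have hx : x ∈ D.X := hx
      rw [← sum_smul_e x]
      refine Submodule.sum_mem _ fun i _ => ?_
      obtain ⟨z, hz⟩ := D.le_weight x hx (e i) (e_mem_roots i)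
      rw [coPair_e] at hz
      have : x i • (e i : E n) = z • ((2 : ℝ)⁻¹ • e i : E n) := by
        rw [← Int.cast_smul_eq_zsmul ℝ, ← hz, smul_smul]
        congr 1
        ring
      rw [this]
      exact Submodule.smul_mem _ _ (Submodule.subset_span ⟨i, rfl⟩)
    have : IsNoetherian ℤ D.X.toIntSubmodule := isNoetherian_of_le hle
    exact Submodule.fg_top _ |>.1 (IsNoetherian.noetherian ⊤)
  classical
  obtain ⟨S, hS⟩ := hX
  refine ⟨S.image (projL L), ?_⟩
  rw [Finset.coe_image, ← AddMonoidHom.map_closure, hS]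
  rfl

/-- Every nonzero subspace that is stable under all `θ_x` contains a weight vector: the `θ_x`
commute, each of them is killed by a product of linear factors, and `X_L` is finitely generated. -/
lemma exists_weight_mem {r : AddChar (XL D L) ℂ} (hcc : HasCentralChar δ r) (U : Submodule ℂ V)
    (hU0 : U ≠ ⊥) (hU : ∀ x, ∀ u ∈ U, δ (θ D L x) u ∈ U) :
    ∃ t : AddChar (XL D L) ℂ, ∃ v ∈ U, v ≠ 0 ∧ ∀ x, δ (θ D L x) v = t x • v := by
  classical
  have hcomm : ∀ x y v, δ (θ D L x) (δ (θ D L y) v) = δ (θ D L y) (δ (θ D L x) v) := by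
    intro x y v
    rw [← Module.End.mul_apply, ← Module.End.mul_apply, ← map_mul, ← map_mul, ← θ_add, ← θ_add,
      add_comm]
  have hker : ∀ x : XL D L, ∀ W : Submodule ℂ V, W ≠ ⊥ → (∀ x, ∀ u ∈ W, δ (θ D L x) u ∈ W) →
      ∃ a : ℂ, ∃ v ∈ W, v ≠ 0 ∧ δ (θ D L x) v = a • v := by
    intro x W hW0 hW
    obtain ⟨u, hu, hu0⟩ := W.ne_bot_iff.1 hW0
    have : Fintype (WL L) := Fintype.ofFinite _
    have h := aeval_theta_prod hcc (fun w : WL L => actXL w.1 w.2 x)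
      (fun w hw => ⟨Equiv.mulLeft ⟨w, hw⟩, fun i => rfl⟩) 1
    have h1 : actXL (1 : WL L).1 (1 : WL L).2 x = x := rfl
    rw [h1] at h
    exact exists_eigenvector_of_prod _ W (hW x) _ Finset.univ u hu hu0 (by rw [h]; rfl)
  have hfin : ∀ S : Finset (XL D L), ∃ W : Submodule ℂ V, W ≤ U ∧ W ≠ ⊥ ∧
      (∀ x, ∀ u ∈ W, δ (θ D L x) u ∈ W) ∧ ∀ x ∈ S, ∃ a : ℂ, ∀ u ∈ W, δ (θ D L x) u = a • u := by
    intro S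
    induction S using Finset.induction_on with
    | empty => exact ⟨U, le_rfl, hU0, hU, by simp⟩
    | insert x S _ ih =>
      obtain ⟨W, hWU, hW0, hW, hS⟩ := ih
      obtain ⟨a, v, hv, hv0, hav⟩ := hker x W hW0 hW
      refine ⟨W ⊓ LinearMap.ker (δ (θ D L x) - a • 1), inf_le_left.trans hWU, ?_, ?_, ?_⟩
      · rw [Submodule.ne_bot_iff]
        exact ⟨v, ⟨hv, by simp [hav]⟩, hv0⟩
      · rintro y u ⟨hu, hu'⟩
        refine ⟨hW y u hu, ?_⟩
        simp only [SetLike.mem_coe, LinearMap.mem_ker, LinearMap.sub_apply, LinearMap.smul_apply,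
          Module.End.one_apply, sub_eq_zero] at hu' ⊢
        rw [hcomm, hu', map_smul]
      · intro y hy
        rcases Finset.mem_insert.1 hy with rfl | hy
        · refine ⟨a, fun u hu => ?_⟩
          have := hu.2
          simpa [sub_eq_zero] using this
        · obtain ⟨b, hb⟩ := hS y hy
          exact ⟨b, fun u hu => hb u hu.1⟩
  obtain ⟨S, hS⟩ := (AddGroup.fg_iff_addSubgroup_fg (XL D L)).2 fg_XL |>.out
  obtain ⟨W, hWU, hW0, -, hWS⟩ := hfin S
  obtain ⟨v, hv, hv0⟩ := W.ne_bot_iff.1 hW0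
  have hall : ∀ x : XL D L, ∃ a : ℂ, δ (θ D L x) v = a • v := by
    intro x
    have hx : x ∈ AddSubgroup.closure (S : Set (XL D L)) := by rw [hS]; trivial
    induction hx using AddSubgroup.closure_induction with
    | mem y hy =>
      obtain ⟨a, ha⟩ := hWS y hy
      exact ⟨a, ha v hv⟩
    | zero => exact ⟨1, by rw [θ_zero, map_one, one_smul]; rfl⟩
    | add x y _ _ ihx ihy =>
      obtain ⟨a, ha⟩ := ihx
      obtain ⟨b, hb⟩ := ihy
      refine ⟨b * a, ?_⟩
      rw [θ_add, map_mul, Module.End.mul_apply, hb, map_smul, ha, smul_smul]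
    | neg x _ ihx =>
      obtain ⟨a, ha⟩ := ihx
      have h1 : δ (θ D L (-x)) (δ (θ D L x) v) = v := by
        rw [← Module.End.mul_apply, ← map_mul, ← θ_add, neg_add_cancel, θ_zero, map_one]
        rfl
      rw [ha, map_smul] at h1
      have ha0 : a ≠ 0 := by
        rintro rfl
        rw [zero_smul] at h1
        exact hv0 h1.symm
      refine ⟨a⁻¹, ?_⟩
      conv_rhs => rw [← h1]
      rw [smul_smul, inv_mul_cancel₀ ha0, one_smul]
  choose t ht using hall
  have hinj := smul_left_injective ℂ hv0
  refine ⟨⟨t, hinj ?_, fun x y => hinj ?_⟩, v, hWU hv, hv0, ht⟩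
  · dsimp only
    rw [← ht, θ_zero, map_one, one_smul]
    rfl
  · dsimp only
    rw [← ht, θ_add, map_mul, Module.End.mul_apply, ht, map_smul, ht, smul_smul, mul_comm]

end Weights

/-! ### Rank one intertwiners -/

section Intertwiner

variable {n : ℕ} {D : Datum n} {L : Set (Fin n)}
variable {V : Type*} [AddCommGroup V] [Module ℂ V] {δ : Hecke D L →ₐ[ℂ] Module.End ℂ V}

lemma simpleRoot_mem_rootsL (i : L) : simpleRoot (i : Fin n) ∈ rootsL L :=
  ⟨simpleRoot_mem_roots _, Submodule.subset_span ⟨i, i.2, rfl⟩⟩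

lemma refl_simpleRoot_mem_WL (i : L) : refl (simpleRoot (i : Fin n)) ∈ WL L :=
  Subgroup.subset_closure ⟨_, simpleRoot_mem_rootsL i, rfl⟩

lemma qSimple_of_long {i : Fin n} (h : simpleRoot i ∈ longRoots n) : D.qSimple i = D.q₁ := by
  simp [Datum.qSimple, Datum.q, Datum.qHalf, h]

lemma crossCoef_of_long {i : Fin n} (h : simpleRoot i ∈ longRoots n) (a : ℕ) :
    D.crossCoef i a = D.q₁ - 1 := by
  simp [Datum.crossCoef, Datum.q, Datum.qHalf, h]

lemma actXL_refl_simpleRoot (i : L) (y : XL D L) (z : ℤ)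
    (hz : coPair (y : E n) (simpleRoot (i : Fin n)) = z) :
    actXL _ (refl_simpleRoot_mem_WL i) y = y - z • simpleXL D L i := by
  refine Subtype.ext ?_
  change refl _ (y : E n) = _
  rw [refl_apply, hz, Int.cast_smul_eq_zsmul]
  rfl

lemma theta_mul_apply (x y : XL D L) (v : V) :
    δ (θ D L x) (δ (θ D L y) v) = δ (θ D L (x + y)) v := by
  rw [θ_add, map_mul, Module.End.mul_apply]

/-- If `v` transforms under the `θ_y`, `y ∈ P`, by the character `χ`, then a combination of `T_i v`
and `v` transforms by the reflected character. -/
lemma theta_intertwiner (i : L) (hi : simpleRoot (i : Fin n) ∈ longRoots n)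
    (P : AddSubgroup (XL D L)) (hP : simpleXL D L i ∈ P) (χ : AddChar (XL D L) ℂ) (v : V)
    (hv : ∀ y ∈ P, δ (θ D L y) v = χ y • v) (hz : χ (-simpleXL D L i) ≠ 1) :
    ∀ y ∈ P, δ (θ D L y)
        (δ (T D L i) v - (((D.q₁ : ℂ) - 1) / (1 - χ (-simpleXL D L i))) • v) =
      χ (actXL _ (refl_simpleRoot_mem_WL i) y) •
        (δ (T D L i) v - (((D.q₁ : ℂ) - 1) / (1 - χ (-simpleXL D L i))) • v) := by
  set z := χ (-simpleXL D L i) with hzdef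
  set c := ((D.q₁ : ℂ) - 1) / (1 - z) with hc
  have hz1 : 1 - z ≠ 0 := sub_ne_zero.2 (Ne.symm hz)
  have hχ : ∀ (y : XL D L) (a : ℕ), χ (y - a • simpleXL D L i) = χ y * z ^ a := by
    intro y a
    rw [sub_eq_add_neg, AddChar.map_add_eq_mul, ← smul_neg, AddChar.map_nsmul_eq_pow]
  have hnat : ∀ y ∈ P, ∀ k : ℕ, coPair (y : E n) (simpleRoot (i : Fin n)) = k →
      δ (θ D L y) (δ (T D L i) v - c • v) =
        χ (actXL _ (refl_simpleRoot_mem_WL i) y) • (δ (T D L i) v - c • v) := by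
    intro y hy k hk
    have h := congrArg (fun X => δ X v) (T_cross i y k hk)
    simp only [map_sub, map_mul, map_sum, map_smul, LinearMap.sub_apply, Module.End.mul_apply,
      LinearMap.sum_apply, LinearMap.smul_apply, crossCoef_of_long hi] at h
    rw [hv _ (P.sub_mem hy (P.nsmul_mem hP k)), map_smul,
      Finset.sum_congr rfl fun a _ => by rw [hv _ (P.sub_mem hy (P.nsmul_mem hP a)), hχ]] at h
    simp only [smul_smul] at h
    rw [← Finset.sum_smul, ← Finset.mul_sum, ← Finset.mul_sum] at h
    have hgeom : (1 - z) * ∑ a ∈ Finset.range k, z ^ a = 1 - z ^ k := mul_neg_geom_sum z k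
    have hgeom' : ((D.q₁ - 1 : ℝ) : ℂ) * (χ y * ∑ a ∈ Finset.range k, z ^ a) =
        c * (χ y - χ y * z ^ k) := by
      rw [hc]
      field_simp
      push_cast
      linear_combination ((D.q₁ : ℂ) - 1) * χ y * hgeom
    rw [hgeom', hχ] at h
    rw [actXL_refl_simpleRoot i y k (by exact_mod_cast hk), natCast_zsmul, hχ, map_sub, map_smul,
      hv y hy, sub_eq_iff_eq_add.1 h]
    module
  intro y hy
  obtain ⟨k, hk⟩ := exists_int_coPair y.2 (simpleRoot_mem_rootsL i)
  rcases le_or_gt 0 k with h0 | h0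
  · lift k to ℕ using h0
    exact hnat y hy k (by exact_mod_cast hk)
  · have h1 := hnat (-y) (P.neg_mem hy) (-k).toNat (by
      have : (((-k).toNat : ℕ) : ℝ) = ((-k : ℤ) : ℝ) := by
        exact_mod_cast congrArg (Int.cast (R := ℝ)) (Int.toNat_of_nonneg (by omega : 0 ≤ -k))
      rw [this]
      push_cast
      rw [← hk]
      simp [coPair, neg_div])
    set u := δ (T D L i) v - c • v
    have h2 := congrArg (δ (θ D L y)) h1
    rw [theta_mul_apply, add_neg_cancel, θ_zero, map_one, Module.End.one_apply, map_smul,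
      map_neg, AddChar.map_neg_eq_inv] at h2
    have hne : χ (actXL _ (refl_simpleRoot_mem_WL i) y) ≠ 0 := by
      intro h
      have := AddChar.map_add_eq_mul χ (actXL _ (refl_simpleRoot_mem_WL i) y)
        (-actXL _ (refl_simpleRoot_mem_WL i) y)
      rw [add_neg_cancel, AddChar.map_zero_eq_one, h, zero_mul] at this
      exact one_ne_zero this
    conv_rhs => rw [h2]
    rw [smul_smul, mul_inv_cancel₀ hne, one_smul]

lemma eigenvalue_T (i : L) (hi : simpleRoot (i : Fin n) ∈ longRoots n) {v : V} (hv : v ≠ 0)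
    {c : ℂ} (h : δ (T D L i) v = c • v) : c = -1 ∨ c = D.q₁ := by
  have h1 := congrArg (fun X => δ X v) (T_quadratic (D := D) i)
  simp only [map_mul, map_add, map_sub, map_one, map_zero, AlgHom.commutes, Module.End.mul_apply,
    LinearMap.sub_apply, LinearMap.add_apply, Module.algebraMap_end_apply, h,
    Module.End.one_apply, LinearMap.zero_apply, map_smul, qSimple_of_long hi] at h1
  have h2 : ((c + 1) * (c - D.q₁)) • v = 0 := by
    rw [← h1]
    module
  rcases mul_eq_zero.1 ((smul_eq_zero.1 h2).resolve_right hv) with h3 | h3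
  · exact Or.inl (eq_neg_of_add_eq_zero_left h3)
  · exact Or.inr (sub_eq_zero.1 h3)

end Intertwiner

/-! ### Arrangements of a centred strip with negative partial sums -/

section Permutations

/-- The sum of the largest entries of a centred strip is nonnegative. -/
lemma sum_strip_upper_nonneg (p v : ℕ) :
    0 ≤ ∑ w : Fin p, if v < (w : ℕ) then -(((p : ℝ) - 1) / 2) + (w : ℕ) else 0 := by
  rcases le_or_gt (((p : ℝ) - 1) / 2) v with h | h
  · refine Finset.sum_nonneg fun w _ => ?_
    split_ifs with hw
    · have : (v : ℝ) < (w : ℕ) := by exact_mod_cast hw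
      linarith
    · exact le_rfl
  · have h1 : ∑ w : Fin p, (if v < (w : ℕ) then -(((p : ℝ) - 1) / 2) + (w : ℕ) else 0) =
        ∑ w : Fin p, (if v < (w : ℕ) then 0 else -(-(((p : ℝ) - 1) / 2) + (w : ℕ))) := by
      rw [← sub_eq_zero, ← Finset.sum_sub_distrib]
      refine Eq.trans ?_ (sum_strip_eq_zero p)
      refine Finset.sum_congr rfl fun w _ => ?_
      split_ifs <;> ring
    rw [h1]
    refine Finset.sum_nonneg fun w _ => ?_
    split_ifs with hw
    · exact le_rfl
    · have : ((w : ℕ) : ℝ) ≤ v := by exact_mod_cast not_lt.1 hw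
      linarith

/-- Consider arrangements of the entries of a centred strip. If a set of arrangements is closed
under swapping neighbours that differ by more than one, and if all its members have negative
proper partial sums, then it contains at most the increasing arrangement: if `v + 1` came before
`v`, all entries larger than `v` could be moved to the front. -/
lemma perm_eq_one_of_partial_sums {p : ℕ} (S : Set (Equiv.Perm (Fin p)))
    (hswap : ∀ σ ∈ S, ∀ (a : ℕ) (h : a + 1 < p),
      ((σ ⟨a, by omega⟩ : ℕ) + 2 ≤ σ ⟨a + 1, h⟩ ∨ (σ ⟨a + 1, h⟩ : ℕ) + 2 ≤ σ ⟨a, by omega⟩) →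
      σ * Equiv.swap ⟨a, by omega⟩ ⟨a + 1, h⟩ ∈ S)
    (hsum : ∀ σ ∈ S, ∀ j : ℕ, 0 < j → j < p →
      ∑ d : Fin p, (if (d : ℕ) < j then -(((p : ℝ) - 1) / 2) + (σ d : ℕ) else 0) < 0) :
    ∀ σ ∈ S, σ = 1 := by
  have main : ∀ (v : ℕ) (hv : v + 1 < p) (N : ℕ), ∀ σ ∈ S,
      ∑ w : Fin p, (if v < (w : ℕ) then (σ.symm w : ℕ) else 0) = N →
      ¬ σ.symm ⟨v + 1, hv⟩ < σ.symm ⟨v, by omega⟩ := by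
    intro v hv N
    induction N using Nat.strong_induction_on with
    | _ N ih =>
      intro σ hσ hN hinv
      by_cases hex : ∃ (a : ℕ) (h : a + 1 < p), (σ ⟨a, by omega⟩ : ℕ) ≤ v ∧ v < σ ⟨a + 1, h⟩
      · obtain ⟨a, ha, h1, h2⟩ := hex
        set x : Fin p := ⟨a, by omega⟩ with hx
        set y : Fin p := ⟨a + 1, ha⟩ with hy
        have hxy : x < y := by rw [Fin.lt_def]; simp [hx, hy]
        have hgap : (σ x : ℕ) + 2 ≤ σ y := by
          by_contra hlt
          have e1 : σ x = ⟨v, by omega⟩ := Fin.ext (by dsimp; omega)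
          have e2 : σ y = ⟨v + 1, hv⟩ := Fin.ext (by dsimp; omega)
          rw [← e1, ← e2, Equiv.symm_apply_apply, Equiv.symm_apply_apply] at hinv
          exact absurd hxy hinv.asymm
        have hsymm : ∀ w, (σ * Equiv.swap x y).symm w = Equiv.swap x y (σ.symm w) := fun w => rfl
        have hle : ∀ w : Fin p, v < (w : ℕ) → Equiv.swap x y (σ.symm w) ≤ σ.symm w := by
          intro w hw
          have hwx : σ.symm w ≠ x := by
            intro h
            rw [← h, Equiv.apply_symm_apply] at h1
            omega
          by_cases hwy : σ.symm w = y
          · rw [hwy, Equiv.swap_apply_right]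
            exact hxy.le
          · rw [Equiv.swap_apply_of_ne_of_ne hwx hwy]
        refine ih _ ?_ _ (hswap σ hσ a ha (Or.inl hgap)) rfl ?_
        · rw [← hN]
          refine Finset.sum_lt_sum (fun w _ => ?_) ⟨σ y, Finset.mem_univ _, ?_⟩
          · split_ifs with hw
            · exact hle w hw
            · exact le_rfl
          · rw [if_pos h2, if_pos h2, hsymm, Equiv.symm_apply_apply, Equiv.swap_apply_right]
            exact hxy
        · rw [hsymm, hsymm]
          refine (hle _ (Nat.lt_succ_self v)).trans_lt (hinv.trans_le ?_)
          have hvy : σ.symm ⟨v, by omega⟩ ≠ y := by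
            intro h
            rw [← h, Equiv.apply_symm_apply] at h2
            exact lt_irrefl _ h2
          by_cases hvx : σ.symm ⟨v, by omega⟩ = x
          · rw [hvx, Equiv.swap_apply_left]
            exact hxy.le
          · rw [Equiv.swap_apply_of_ne_of_ne hvx hvy]
      · push Not at hex
        -- the entries larger than `v` form an initial segment
        have hdown : ∀ (t a : ℕ) (h : a + t < p), (σ ⟨a, by omega⟩ : ℕ) ≤ v →
            (σ ⟨a + t, h⟩ : ℕ) ≤ v := by
          intro t
          induction t with
          | zero => intro a h h'; exact h'
          | succ t iht => intro a h h'; exact hex (a + t) h (iht a (by omega) h')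
        classical
        have hexj : ∃ j : ℕ, ∃ h : j < p, (σ ⟨j, h⟩ : ℕ) ≤ v :=
          ⟨σ.symm ⟨v, by omega⟩, Fin.is_lt _, by simp⟩
        set j := Nat.find hexj with hj
        obtain ⟨hjp, hjv⟩ := Nat.find_spec hexj
        have hiff : ∀ d : Fin p, (d : ℕ) < j ↔ v < (σ d : ℕ) := by
          intro d
          constructor
          · intro h
            have := Nat.find_min hexj h
            push Not at this
            exact this d.2
          · intro h
            by_contra hle
            obtain ⟨t, ht⟩ := Nat.exists_eq_add_of_le (not_lt.1 hle)
            have := hdown t j (ht ▸ d.2) hjv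
            have hd : (⟨j + t, ht ▸ d.2⟩ : Fin p) = d := Fin.ext ht.symm
            rw [hd] at this
            omega
        have hj0 : 0 < j := by
          have h1 : ((σ.symm ⟨v + 1, hv⟩ : Fin p) : ℕ) < j := (hiff _).2 (by simp)
          omega
        have h1 := hsum σ hσ j hj0 hjp
        simp only [hiff] at h1
        rw [Equiv.sum_comp σ fun w : Fin p =>
          if v < (w : ℕ) then -(((p : ℝ) - 1) / 2) + (w : ℕ) else 0] at h1
        exact absurd (sum_strip_upper_nonneg p v) (not_le.2 h1)
  intro σ hσ
  have hmono : StrictMono σ.symm := by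
    have hstep : ∀ (v : ℕ) (hv : v + 1 < p), σ.symm ⟨v, by omega⟩ < σ.symm ⟨v + 1, hv⟩ := by
      intro v hv
      refine lt_of_le_of_ne (not_lt.1 (main v hv _ σ hσ rfl)) fun h => ?_
      have := Fin.mk.inj (σ.symm.injective h)
      omega
    have hgen : ∀ (t v : ℕ) (hv : v + (t + 1) < p),
        σ.symm ⟨v, by omega⟩ < σ.symm ⟨v + (t + 1), hv⟩ := by
      intro t
      induction t with
      | zero => intro v hv; exact hstep v hv
      | succ t iht => intro v hv; exact (iht v (by omega)).trans (hstep (v + (t + 1)) hv)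
    intro a b hab
    obtain ⟨t, ht⟩ := Nat.exists_eq_add_of_lt (Fin.lt_def.1 hab)
    have := hgen t a (by have := b.2; omega)
    convert! this using 2
    exact Fin.ext (by dsimp; omega)
  have hmono' : StrictMono σ := by
    intro a b hab
    by_contra hle
    have := hmono.monotone (not_lt.1 hle)
    rw [Equiv.symm_apply_apply, Equiv.symm_apply_apply] at this
    exact absurd hab (not_lt.2 this)
  ext1 a
  refine le_antisymm ?_ (hmono'.le_apply)
  have := hmono.le_apply (x := σ a)
  rwa [Equiv.symm_apply_apply] at this

end Permutations

/-! ### The action of the type `A` blocks in a discrete series representation -/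

section BlockAction

variable {k l : ℕ} {κ : Composition k} {D : Datum (k + l)}

lemma coPair_center {α : E (k + l)} (hα : α ∈ rootsL (levi κ l)) (i : Fin κ.length) :
    coPair (center κ l i) α = 0 := by
  rw [coPair, real_inner_comm, inner_center, ((mem_rootsL_iff κ l).1 hα).2 i]
  simp

lemma WL_center {w : E (k + l) ≃ₗᵢ[ℝ] E (k + l)} (hw : w ∈ WL (levi κ l)) (i : Fin κ.length) :
    w (center κ l i) = center κ l i := by
  have key : ∀ α ∈ rootsL (levi κ l), refl α (center κ l i) = center κ l i := by
    intro α hα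
    rw [refl_apply, coPair_center hα, zero_smul, sub_zero]
  induction hw using Subgroup.closure_induction'' with
  | mem g hg =>
    obtain ⟨α, hα, rfl⟩ := hg
    exact key α hα
  | inv_mem g hg =>
    obtain ⟨α, hα, rfl⟩ := hg
    rw [refl_inv]
    exact key α hα
  | one => rfl
  | mul g h _ _ ig ih => exact (congrArg g ih).trans ig

/-- `W_L` permutes the coordinates of each block: it fixes the center of the block, and a vector
`± e_j` has the same pairing with the center as `e_a` only if it is `e_j` for `j` in the block. -/
lemma WL_perm {w : E (k + l) ≃ₗᵢ[ℝ] E (k + l)} (hw : w ∈ WL (levi κ l)) (i : Fin κ.length) :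
    ∃ σ : Equiv.Perm (Fin (κ.blocksFun i)), ∀ d, w (e (pos κ l i d)) = e (pos κ l i (σ d)) := by
  have hinv : ∀ x, blockSum κ l i (w x) = blockSum κ l i x := by
    intro x
    have h := w.inner_map_map x (center κ l i)
    rw [WL_center hw, inner_center, inner_center] at h
    have h1 : (κ.blocksFun i : ℝ)⁻¹ ≠ 0 := by
      exact_mod_cast inv_ne_zero (Nat.cast_ne_zero.2 (blocksFun_pos κ i).ne')
    exact mul_left_cancel₀ h1 h
  have hex : ∀ d, ∃ d', w (e (pos κ l i d)) = e (pos κ l i d') := by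
    intro d
    obtain ⟨j, hj⟩ := isSigned_of_mem_W0 (WL_le_W0 hw) (pos κ l i d)
    have h1 := hinv (e (pos κ l i d))
    rw [blockSum_e_pos, if_pos rfl] at h1
    have h2 := blockSum_e_nonneg κ l i j
    rcases hj with hj | hj
    · rw [hj] at h1
      obtain ⟨d', rfl⟩ := exists_pos_of_blockSum_pos κ l (h1 ▸ one_pos)
      exact ⟨d', hj⟩
    · rw [hj, map_neg] at h1
      linarith
  choose f hf using hex
  have hinj : Function.Injective f := by
    intro a b hab
    have : w (e (pos κ l i a)) = w (e (pos κ l i b)) := by rw [hf, hf, hab]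
    exact (pos_inj κ l).1 (e_injective (w.injective this))
  exact ⟨Equiv.ofBijective f (Finite.injective_iff_bijective.1 hinj), hf⟩

variable (D) in
/-- The image of `e_a` in `X_L`, for `a` at position `d` of the `i`-th block. -/
def eBar (l : ℕ) {κ : Composition k} (D : Datum (k + l)) (i : Fin κ.length)
    (d : Fin (κ.blocksFun i)) : XL D (levi κ l) :=
  toXL D (levi κ l) ⟨e (pos κ l i d), D.root_mem (e_mem_roots _)⟩

lemma coe_eBar (i : Fin κ.length) (d : Fin (κ.blocksFun i)) :
    (eBar l D i d : E (k + l)) = e (pos κ l i d) - center κ l i := by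
  rw [← res_e_pos κ l i d]
  exact projL_eq κ l _

lemma eBar_perm {w : E (k + l) ≃ₗᵢ[ℝ] E (k + l)} (hw : w ∈ WL (levi κ l)) (i : Fin κ.length) :
    ∃ σ : Equiv.Perm (Fin (κ.blocksFun i)), ∀ d,
      (eBar l D i (σ d) : E (k + l)) = w (eBar l D i d) := by
  obtain ⟨σ, hσ⟩ := WL_perm hw i
  exact ⟨σ, fun d => by rw [coe_eBar, coe_eBar, map_sub, hσ, WL_center hw]⟩

variable (l D) in
/-- The elements of `X_L` supported on the type `A` blocks. -/
def blockLattice (κ : Composition k) : AddSubgroup (XL D (levi κ l)) where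
  carrier := {y | ∀ b : Fin l, (y : E (k + l)) (Fin.natAdd k b) = 0}
  zero_mem' := fun b => rfl
  add_mem' := fun {x y} hx hy b => by
    have h1 := hx b
    have h2 := hy b
    simp [h1, h2]
  neg_mem' := fun {x} hx b => by
    have h1 := hx b
    simp [h1]

lemma eBar_mem_blockLattice (i : Fin κ.length) (d : Fin (κ.blocksFun i)) :
    eBar l D i d ∈ blockLattice l D κ := by
  intro b
  rw [coe_eBar]
  simp [e_apply, center_apply_natAdd, (pos_ne_natAdd κ l i d b).symm]

/-- The block lattice is generated by the vectors `eBar`. This uses that the coordinates of the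
elements of `X` differ by integers, and that the `eBar` of one block add up to zero. -/
lemma blockLattice_le_closure :
    blockLattice l D κ ≤ AddSubgroup.closure (⋃ i, Set.range (eBar (κ := κ) l D i)) := by
  intro y hy
  obtain ⟨x, hx, hxy⟩ := y.2
  rcases isEmpty_or_nonempty (Fin κ.length) with hemp | ⟨⟨i₀⟩⟩
  · have : y = 0 := by
      refine Subtype.ext ?_
      ext j
      rcases pos_or_natAdd κ l j with ⟨i, -, -⟩ | ⟨b, rfl⟩
      · exact hemp.elim i
      · exact hy b
    rw [this]
    exact AddSubgroup.zero_mem _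
  · set a₀ := pos κ l i₀ ⟨0, blocksFun_pos κ i₀⟩ with ha₀
    have hint : ∀ a, ∃ z : ℤ, x a - x a₀ = z := by
      intro a
      by_cases h : a = a₀
      · exact ⟨0, by simp [h]⟩
      · obtain ⟨z, hz⟩ := D.le_weight x hx _ (e_sub_mem_roots h)
        exact ⟨z, by rw [← hz, coPair_e_sub h]⟩
    choose z hz using hint
    have hsum : y = ∑ i, ∑ d, z (pos κ l i d) • eBar l D i d := by
      refine Subtype.ext ?_
      have hcoe : ((∑ i, ∑ d, z (pos κ l i d) • eBar l D i d : XL D (levi κ l)) : E (k + l)) =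
          ∑ i, ∑ d, (x (pos κ l i d) - x a₀) • (e (pos κ l i d) - center κ l i) := by
        simp only [AddSubgroup.val_finsetSum, AddSubgroup.coe_zsmul, coe_eBar, hz,
          Int.cast_smul_eq_zsmul]
      rw [hcoe]
      have hblock : ∀ i, ∑ d, (x (pos κ l i d) - x a₀) • (e (pos κ l i d) - center κ l i) =
          ∑ d, x (pos κ l i d) • (e (pos κ l i d) : E (k + l)) -
            blockSum κ l i x • center κ l i := by
        intro i
        have h0 : ∑ d, (e (pos κ l i d) - center κ l i : E (k + l)) = 0 := by
          have hne : (κ.blocksFun i : ℝ) ≠ 0 := by exact_mod_cast (blocksFun_pos κ i).ne'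
          rw [Finset.sum_sub_distrib, Finset.sum_const, Finset.card_univ, Fintype.card_fin,
            ← Nat.cast_smul_eq_nsmul ℝ, center, smul_smul, mul_inv_cancel₀ hne, one_smul, sub_self]
        simp only [sub_smul, Finset.sum_sub_distrib]
        rw [← Finset.smul_sum, h0, smul_zero, sub_zero]
        simp only [smul_sub, Finset.sum_sub_distrib]
        rw [← Finset.sum_smul, blockSum_apply]
      rw [Finset.sum_congr rfl fun i _ => hblock i, Finset.sum_sub_distrib, ← res_eq]
      have hnat : ∀ b : Fin l, x (Fin.natAdd k b) = 0 := by
        intro b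
        have h1 := hy b
        rw [← hxy, projL_eq, res_eq] at h1
        simpa [center_apply_natAdd] using h1
      have hx' := sum_smul_e x
      rw [sum_coords κ l] at hx'
      simp only [hnat, zero_smul, Finset.sum_const_zero, add_zero] at hx'
      rw [hx', ← projL_eq]
      exact hxy.symm
    rw [hsum]
    refine AddSubgroup.sum_mem _ fun i _ => AddSubgroup.sum_mem _ fun d _ =>
      AddSubgroup.zsmul_mem _ (AddSubgroup.subset_closure ?_) _
    exact Set.mem_iUnion.2 ⟨i, d, rfl⟩

variable {m : ℝ} {μ : YoungDiagram} (num : Fin l ≃ μ.cells)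

variable (κ m) in
/-- The real character `y ↦ Q ^ ⟨y, log r_L⟩` of `X_L`. -/
def powChar (D : Datum (k + l)) {Q : ℝ} (hQ : 0 < Q) : AddChar (XL D (levi κ l)) ℂ where
  toFun y := ((Q ^ (inner ℝ (y : E (k + l)) (logPoint κ m num)) : ℝ) : ℂ)
  map_zero_eq_one' := by simp
  map_add_eq_mul' x y := by
    rw [AddSubgroup.coe_add, inner_add_left, Real.rpow_add hQ]
    push_cast
    rfl

lemma powChar_apply {Q : ℝ} (hQ : 0 < Q) (y : XL D (levi κ l)) :
    powChar κ m num D hQ y =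
      ((Q ^ (inner ℝ (y : E (k + l)) (logPoint κ m num)) : ℝ) : ℂ) := rfl

lemma inner_eBar_logPoint (i : Fin κ.length) (d : Fin (κ.blocksFun i)) :
    inner ℝ (eBar l D i d : E (k + l)) (logPoint κ m num) =
      -(((κ.blocksFun i : ℝ) - 1) / 2) + (d : ℕ) := by
  have : (eBar l D i d : E (k + l)) = projL (levi κ l) (e (pos κ l i d)) := rfl
  rw [this, inner_projL_logPoint, inner_e_left, logPoint_pos]

variable {V : Type*} [AddCommGroup V] [Module ℂ V]
  {δ : Hecke D (levi κ l) →ₐ[ℂ] Module.End ℂ V}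

/-- On each block, a weight is a rearrangement of the entries of a centred strip. Since these are
symmetric about zero, `q₁` may be replaced by its inverse. -/
lemma exists_perm_weight {r t : AddChar (XL D (levi κ l)) ℂ}
    (hr : ∀ x, r x = ((D.q₁ ^ (∑ j, (x : E (k + l)) j * exponent κ l m num j) : ℝ) : ℂ))
    (hcc : HasCentralChar δ r) (hq₁ : D.q₁ ≠ 1) {Q : ℝ} (hQ : Q = D.q₁ ∨ Q = D.q₁⁻¹)
    (ht : IsWeightOf δ t) (i : Fin κ.length) :
    ∃ σ : Equiv.Perm (Fin (κ.blocksFun i)), ∀ d,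
      t (eBar l D i d) = ((Q ^ (-(((κ.blocksFun i : ℝ) - 1) / 2) + (σ d : ℕ)) : ℝ) : ℂ) := by
  have hrd : ∀ d, r (eBar l D i d) =
      ((D.q₁ ^ (-(((κ.blocksFun i : ℝ) - 1) / 2) + (d : ℕ)) : ℝ) : ℂ) := by
    intro d
    rw [hr, ← inner_logPoint, inner_eBar_logPoint]
  have hprod := prod_weight_eq hcc ht (eBar l D i) fun w hw => eBar_perm hw i
  have hex : ∀ d, ∃ d', t (eBar l D i d) = r (eBar l D i d') := by
    intro d
    have h := congrArg (Polynomial.eval (t (eBar l D i d))) hprod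
    rw [Polynomial.eval_prod, Polynomial.eval_prod,
      Finset.prod_eq_zero (Finset.mem_univ d) (by simp), eq_comm, Finset.prod_eq_zero_iff] at h
    obtain ⟨d', -, h⟩ := h
    exact ⟨d', by simpa [sub_eq_zero] using h⟩
  have hex' : ∀ d, ∃ d', r (eBar l D i d) = t (eBar l D i d') := by
    intro d
    have h := congrArg (Polynomial.eval (r (eBar l D i d))) hprod
    rw [Polynomial.eval_prod, Polynomial.eval_prod, eq_comm,
      Finset.prod_eq_zero (Finset.mem_univ d) (by simp), eq_comm, Finset.prod_eq_zero_iff] at h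
    obtain ⟨d', -, h⟩ := h
    exact ⟨d', by simpa [sub_eq_zero] using h⟩
  choose f hf using hex
  have hrinj : ∀ a b, r (eBar l D i a) = r (eBar l D i b) → a = b := by
    intro a b h
    rw [hrd, hrd] at h
    have h1 := (D.rpow_eq_iff hq₁ _ _).1 (Complex.ofReal_injective h)
    have h2 : ((a : ℕ) : ℝ) = (b : ℕ) := by linarith
    exact Fin.ext (by exact_mod_cast h2)
  have hsurj : Function.Surjective f := by
    intro d
    obtain ⟨d', hd'⟩ := hex' d
    exact ⟨d', (hrinj _ _ (hd'.trans (hf d'))).symm⟩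
  set σ := Equiv.ofBijective f (Finite.surjective_iff_bijective.1 hsurj)
  rcases hQ with rfl | rfl
  · exact ⟨σ, fun d => by rw [hf, hrd]; rfl⟩
  · refine ⟨σ.trans Fin.revPerm, fun d => ?_⟩
    rw [hf, hrd]
    have hrev : (((f d).rev : ℕ) : ℝ) = (κ.blocksFun i : ℝ) - 1 - (f d : ℕ) := by
      have : ((f d).rev : ℕ) + f d + 1 = κ.blocksFun i := by rw [Fin.val_rev]; omega
      have : (((f d).rev : ℕ) : ℝ) + (f d : ℕ) + 1 = κ.blocksFun i := by exact_mod_cast this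
      linarith
    have hσ : (σ.trans Fin.revPerm) d = (f d).rev := rfl
    rw [hσ, hrev, Real.inv_rpow D.q₁_pos.le, ← Real.rpow_neg D.q₁_pos.le]
    congr 2
    ring

/-- The discrete series condition for the fundamental weights of a block of type `A`. -/
lemma partial_sum_neg {t : AddChar (XL D (levi κ l)) ℂ} (hds : IsDiscreteSeries δ)
    (ht : IsWeightOf δ t) {Q : ℝ} (hQ : 1 < Q) (i : Fin κ.length)
    (σ : Equiv.Perm (Fin (κ.blocksFun i)))
    (hσ : ∀ d, t (eBar l D i d) =
      ((Q ^ (-(((κ.blocksFun i : ℝ) - 1) / 2) + (σ d : ℕ)) : ℝ) : ℂ))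
    (j : ℕ) (hj0 : 0 < j) (hjp : j < κ.blocksFun i) :
    ∑ d : Fin (κ.blocksFun i),
      (if (d : ℕ) < j then -(((κ.blocksFun i : ℝ) - 1) / 2) + (σ d : ℕ) else 0) < 0 := by
  have hQ0 : 0 < Q := one_pos.trans hQ
  set x : XL D (levi κ l) := ∑ d : Fin (κ.blocksFun i), if (d : ℕ) < j then eBar l D i d else 0 with hx
  have hcoe : (x : E (k + l)) =
      ∑ d : Fin (κ.blocksFun i),
        if (d : ℕ) < j then (e (pos κ l i d) - center κ l i : E (k + l)) else 0 := by
    rw [hx, AddSubgroup.val_finsetSum]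
    refine Finset.sum_congr rfl fun d _ => ?_
    split_ifs
    · exact coe_eBar i d
    · rfl
  have hpos : (0 : ℝ) < (κ.blocksFun i : ℝ)⁻¹ :=
    inv_pos.2 (Nat.cast_pos.2 (blocksFun_pos κ i))
  have hx0 : x ≠ 0 := by
    intro h0
    -- the coordinate of `x` after the first `j` positions is negative
    have h1 : (x : E (k + l)) (pos κ l i ⟨j, hjp⟩) < 0 := by
      rw [hcoe, WithLp.ofLp_sum, Finset.sum_apply]
      refine Finset.sum_neg' (fun d _ => ?_) ⟨⟨0, by omega⟩, Finset.mem_univ _, ?_⟩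
      · split_ifs with hd
        · rw [PiLp.sub_apply, e_apply, center_apply_pos, if_neg, if_pos rfl]
          · simp
          · rw [pos_inj]
            rintro rfl
            exact lt_irrefl _ hd
        · exact le_rfl
      · rw [if_pos (by exact hj0), PiLp.sub_apply, e_apply, center_apply_pos, if_neg, if_pos rfl,
          zero_sub, neg_lt_zero]
        · exact hpos
        · rw [pos_inj]
          intro h
          have := Fin.mk.inj h
          omega
    rw [h0] at h1
    exact lt_irrefl _ h1
  have hdom : ∀ α ∈ rootsL (levi κ l), α ∈ posRoots (k + l) → 0 ≤ coPair (x : E (k + l)) α := by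
    intro α hα hpos
    have h1 : inner ℝ (x : E (k + l)) α =
        ∑ d : Fin (κ.blocksFun i), if (d : ℕ) < j then α (pos κ l i d) else 0 := by
      rw [hcoe, sum_inner]
      refine Finset.sum_congr rfl fun d _ => ?_
      split_ifs
      · rw [inner_sub_left, inner_e_left, real_inner_comm, inner_center,
          ((mem_rootsL_iff κ l).1 hα).2 i, mul_zero, sub_zero]
      · rw [inner_zero_left]
    have h2 : 0 ≤ inner ℝ (x : E (k + l)) α := by
      rw [h1]
      rcases hpos with ⟨a, b, hab, rfl | rfl⟩ | ⟨a, rfl⟩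
      · refine Finset.sum_nonneg fun d _ => ?_
        split_ifs
        · rw [PiLp.add_apply, e_apply, e_apply]
          split_ifs <;> norm_num
        · exact le_rfl
      · by_cases hb : ∃ d : Fin (κ.blocksFun i), (d : ℕ) < j ∧ b = pos κ l i d
        · -- then `a` is an earlier coordinate of the same block, and the terms cancel
          obtain ⟨d, hd, rfl⟩ := hb
          have h3 := ((mem_rootsL_iff κ l).1 hα).2 i
          rw [map_sub, blockSum_e_pos, if_pos rfl, sub_eq_zero] at h3
          obtain ⟨d', rfl⟩ := exists_pos_of_blockSum_pos κ l (h3 ▸ one_pos)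
          have hd' : (d' : ℕ) < j := by
            have : (pos κ l i d' : ℕ) < pos κ l i d := hab
            rw [val_pos, val_pos] at this
            omega
          have : ∀ c : Fin (κ.blocksFun i), (if (c : ℕ) < j then
              (e (pos κ l i d') - e (pos κ l i d) : E (k + l)) (pos κ l i c) else 0) =
              (if c = d' then 1 else 0) - (if c = d then 1 else 0) := by
            intro c
            rw [PiLp.sub_apply, e_apply, e_apply]
            simp only [pos_inj]
            by_cases hc : (c : ℕ) < j
            · rw [if_pos hc]
            · have h4 : c ≠ d' := by rintro rfl; exact hc hd'
              have h5 : c ≠ d := by rintro rfl; exact hc hd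
              simp [hc, h4, h5]
          rw [Finset.sum_congr rfl fun c _ => this c, Finset.sum_sub_distrib]
          simp
        · push Not at hb
          refine Finset.sum_nonneg fun d _ => ?_
          split_ifs with hd
          · rw [PiLp.sub_apply, e_apply, e_apply, if_neg (hb d hd).symm]
            split_ifs <;> norm_num
          · exact le_rfl
      · refine Finset.sum_nonneg fun d _ => ?_
        split_ifs
        · rw [e_apply]
          split_ifs <;> norm_num
        · exact le_rfl
    rw [coPair]
    exact div_nonneg (mul_nonneg two_pos.le h2) real_inner_self_nonneg
  have hlt := hds t ht x hx0 hdom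
  have htx : t x = ((Q ^ (∑ d : Fin (κ.blocksFun i),
      (if (d : ℕ) < j then -(((κ.blocksFun i : ℝ) - 1) / 2) + (σ d : ℕ) else 0)) : ℝ) : ℂ) := by
    have hsum : ∀ s : Finset (Fin (κ.blocksFun i)),
        t (∑ d ∈ s, if (d : ℕ) < j then eBar l D i d else 0) = ((Q ^ (∑ d ∈ s,
          (if (d : ℕ) < j then -(((κ.blocksFun i : ℝ) - 1) / 2) + (σ d : ℕ) else 0)) : ℝ) : ℂ) := by
      intro s
      induction s using Finset.induction_on with
      | empty => simp
      | insert a s ha ih =>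
        rw [Finset.sum_insert ha, Finset.sum_insert ha, AddChar.map_add_eq_mul, ih,
          Real.rpow_add hQ0, Complex.ofReal_mul]
        congr 1
        split_ifs
        · exact hσ a
        · simp
    exact hsum Finset.univ
  rw [htx, Complex.norm_real, Real.norm_of_nonneg (Real.rpow_nonneg hQ0.le _)] at hlt
  by_contra hge
  exact absurd hlt (not_lt.2 (Real.one_le_rpow hQ.le (not_lt.1 hge)))

end BlockAction

section Scalars

variable {k l : ℕ} {κ : Composition k} {D : Datum (k + l)} {m : ℝ} {μ : YoungDiagram}
  (num : Fin l ≃ μ.cells) {V : Type*} [AddCommGroup V] [Module ℂ V]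
  {δ : Hecke D (levi κ l) →ₐ[ℂ] Module.End ℂ V}

lemma pos_simpleRoot_long (i : Fin κ.length) (a : ℕ) (h : a + 1 < κ.blocksFun i) :
    simpleRoot (pos κ l i ⟨a, by omega⟩) ∈ longRoots (k + l) := by
  rw [simpleRoot_pos κ l i a h]
  refine ⟨_, _, fun h' => ?_, Or.inr (Or.inl rfl)⟩
  have := Fin.mk.inj ((pos_inj κ l).1 h')
  omega

lemma simpleXL_pos (i : Fin κ.length) (a : ℕ) (h : a + 1 < κ.blocksFun i) :
    simpleXL D (levi κ l) ⟨pos κ l i ⟨a, by omega⟩, pos_mem_levi κ l i a h⟩ =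
      eBar l D i ⟨a, by omega⟩ - eBar l D i ⟨a + 1, h⟩ := by
  refine Subtype.ext ?_
  rw [AddSubgroup.coe_sub, coe_eBar, coe_eBar, sub_sub_sub_cancel_right]
  exact simpleRoot_pos κ l i a h

lemma actXL_refl_eBar (i : Fin κ.length) (a : ℕ) (h : a + 1 < κ.blocksFun i)
    (d : Fin (κ.blocksFun i)) :
    actXL _ (refl_simpleRoot_mem_WL ⟨pos κ l i ⟨a, by omega⟩, pos_mem_levi κ l i a h⟩)
      (eBar l D i d) = eBar l D i (Equiv.swap ⟨a, by omega⟩ ⟨a + 1, h⟩ d) := by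
  refine Subtype.ext ?_
  have hw := refl_simpleRoot_mem_WL (⟨_, pos_mem_levi κ l i a h⟩ : levi κ l)
  change refl (simpleRoot (pos κ l i ⟨a, by omega⟩)) (eBar l D i d : E (k + l)) = _
  rw [coe_eBar, coe_eBar, map_sub, WL_center hw, simpleRoot_pos κ l i a h]
  congr 1
  set x : Fin (κ.blocksFun i) := ⟨a, by omega⟩
  set y : Fin (κ.blocksFun i) := ⟨a + 1, h⟩
  have hxy : x ≠ y := fun h' => by
    have := Fin.mk.inj h'
    omega
  have hne : pos κ l i x ≠ pos κ l i y := fun h' => hxy ((pos_inj κ l).1 h')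
  rw [refl_sub_e hne]
  by_cases hdx : d = x
  · subst hdx
    rw [Equiv.swap_apply_left]
    simp [e_apply, hne.symm]
  · by_cases hdy : d = y
    · subst hdy
      rw [Equiv.swap_apply_right]
      simp [e_apply, hne]
    · rw [Equiv.swap_apply_of_ne_of_ne hdx hdy]
      have h1 : pos κ l i x ≠ pos κ l i d := fun h' => hdx ((pos_inj κ l).1 h').symm
      have h2 : pos κ l i y ≠ pos κ l i d := fun h' => hdy ((pos_inj κ l).1 h').symm
      simp [e_apply, h1, h2]

/-- A discrete series representation has only one weight on the blocks of type `A`. -/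
lemma weight_eBar {r t : AddChar (XL D (levi κ l)) ℂ}
    (hr : ∀ x, r x = ((D.q₁ ^ (∑ j, (x : E (k + l)) j * exponent κ l m num j) : ℝ) : ℂ))
    (hcc : HasCentralChar δ r) (hds : IsDiscreteSeries δ) (hq₁ : D.q₁ ≠ 1) {Q : ℝ}
    (hQ : Q = D.q₁ ∨ Q = D.q₁⁻¹) (hQ1 : 1 < Q) (ht : IsWeightOf δ t) (i : Fin κ.length)
    (d : Fin (κ.blocksFun i)) :
    t (eBar l D i d) = ((Q ^ (-(((κ.blocksFun i : ℝ) - 1) / 2) + (d : ℕ)) : ℝ) : ℂ) := by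
  have hQ0 : 0 < Q := one_pos.trans hQ1
  obtain ⟨σ, hσ⟩ := exists_perm_weight num hr hcc hq₁ hQ ht i
  suffices h : σ = 1 by
    rw [hσ, h]
    rfl
  refine perm_eq_one_of_partial_sums {σ : Equiv.Perm (Fin (κ.blocksFun i)) |
    ∃ t : AddChar (XL D (levi κ l)) ℂ, IsWeightOf δ t ∧ ∀ d, t (eBar l D i d) =
      ((Q ^ (-(((κ.blocksFun i : ℝ) - 1) / 2) + (σ d : ℕ)) : ℝ) : ℂ)} ?_ ?_ σ ⟨t, ht, hσ⟩
  · rintro σ ⟨t, ⟨v, hv0, hv⟩, hσ⟩ a ha hgap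
    set j : levi κ l := ⟨pos κ l i ⟨a, by omega⟩, pos_mem_levi κ l i a ha⟩ with hj
    have hα : simpleXL D (levi κ l) j = eBar l D i ⟨a, by omega⟩ - eBar l D i ⟨a + 1, ha⟩ :=
      simpleXL_pos i a ha
    have hz : t (-simpleXL D (levi κ l) j) =
        ((Q ^ (((σ ⟨a + 1, ha⟩ : ℕ) : ℝ) - (σ ⟨a, by omega⟩ : ℕ)) : ℝ) : ℂ) := by
      rw [hα, neg_sub, AddChar.map_sub_eq_div, hσ, hσ, ← Complex.ofReal_div,
        ← Real.rpow_sub hQ0]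
      congr 2
      ring
    have hzval : ∀ s : ℝ, t (-simpleXL D (levi κ l) j) = ((Q ^ s : ℝ) : ℂ) →
        ((σ ⟨a + 1, ha⟩ : ℕ) : ℝ) - (σ ⟨a, by omega⟩ : ℕ) = s := by
      intro s hs
      rw [hz] at hs
      have h1 := congrArg (Real.logb Q) (Complex.ofReal_injective hs)
      rwa [Real.logb_rpow hQ0 hQ1.ne', Real.logb_rpow hQ0 hQ1.ne'] at h1
    have hgap' : ((σ ⟨a, by omega⟩ : ℕ) : ℝ) + 2 ≤ (σ ⟨a + 1, ha⟩ : ℕ) ∨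
        ((σ ⟨a + 1, ha⟩ : ℕ) : ℝ) + 2 ≤ (σ ⟨a, by omega⟩ : ℕ) := by exact_mod_cast hgap
    have hz1 : t (-simpleXL D (levi κ l) j) ≠ 1 := by
      intro h
      have := hzval 0 (by rw [h, Real.rpow_zero, Complex.ofReal_one])
      rcases hgap' with h' | h' <;> linarith
    have hlong : simpleRoot (j : Fin (k + l)) ∈ longRoots (k + l) := pos_simpleRoot_long i a ha
    have hint := theta_intertwiner j hlong ⊤ trivial t v (fun y _ => hv y) hz1
    refine ⟨t.compAddMonoidHom (actXL _ (refl_simpleRoot_mem_WL j)).toAddMonoidHom,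
      ⟨_, ?_, fun y => hint y trivial⟩, fun d => ?_⟩
    · -- the intertwiner can only vanish if the two entries are neighbours
      intro h0
      have hc := eigenvalue_T j hlong hv0 (sub_eq_zero.1 h0)
      have hne : 1 - t (-simpleXL D (levi κ l) j) ≠ 0 := sub_ne_zero.2 (Ne.symm hz1)
      have hq0 : (D.q₁ : ℂ) ≠ 0 := by exact_mod_cast D.q₁_pos.ne'
      have hzq : t (-simpleXL D (levi κ l) j) = D.q₁ ∨
          t (-simpleXL D (levi κ l) j) = (D.q₁ : ℂ)⁻¹ := by
        rcases hc with hc | hc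
        · left
          rw [div_eq_iff hne] at hc
          linear_combination (-1 : ℂ) * hc
        · right
          rw [div_eq_iff hne] at hc
          field_simp
          linear_combination hc
      have hzQ : t (-simpleXL D (levi κ l) j) = ((Q ^ (1 : ℝ) : ℝ) : ℂ) ∨
          t (-simpleXL D (levi κ l) j) = ((Q ^ (-1 : ℝ) : ℝ) : ℂ) := by
        rw [Real.rpow_neg hQ0.le, Real.rpow_one]
        rcases hQ with rfl | rfl
        · push_cast
          exact hzq
        · rw [inv_inv]
          push_cast
          exact hzq.symm
      rcases hzQ with h | h <;> have := hzval _ h <;> rcases hgap' with h' | h' <;> linarith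
    · rw [AddChar.coe_compAddMonoidHom]
      exact (congrArg t (actXL_refl_eBar i a ha d)).trans (hσ _)
  · rintro σ ⟨t, ht, hσ⟩ j hj0 hjp
    exact partial_sum_neg hds ht hQ1 i σ hσ j hj0 hjp

lemma stable_of_generators (U : Submodule ℂ V) (hT : ∀ j, ∀ u ∈ U, δ (T D (levi κ l) j) u ∈ U)
    (hθ : ∀ y, ∀ u ∈ U, δ (θ D (levi κ l) y) u ∈ U) (h : Hecke D (levi κ l)) :
    ∀ u ∈ U, δ h u ∈ U := by
  obtain ⟨a, rfl⟩ := RingQuot.mkAlgHom_surjective ℂ (Rel D (levi κ l)) h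
  induction a using FreeAlgebra.induction with
  | grade0 c =>
    intro u hu
    rw [AlgHom.commutes, AlgHom.commutes, Module.algebraMap_end_apply]
    exact U.smul_mem c hu
  | grade1 x =>
    cases x with
    | T j => exact hT j
    | θ y => exact hθ y
  | mul a b iha ihb =>
    intro u hu
    rw [map_mul, map_mul]
    exact iha _ (ihb u hu)
  | add a b iha ihb =>
    intro u hu
    rw [map_add, map_add]
    exact U.add_mem (iha u hu) (ihb u hu)

lemma coPair_blockLattice {y : XL D (levi κ l)} (hy : y ∈ blockLattice l D κ) {j : Fin (k + l)}
    (hj : j ∈ levi κ l) (hjk : k ≤ (j : ℕ)) : coPair (y : E (k + l)) (simpleRoot j) = 0 := by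
  rcases simpleRoot_cases κ l hj with ⟨i, a, h, rfl, -⟩ | ⟨b, h, -, h'⟩ | ⟨b, -, -, h'⟩
  · exact absurd (pos_lt κ l i _) (not_lt.2 hjk)
  · rw [h', coPair_e_sub, hy, hy, sub_self]
    intro h''
    have := congrArg Fin.val h''
    simp at this
  · rw [h', coPair_e, hy, mul_zero]

/-- In an irreducible discrete series representation the simple reflections of the blocks of type
`A` act by one scalar, and the `θ_y` with `y` supported on these blocks act by a character. -/
theorem block_action {r : AddChar (XL D (levi κ l)) ℂ}
    (hr : ∀ x, r x = ((D.q₁ ^ (∑ j, (x : E (k + l)) j * exponent κ l m num j) : ℝ) : ℂ))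
    (hirr : IsIrreducible δ) (hcc : HasCentralChar δ r) (hds : IsDiscreteSeries δ)
    (hq₁ : D.q₁ ≠ 1) :
    (∃ c : ℂ, ∀ j : levi κ l, ((j : Fin (k + l)) : ℕ) < k → ∀ v, δ (T D (levi κ l) j) v = c • v) ∧
    ∃ Q : ℝ, ∃ hQ : 0 < Q, ∀ y ∈ blockLattice l D κ, ∀ v,
      δ (θ D (levi κ l) y) v = powChar κ m num D hQ y • v := by
  obtain ⟨Q, hQ, hQ1⟩ : ∃ Q : ℝ, (Q = D.q₁ ∨ Q = D.q₁⁻¹) ∧ 1 < Q := by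
    rcases lt_or_gt_of_ne hq₁ with h | h
    · exact ⟨_, Or.inr rfl, (one_lt_inv₀ D.q₁_pos).2 h⟩
    · exact ⟨_, Or.inl rfl, h⟩
  have hQ0 : 0 < Q := one_pos.trans hQ1
  set χ := powChar κ m num D hQ0 with hχ
  set P := blockLattice l D κ with hP
  have hweight : ∀ t, IsWeightOf δ t → ∀ y ∈ P, t y = χ y := by
    intro t ht y hy
    have hy' := blockLattice_le_closure hy
    induction hy' using AddSubgroup.closure_induction with
    | mem x hx =>
      obtain ⟨i, d, rfl⟩ := Set.mem_iUnion.1 hx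
      rw [weight_eBar num hr hcc hds hq₁ hQ hQ1 ht, hχ, powChar_apply, inner_eBar_logPoint]
    | zero => rw [AddChar.map_zero_eq_one, AddChar.map_zero_eq_one]
    | add x y hx' hy' ihx ihy =>
      have hle : ∀ z ∈ AddSubgroup.closure (⋃ i, Set.range (eBar (κ := κ) l D i)), z ∈ P := by
        intro z hz
        refine (AddSubgroup.closure_le P).2 ?_ hz
        intro z hz
        obtain ⟨i, d, rfl⟩ := Set.mem_iUnion.1 hz
        exact eBar_mem_blockLattice i d
      rw [AddChar.map_add_eq_mul, AddChar.map_add_eq_mul, ihx (hle x hx'), ihy (hle y hy')]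
    | neg x _ ih =>
      have h1 := ih (P.neg_mem_iff.1 ‹_›)
      rw [AddChar.map_neg_eq_inv, AddChar.map_neg_eq_inv, h1]
  have hcomm : ∀ x y v, δ (θ D (levi κ l) x) (δ (θ D (levi κ l) y) v) =
      δ (θ D (levi κ l) y) (δ (θ D (levi κ l) x) v) := by
    intro x y v
    rw [theta_mul_apply, theta_mul_apply, add_comm x y]
  -- the joint eigenspace of the block lattice for a function `ψ`
  let eig : (XL D (levi κ l) → ℂ) → Submodule ℂ V := fun ψ =>
    { carrier := {v | ∀ y ∈ P, δ (θ D (levi κ l) y) v = ψ y • v}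
      zero_mem' := fun y _ => by rw [map_zero, smul_zero]
      add_mem' := fun {u v} hu hv y hy => by rw [map_add, hu y hy, hv y hy, smul_add]
      smul_mem' := fun a {v} hv y hy => by rw [map_smul, hv y hy, smul_comm] }
  have heig : ∀ ψ x, ∀ u ∈ eig ψ, δ (θ D (levi κ l) x) u ∈ eig ψ := by
    intro ψ x u hu y hy
    rw [hcomm, hu y hy, map_smul]
  set z : ℂ := ((Q : ℝ) : ℂ) with hz
  set c : ℂ := ((D.q₁ : ℂ) - 1) / (1 - z) with hc
  have hscalar : ∀ j : levi κ l, ((j : Fin (k + l)) : ℕ) < k → ∀ v ∈ eig χ,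
      δ (T D (levi κ l) j) v = c • v := by
    rintro ⟨j, hj⟩ hjk v hv
    rcases simpleRoot_cases κ l hj with ⟨i, a, ha, rfl, -⟩ | ⟨b, h, rfl, -⟩ | ⟨b, -, rfl, -⟩
    rotate_left
    · simp at hjk
    · simp at hjk
    set j : levi κ l := ⟨_, hj⟩ with hjdef
    have hα : simpleXL D (levi κ l) j = eBar l D i ⟨a, by omega⟩ - eBar l D i ⟨a + 1, ha⟩ :=
      simpleXL_pos i a ha
    have hαP : simpleXL D (levi κ l) j ∈ P := by
      rw [hα]
      exact P.sub_mem (eBar_mem_blockLattice _ _) (eBar_mem_blockLattice _ _)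
    have hχα : χ (simpleXL D (levi κ l) j) = z⁻¹ := by
      rw [hα, AddChar.map_sub_eq_div, hχ, powChar_apply, powChar_apply, inner_eBar_logPoint,
        inner_eBar_logPoint, ← Complex.ofReal_div, ← Real.rpow_sub hQ0, hz, ← Complex.ofReal_inv,
        ← Real.rpow_neg_one]
      congr 2
      push_cast
      ring
    have hχα' : χ (-simpleXL D (levi κ l) j) = z := by
      rw [AddChar.map_neg_eq_inv, hχα, inv_inv]
    have hz1 : χ (-simpleXL D (levi κ l) j) ≠ 1 := by
      rw [hχα', hz]
      exact_mod_cast hQ1.ne'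
    have hint := theta_intertwiner j (pos_simpleRoot_long i a ha) P hαP χ v hv hz1
    rw [hχα'] at hint
    by_contra hne
    have hu0 : δ (T D (levi κ l) j) v - c • v ≠ 0 := sub_ne_zero.2 hne
    -- otherwise there would be a weight given by the reflected character on the block lattice
    obtain ⟨t, u, hu, hu0', htu⟩ := exists_weight_mem hcc
      (eig fun y => χ (actXL _ (refl_simpleRoot_mem_WL j) y))
      (Submodule.ne_bot_iff _ |>.2 ⟨_, hint, hu0⟩) (heig _)
    have h1 := hweight t ⟨u, hu0', htu⟩ _ hαP
    have h2 := hu _ hαP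
    rw [htu] at h2
    have h3 := smul_left_injective ℂ hu0' h2
    have h4 : actXL _ (refl_simpleRoot_mem_WL j) (simpleXL D (levi κ l) j) =
        -simpleXL D (levi κ l) j := by
      rw [actXL_refl_simpleRoot j _ 2]
      · rw [two_zsmul]
        abel
      · have hne : simpleRoot (j : Fin (k + l)) ≠ 0 := by
          intro h0
          have := norm_sq_longRoot (pos_simpleRoot_long (l := l) i a ha)
          change inner ℝ (simpleRoot (j : Fin (k + l))) (simpleRoot (j : Fin (k + l))) = _ at this
          rw [h0, inner_zero_left] at this
          norm_num at this
        have hne' : inner ℝ (simpleRoot (j : Fin (k + l))) (simpleRoot (j : Fin (k + l))) ≠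
            (0 : ℝ) := inner_self_ne_zero.2 hne
        change coPair (simpleRoot (j : Fin (k + l))) (simpleRoot (j : Fin (k + l))) = _
        rw [coPair, mul_div_assoc, div_self hne']
        norm_num
    dsimp only at h3
    rw [h1, h4, hχα, hχα', hz, ← Complex.ofReal_inv] at h3
    have h5 : Q⁻¹ = Q := Complex.ofReal_injective h3
    have h6 : Q⁻¹ < 1 := inv_lt_one_of_one_lt₀ hQ1
    linarith
  have htop : eig χ = ⊤ := by
    refine (hirr.2 (eig χ) (stable_of_generators _ ?_ (heig χ))).resolve_left ?_
    · intro j u hu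
      by_cases hjk : ((j : Fin (k + l)) : ℕ) < k
      · rw [hscalar j hjk u hu]
        exact (eig χ).smul_mem _ hu
      · intro y hy
        have h := T_cross j y 0 (by
          rw [coPair_blockLattice hy j.2 (not_lt.1 hjk), Nat.cast_zero])
        rw [zero_smul, sub_zero, Finset.range_zero, Finset.sum_empty, sub_eq_zero] at h
        rw [← Module.End.mul_apply, ← map_mul, h, map_mul, Module.End.mul_apply, hu y hy, map_smul]
    · have := hirr.1
      obtain ⟨t, v, -, hv0, hv⟩ := exists_weight_mem hcc ⊤ top_ne_bot fun _ _ _ => trivial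
      refine (Submodule.ne_bot_iff _).2 ⟨v, fun y hy => ?_, hv0⟩
      rw [hv, hweight t ⟨v, hv0, hv⟩ y hy]
  have hall : ∀ v, v ∈ eig χ := fun v => htop ▸ Submodule.mem_top
  exact ⟨⟨c, fun j hj v => hscalar j hj v (hall v)⟩, Q, hQ0, fun y hy v => hall v y hy⟩

end Scalars

/-! ### Flips of blocks -/

section Flips

variable {k : ℕ} {κ : Composition k} (l : ℕ)

/-- The span of the vectors `e_d + e_{p+1-d}` of the blocks in `A`, where `p` is the length of the
block. -/
def flipSpan (A : Set (Fin κ.length)) : Submodule ℝ (E (k + l)) :=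
  Submodule.span ℝ {x | ∃ i ∈ A, ∃ d, x = e (pos κ l i d) + e (pos κ l i d.rev)}

/-- The isometry `e_d ↦ -e_{p+1-d}` on the blocks in `A`, the identity on the other coordinates.
It is the orthogonal reflection that is `-1` on `flipSpan l A`. -/
def flip (A : Set (Fin κ.length)) : E (k + l) ≃ₗᵢ[ℝ] E (k + l) := (flipSpan l A)ᗮ.reflection

variable {l}

lemma flip_flip (A : Set (Fin κ.length)) (x : E (k + l)) : flip l A (flip l A x) = x :=
  Submodule.reflection_reflection _ x

lemma inner_flip (A : Set (Fin κ.length)) (x y : E (k + l)) :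
    inner ℝ (flip l A x) y = inner ℝ x (flip l A y) := by
  rw [← (flip l A).inner_map_map, flip_flip]

lemma flip_eq_self {A : Set (Fin κ.length)} {x : E (k + l)}
    (h : ∀ i ∈ A, ∀ d, x (pos κ l i d) + x (pos κ l i d.rev) = 0) : flip l A x = x := by
  refine Submodule.reflection_mem_subspace_eq_self ?_
  rw [Submodule.mem_orthogonal]
  intro u hu
  induction hu using Submodule.span_induction with
  | mem u hu =>
    obtain ⟨i, hi, d, rfl⟩ := hu
    rw [inner_add_left, inner_e_left, inner_e_left, h i hi d]
  | zero => exact inner_zero_left _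
  | add u v _ _ hu hv => rw [inner_add_left, hu, hv, add_zero]
  | smul a u _ hu => rw [inner_smul_left, hu, mul_zero]

lemma flip_pos_of_mem {A : Set (Fin κ.length)} {i : Fin κ.length} (hi : i ∈ A)
    (d : Fin (κ.blocksFun i)) : flip l A (e (pos κ l i d)) = -e (pos κ l i d.rev) := by
  have h1 : flip l A (e (pos κ l i d) + e (pos κ l i d.rev)) =
      -(e (pos κ l i d) + e (pos κ l i d.rev)) := by
    refine Submodule.reflection_mem_subspace_orthogonalComplement_eq_neg ?_
    exact Submodule.le_orthogonal_orthogonal _ (Submodule.subset_span ⟨i, hi, d, rfl⟩)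
  have h2 : flip l A (e (pos κ l i d) - e (pos κ l i d.rev)) =
      e (pos κ l i d) - e (pos κ l i d.rev) := by
    refine flip_eq_self fun i' _ d' => ?_
    by_cases hii : i' = i
    · subst hii
      have h3 : d'.rev = d ↔ d' = d.rev := ⟨fun h => by rw [← h, Fin.rev_rev], fun h => by
        rw [h, Fin.rev_rev]⟩
      simp only [PiLp.sub_apply, e_apply, pos_inj, h3, Fin.rev_inj]
      ring
    · have h3 : ∀ d d', pos κ l i' d' ≠ pos κ l i d := fun d d' h => hii (pos_block_eq κ l h)
      simp [e_apply, h3]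
  have h3 : (2 : ℝ) • (e (pos κ l i d) : E (k + l)) = (e (pos κ l i d) + e (pos κ l i d.rev)) +
      (e (pos κ l i d) - e (pos κ l i d.rev)) := by
    rw [two_smul]
    abel
  have h4 : (2 : ℝ) • flip l A (e (pos κ l i d)) = (2 : ℝ) • -e (pos κ l i d.rev) := by
    rw [← map_smul, h3, map_add, h1, h2, two_smul]
    abel
  exact smul_right_injective _ (two_ne_zero (α := ℝ)) h4

lemma flip_pos_of_notMem {A : Set (Fin κ.length)} {i : Fin κ.length} (hi : i ∉ A)
    (d : Fin (κ.blocksFun i)) : flip l A (e (pos κ l i d)) = e (pos κ l i d) := by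
  refine flip_eq_self fun i' hi' d' => ?_
  have h : ∀ d', pos κ l i' d' ≠ pos κ l i d := fun d' h => hi (pos_block_eq κ l h ▸ hi')
  simp [e_apply, h]

lemma flip_natAdd (A : Set (Fin κ.length)) (b : Fin l) :
    flip l A (e (Fin.natAdd k b)) = e (Fin.natAdd k b) := by
  refine flip_eq_self fun i' hi' d' => ?_
  simp [e_apply, pos_ne_natAdd]

lemma eq_flip {A : Set (Fin κ.length)} {w : E (k + l) ≃ₗᵢ[ℝ] E (k + l)}
    (h1 : ∀ i ∈ A, ∀ d, w (e (pos κ l i d)) = -e (pos κ l i d.rev))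
    (h2 : ∀ i ∉ A, ∀ d, w (e (pos κ l i d)) = e (pos κ l i d))
    (h3 : ∀ b, w (e (Fin.natAdd k b)) = e (Fin.natAdd k b)) : w = flip l A := by
  refine isometry_ext fun j => ?_
  rcases pos_or_natAdd κ l j with ⟨i, d, rfl⟩ | ⟨b, rfl⟩
  · by_cases hi : i ∈ A
    · rw [h1 i hi, flip_pos_of_mem hi]
    · rw [h2 i hi, flip_pos_of_notMem hi]
  · rw [h3, flip_natAdd]

lemma flip_mul (A B : Set (Fin κ.length)) : flip l A * flip l B = flip l (symmDiff A B) := by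
  have hmul : ∀ x, (flip l A * flip l B) x = flip l A (flip l B x) := fun _ => rfl
  refine eq_flip (fun i hi d => ?_) (fun i hi d => ?_) fun b => ?_
  · rw [hmul]
    rcases hi with ⟨hA, hB⟩ | ⟨hB, hA⟩
    · rw [flip_pos_of_notMem hB, flip_pos_of_mem hA]
    · rw [flip_pos_of_mem hB, map_neg, flip_pos_of_notMem hA]
  · rw [hmul]
    by_cases hA : i ∈ A
    · have hB : i ∈ B := by
        by_contra hB
        exact hi (Or.inl ⟨hA, hB⟩)
      rw [flip_pos_of_mem hB, map_neg, flip_pos_of_mem hA, Fin.rev_rev, neg_neg]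
    · have hB : i ∉ B := fun hB => hi (Or.inr ⟨hB, hA⟩)
      rw [flip_pos_of_notMem hB, flip_pos_of_notMem hA]
  · rw [hmul, flip_natAdd, flip_natAdd]

lemma flip_empty : flip l (∅ : Set (Fin κ.length)) = 1 :=
  (eq_flip (fun _ hi => hi.elim) (fun _ _ _ => rfl) fun _ => rfl).symm

lemma flip_injective : Function.Injective (flip l : Set (Fin κ.length) → _) := by
  have key : ∀ A B : Set (Fin κ.length), flip l A = flip l B → A ⊆ B := by
    intro A B h i hi
    by_contra hB
    have h1 := flip_pos_of_mem (l := l) hi ⟨0, blocksFun_pos κ i⟩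
    rw [h, flip_pos_of_notMem hB] at h1
    exact e_ne_neg _ _ h1
  exact fun A B h => (key A B h).antisymm (key B A h.symm)

lemma flip_mem_W0 (A : Set (Fin κ.length)) : flip l A ∈ W0 (k + l) := by
  refine mem_W0_of_isSigned fun j => ?_
  rcases pos_or_natAdd κ l j with ⟨i, d, rfl⟩ | ⟨b, rfl⟩
  · by_cases hi : i ∈ A
    · exact ⟨_, Or.inr (flip_pos_of_mem hi d)⟩
    · exact ⟨_, Or.inl (flip_pos_of_notMem hi d)⟩
  · exact ⟨_, Or.inl (flip_natAdd A b)⟩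

lemma flip_center_of_mem {A : Set (Fin κ.length)} {i : Fin κ.length} (hi : i ∈ A) :
    flip l A (center κ l i) = -center κ l i := by
  rw [center, map_smul, map_sum, ← smul_neg, ← Finset.sum_neg_distrib]
  congr 1
  rw [← Equiv.sum_comp Fin.revPerm]
  refine Finset.sum_congr rfl fun d _ => ?_
  rw [Fin.revPerm_apply, flip_pos_of_mem hi, Fin.rev_rev]

lemma flip_center_of_notMem {A : Set (Fin κ.length)} {i : Fin κ.length} (hi : i ∉ A) :
    flip l A (center κ l i) = center κ l i := by
  rw [center, map_smul, map_sum]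
  exact congrArg _ (Finset.sum_congr rfl fun d _ => flip_pos_of_notMem hi d)

/-- Flips fix the point `r_L`, because the entries of each block are antisymmetric. -/
lemma flip_logPoint (A : Set (Fin κ.length)) (m : ℝ) {μ : YoungDiagram} (num : Fin l ≃ μ.cells) :
    flip l A (logPoint κ m num) = logPoint κ m num := by
  refine flip_eq_self fun i _ d => ?_
  have h : ((d.rev : ℕ) : ℝ) = κ.blocksFun i - ((d : ℕ) + 1) := by
    rw [Fin.val_rev, Nat.cast_sub d.2]
    push_cast
    ring
  rw [logPoint_pos, logPoint_pos, h]
  ring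

lemma flip_simpleRoot_of_le (A : Set (Fin κ.length)) {j : Fin (k + l)} (hj : j ∈ levi κ l)
    (hjk : k ≤ (j : ℕ)) : flip l A (simpleRoot j) = simpleRoot j := by
  rcases simpleRoot_cases κ l hj with ⟨i, a, h, rfl, -⟩ | ⟨b, h, -, h'⟩ | ⟨b, -, -, h'⟩
  · exact absurd (pos_lt κ l i _) (not_lt.2 hjk)
  · rw [h', map_sub, flip_natAdd, flip_natAdd]
  · rw [h', flip_natAdd]

lemma flip_image_simples (A : Set (Fin κ.length)) :
    flip l A '' simples (levi κ l) = simples (levi κ l) := by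
  have key : ∀ x ∈ simples (levi κ l), flip l A x ∈ simples (levi κ l) := by
    rintro _ ⟨j, hj, rfl⟩
    by_cases hjk : (j : ℕ) < k
    · rcases simpleRoot_cases κ l hj with ⟨i, a, h, rfl, h'⟩ | ⟨b, h, rfl, -⟩ | ⟨b, -, rfl, -⟩
      · by_cases hi : i ∈ A
        · have h1 : κ.blocksFun i - 2 - a + 1 < κ.blocksFun i := by omega
          refine ⟨pos κ l i ⟨κ.blocksFun i - 2 - a, by omega⟩, pos_mem_levi κ l i _ h1, ?_⟩
          rw [h', map_sub, flip_pos_of_mem hi, flip_pos_of_mem hi, simpleRoot_pos κ l i _ h1,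
            neg_sub_neg]
          congr 4 <;> simp only <;> omega
        · rw [h', map_sub, flip_pos_of_notMem hi, flip_pos_of_notMem hi, ← h']
          exact ⟨_, hj, rfl⟩
      · simp at hjk
      · simp at hjk
    · rw [flip_simpleRoot_of_le A hj (not_lt.1 hjk)]
      exact ⟨j, hj, rfl⟩
  refine Set.Subset.antisymm (Set.image_subset_iff.2 key) fun x hx => ⟨_, key x hx, flip_flip A x⟩

lemma simpleRoot_injective {n : ℕ} : Function.Injective (simpleRoot : Fin n → E n) := by
  have h1 : ∀ i : Fin n, (simpleRoot i : E n) i = 1 := by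
    intro i
    rw [simpleRoot]
    split_ifs
    · simp [e_apply, Fin.ext_iff]
    · simp [e_apply]
  have h2 : ∀ i j : Fin n, i < j → (simpleRoot j : E n) i = 0 := by
    intro i j hij
    have hne := hij.ne
    rw [simpleRoot]
    split_ifs
    · have : (i : ℕ) ≠ j + 1 := by omega
      simp [e_apply, hne, Fin.ext_iff, this]
    · simp [e_apply, hne]
  intro i j h
  by_contra hij
  rcases lt_or_gt_of_ne hij with hlt | hlt
  · have := h1 i
    rw [h, h2 i j hlt] at this
    exact zero_ne_one this
  · have := h1 j
    rw [← h, h2 j i hlt] at this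
    exact zero_ne_one this

variable {D : Datum (k + l)} {m : ℝ} {μ : YoungDiagram} (num : Fin l ≃ μ.cells)
  {V : Type*} [AddCommGroup V] [Module ℂ V] {δ : Hecke D (levi κ l) →ₐ[ℂ] Module.End ℂ V}

/-- Every flip fixes `δ`, with the identity of `V` as intertwiner: it permutes simple reflections
that act by the same scalar, and it changes `x` by a vector of the block lattice on which the
character by which `θ` acts is trivial. -/
lemma fixesRep_flip {r : AddChar (XL D (levi κ l)) ℂ}
    (hr : ∀ x, r x = ((D.q₁ ^ (∑ j, (x : E (k + l)) j * exponent κ l m num j) : ℝ) : ℂ))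
    (hirr : IsIrreducible δ) (hcc : HasCentralChar δ r) (hds : IsDiscreteSeries δ)
    (hq₁ : D.q₁ ≠ 1) {g : TW D} (hleft : g.left = 1) {A : Set (Fin κ.length)}
    (hg : (g.right : E (k + l) ≃ₗᵢ[ℝ] E (k + l)) = flip l A) : FixesRep D (levi κ l) δ g := by
  obtain ⟨⟨c, hc⟩, Q, hQ, hθ⟩ := block_action num hr hirr hcc hds hq₁
  refine ⟨LinearEquiv.refl ℂ V, fun i j hij v => ?_, fun x v => ?_⟩
  · simp only [LinearEquiv.refl_apply]
    rw [hg] at hij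
    by_cases hik : ((i : Fin (k + l)) : ℕ) < k
    · by_cases hjk : ((j : Fin (k + l)) : ℕ) < k
      · rw [hc i hik, hc j hjk]
      · have h := flip_flip A (simpleRoot (i : Fin (k + l)))
        rw [hij, flip_simpleRoot_of_le A j.2 (not_lt.1 hjk)] at h
        rw [Subtype.ext (simpleRoot_injective h)]
    · rw [flip_simpleRoot_of_le A i.2 (not_lt.1 hik)] at hij
      rw [Subtype.ext (simpleRoot_injective hij)]
  · simp only [LinearEquiv.refl_apply]
    rw [hleft, AddChar.one_apply, one_smul]
    set x' := actX D g.right x with hx'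
    have hcoe : (x' : E (k + l)) = flip l A x := by rw [← hg]; rfl
    have hcoeX : ∀ z : D.X, (toXL D (levi κ l) z : E (k + l)) = projL (levi κ l) z := fun _ => rfl
    have hmem : toXL D (levi κ l) x' - toXL D (levi κ l) x ∈ blockLattice l D κ := by
      intro b
      have h0 : ∀ z, res (levi κ l) z (Fin.natAdd k b) = 0 := by
        intro z
        rw [res_eq]
        simp [center_apply_natAdd]
      have h1 : flip l A (x : E (k + l)) (Fin.natAdd k b) = (x : E (k + l)) (Fin.natAdd k b) := by
        rw [← inner_e_right, inner_flip, flip_natAdd, inner_e_right]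
      rw [AddSubgroup.coe_sub, hcoeX, hcoeX, projL_eq, projL_eq]
      simp [h0, hcoe, h1]
    have hone : powChar κ m num D hQ (toXL D (levi κ l) x' - toXL D (levi κ l) x) = 1 := by
      rw [powChar_apply, AddSubgroup.coe_sub, hcoeX, hcoeX, inner_sub_left, inner_projL_logPoint,
        inner_projL_logPoint, hcoe, inner_flip, flip_logPoint, sub_self, Real.rpow_zero,
        Complex.ofReal_one]
    have h := hθ _ hmem (δ (θ D (levi κ l) (toXL D (levi κ l) x)) v)
    rw [hone, one_smul, theta_mul_apply, sub_add_cancel] at h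
    exact h.symm

end Flips

/-! ### The R-group -/

section Determination

variable {k l : ℕ} {κ : Composition k} {D : Datum (k + l)} {m : ℝ} {μ : YoungDiagram}
  (num : Fin l ≃ μ.cells) {r : AddChar (XL D (levi κ l)) ℂ}

lemma notMem_rootsL_of_blockSum_ne_zero {α : E (k + l)} (i : Fin κ.length)
    (h : blockSum κ l i α ≠ 0) : α ∉ rootsL (levi κ l) :=
  fun h' => h (((mem_rootsL_iff κ l).1 h').2 i)

/-- The positive system of `R_0(ξ)`: on the centers of the blocks of one given length, it is a root
system of type `D` if the strip of this length can be glued, and of type `B` otherwise. -/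
lemma mem_R0xiPos_iff (hq₁ : D.q₁ ≠ 1) (hm : D.q₂ = D.q₁ ^ m)
    (hr : ∀ x, r x = ((D.q₁ ^ (∑ j, (x : E (k + l)) j * exponent κ l m num j) : ℝ) : ℂ))
    {β : E (k + l)} :
    β ∈ R0xiPos D (levi κ l) r 1 ↔
      (∃ i, β = center κ l i ∧ ¬ CanGlue m μ (κ.blocksFun i)) ∨
      ∃ i j, i < j ∧ κ.blocksFun i = κ.blocksFun j ∧
        (β = center κ l i + center κ l j ∨ β = center κ l i - center κ l j) := by
  constructor
  · rintro ⟨⟨hprim, hpole⟩, α, hα, hαL, rfl⟩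
    have hnot : ∀ h : (∀ i, blockSum κ l i α = 0), False := fun h =>
      hαL ((mem_rootsL_iff κ l).2 ⟨posRoots_subset_roots hα, h⟩)
    have hcenter : ∀ i, res (levi κ l) α = center κ l i →
        ∃ i, res (levi κ l) α = center κ l i ∧ ¬ CanGlue m μ (κ.blocksFun i) := by
      intro i hi
      refine ⟨i, hi, ?_⟩
      rw [hi] at hpole
      exact (hasPole_center num hq₁ hm hr i).1 hpole
    rcases hα with ⟨a, b, hab, h⟩ | ⟨a, rfl⟩
    · rcases pos_or_natAdd κ l a with ⟨i, d, rfl⟩ | ⟨a, rfl⟩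
      · rcases pos_or_natAdd κ l b with ⟨j, d', rfl⟩ | ⟨b, rfl⟩
        · rcases (block_le_of_pos_lt κ l hab).eq_or_lt with rfl | hij
          · exfalso
            rcases h with rfl | rfl
            · -- `e_a + e_b` restricts to twice the center, which is not primitive
              have hne : (e (pos κ l i d) : E (k + l)) ∉ rootsL (levi κ l) :=
                notMem_rootsL_of_blockSum_ne_zero i (by rw [blockSum_e_pos, if_pos rfl]; simp)
              obtain ⟨c, hc, hc'⟩ := hprim.2 _ (e_mem_roots _) hne ⟨2⁻¹, by norm_num, by
                rw [res_add, res_e_pos, res_e_pos, ← two_smul ℝ, smul_smul]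
                norm_num⟩
              have h1 := congrArg (blockSum κ l i) hc'
              rw [map_smul, blockSum_res, blockSum_res, map_add, blockSum_e_pos, blockSum_e_pos,
                if_pos rfl, smul_eq_mul] at h1
              have h2 : (1 : ℝ) ≤ c := by exact_mod_cast hc
              linarith
            · refine hnot fun i' => ?_
              rw [map_sub, blockSum_e_pos, blockSum_e_pos, sub_self]
          · right
            rcases h with rfl | rfl
            · rw [res_add, res_e_pos, res_e_pos] at hpole ⊢
              exact ⟨i, j, hij, (hasPole_center_add_center num hq₁ hm hr hij.ne).1 hpole,
                Or.inl rfl⟩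
            · rw [res_sub, res_e_pos, res_e_pos] at hpole ⊢
              exact ⟨i, j, hij, (hasPole_center_sub_center num hq₁ hm hr hij.ne).1 hpole,
                Or.inr rfl⟩
        · left
          refine hcenter i ?_
          rcases h with rfl | rfl
          · rw [res_add, res_e_pos, res_e_natAdd, add_zero]
          · rw [res_sub, res_e_pos, res_e_natAdd, sub_zero]
      · rcases pos_or_natAdd κ l b with ⟨j, d', rfl⟩ | ⟨b, rfl⟩
        · have h1 := pos_lt κ l j d'
          have h2 := Fin.lt_def.1 hab
          rw [Fin.val_natAdd] at h2
          omega
        · refine (hnot fun i' => ?_).elim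
          rcases h with rfl | rfl
          · rw [map_add, blockSum_e_natAdd, blockSum_e_natAdd, add_zero]
          · rw [map_sub, blockSum_e_natAdd, blockSum_e_natAdd, sub_zero]
    · rcases pos_or_natAdd κ l a with ⟨i, d, rfl⟩ | ⟨a, rfl⟩
      · exact Or.inl (hcenter i (res_e_pos κ l i d))
      · exact (hnot fun i' => blockSum_e_natAdd κ l i' a).elim
  · -- each of the vectors is the restriction of a positive root with a block sum equal to `1`
    have key : ∀ (α : E (k + l)) (i : Fin κ.length), α ∈ posRoots (k + l) →
        blockSum κ l i α = 1 →
        HasPole D (levi κ l) (r.compAddMonoidHom (toXL D (levi κ l)) * 1) (res (levi κ l) α) →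
        res (levi κ l) α ∈ R0xiPos D (levi κ l) r 1 := fun α i hα h hp =>
      ⟨⟨isPrimitive_of_blockSum_eq_one κ l (posRoots_subset_roots hα) i h, hp⟩, α, hα,
        notMem_rootsL_of_blockSum_ne_zero i (by rw [h]; exact one_ne_zero), rfl⟩
    rintro (⟨i, rfl, hi⟩ | ⟨i, j, hij, hκ, h⟩)
    · have h1 := res_e_pos κ l i ⟨0, blocksFun_pos κ i⟩
      rw [← h1]
      refine key _ i (Or.inr ⟨_, rfl⟩) (by rw [blockSum_e_pos, if_pos rfl]) ?_
      rw [h1]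
      exact (hasPole_center num hq₁ hm hr i).2 hi
    · have h1 := res_e_pos κ l i ⟨0, blocksFun_pos κ i⟩
      have h2 := res_e_pos κ l j ⟨0, blocksFun_pos κ j⟩
      have hlt := pos_lt_pos_of_block_lt κ l hij ⟨0, blocksFun_pos κ i⟩ ⟨0, blocksFun_pos κ j⟩
      rcases h with rfl | rfl
      · rw [← h1, ← h2, ← res_add]
        refine key _ i (Or.inl ⟨_, _, hlt, Or.inl rfl⟩) ?_ ?_
        · rw [map_add, blockSum_e_pos, blockSum_e_pos, if_pos rfl, if_neg hij.ne, add_zero]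
        · rw [res_add, h1, h2]
          exact (hasPole_center_add_center num hq₁ hm hr hij.ne).2 hκ
      · rw [← h1, ← h2, ← res_sub]
        refine key _ i (Or.inl ⟨_, _, hlt, Or.inr rfl⟩) ?_ ?_
        · rw [map_sub, blockSum_e_pos, blockSum_e_pos, if_pos rfl, if_neg hij.ne, sub_zero]
        · rw [res_sub, h1, h2]
          exact (hasPole_center_sub_center num hq₁ hm hr hij.ne).2 hκ

/-- The blocks which are the last one of their length, and for which the strip of this length can
be glued. -/
def flippable (κ : Composition k) (m : ℝ) (μ : YoungDiagram) : Set (Fin κ.length) :=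
  {i | (∀ i', κ.blocksFun i' = κ.blocksFun i → i' ≤ i) ∧ CanGlue m μ (κ.blocksFun i)}

/-- Flips of last blocks of their length preserve the positive system: they are the diagram
automorphisms of the components of type `D`. -/
lemma flip_image_R0xiPos (hq₁ : D.q₁ ≠ 1) (hm : D.q₂ = D.q₁ ^ m)
    (hr : ∀ x, r x = ((D.q₁ ^ (∑ j, (x : E (k + l)) j * exponent κ l m num j) : ℝ) : ℂ))
    {A : Set (Fin κ.length)} (hA : A ⊆ flippable κ m μ) :
    flip l A '' R0xiPos D (levi κ l) r 1 = R0xiPos D (levi κ l) r 1 := by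
  have key : ∀ β ∈ R0xiPos D (levi κ l) r 1, flip l A β ∈ R0xiPos D (levi κ l) r 1 := by
    intro β hβ
    rw [mem_R0xiPos_iff num hq₁ hm hr] at hβ ⊢
    rcases hβ with ⟨i, rfl, hi⟩ | ⟨i, j, hij, hκ, h⟩
    · exact Or.inl ⟨i, flip_center_of_notMem fun h => hi (hA h).2, hi⟩
    · right
      have hiA : i ∉ A := fun h => absurd ((hA h).1 j hκ.symm) (not_le.2 hij)
      refine ⟨i, j, hij, hκ, ?_⟩
      by_cases hj : j ∈ A
      · rcases h with rfl | rfl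
        · right
          rw [map_add, flip_center_of_notMem hiA, flip_center_of_mem hj, sub_eq_add_neg]
        · left
          rw [map_sub, flip_center_of_notMem hiA, flip_center_of_mem hj, sub_neg_eq_add]
      · rcases h with rfl | rfl
        · left
          rw [map_add, flip_center_of_notMem hiA, flip_center_of_notMem hj]
        · right
          rw [map_sub, flip_center_of_notMem hiA, flip_center_of_notMem hj]
  exact Set.Subset.antisymm (Set.image_subset_iff.2 key) fun x hx => ⟨_, key x hx, flip_flip A x⟩

/-- A map of `Fin p` to itself that increases by one at each step is the identity. -/
lemma eq_self_of_succ_step {p : ℕ} {f : Fin p → Fin p}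
    (h : ∀ (a : ℕ) (ha : a + 1 < p), (f ⟨a + 1, ha⟩ : ℕ) = f ⟨a, by omega⟩ + 1) (d : Fin p) :
    f d = d := by
  have hp : 0 < p := d.pos
  have key : ∀ (a : ℕ) (ha : a < p), (f ⟨a, ha⟩ : ℕ) = f ⟨0, hp⟩ + a := by
    intro a
    induction a with
    | zero => intro ha; rfl
    | succ a ih =>
      intro ha
      rw [h a ha, ih (by omega), add_assoc]
  have h1 := key (p - 1) (by omega)
  have h2 := (f ⟨p - 1, by omega⟩).2
  have h3 := key d d.2
  exact Fin.ext (by rw [Fin.eta] at h3; omega)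

lemma eq_succ_of_e_sub_e_mem_simples {i : Fin κ.length} {d d' : Fin (κ.blocksFun i)}
    (hne : d ≠ d') (h : (e (pos κ l i d) - e (pos κ l i d') : E (k + l)) ∈ simples (levi κ l)) :
    (d' : ℕ) = d + 1 := by
  have hne' : pos κ l i d ≠ pos κ l i d' := fun h => hne ((pos_inj κ l).1 h)
  obtain ⟨j, hj, h⟩ := h
  rcases simpleRoot_cases κ l hj with ⟨i', a, ha, -, h'⟩ | ⟨b, hb, -, h'⟩ | ⟨b, -, -, h'⟩
  · rw [h'] at h
    obtain ⟨h1, h2⟩ := e_sub_e_inj hne' h.symm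
    obtain rfl := pos_block_eq κ l h1
    rw [pos_inj] at h1 h2
    subst h1 h2
    rfl
  · rw [h'] at h
    exact absurd (e_sub_e_inj hne' h.symm).1 (pos_ne_natAdd κ l _ _ _)
  · rw [h'] at h
    have := congrArg (fun x : E (k + l) => x (pos κ l i d)) h
    simp [e_apply, hne', pos_ne_natAdd] at this

/-- An isometry that preserves the simple roots of the Levi fixes the last `l` coordinates, since
the Dynkin diagram of type `B` has no automorphisms. -/
lemma map_e_natAdd {w : E (k + l) ≃ₗᵢ[ℝ] E (k + l)}
    (hw : w '' simples (levi κ l) = simples (levi κ l)) (b : Fin l) :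
    w (e (Fin.natAdd k b)) = e (Fin.natAdd k b) := by
  have hsimple : ∀ j ∈ levi κ l, ∃ j' ∈ levi κ l, simpleRoot j' = w (simpleRoot j) := by
    intro j hj
    have : w (simpleRoot j) ∈ simples (levi κ l) := hw ▸ ⟨_, ⟨j, hj, rfl⟩, rfl⟩
    exact this
  have key : ∀ (c : ℕ) (b : Fin l), (b : ℕ) + 1 + c = l →
      w (e (Fin.natAdd k b)) = e (Fin.natAdd k b) := by
    intro c
    induction c with
    | zero =>
      intro b hb
      have hs : simpleRoot (Fin.natAdd k b) = e (Fin.natAdd k b) := by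
        rw [simpleRoot, dif_neg (by simp; omega)]
      obtain ⟨j, hj, hjw⟩ := hsimple _ (natAdd_mem_levi κ l b)
      rw [hs] at hjw
      have hnorm : inner ℝ (simpleRoot j) (simpleRoot j) = (1 : ℝ) := by
        rw [hjw, w.inner_map_map, inner_e_left, e_apply, if_pos rfl]
      have hlong : simpleRoot j ∉ longRoots (k + l) := by
        intro h
        rw [norm_sq_longRoot h] at hnorm
        norm_num at hnorm
      rcases simpleRoot_cases κ l hj with ⟨i, a, ha, rfl, -⟩ | ⟨b', hb', -, h'⟩ | ⟨b', h, -, h'⟩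
      · exact absurd (pos_simpleRoot_long i a ha) hlong
      · refine absurd ⟨_, _, ?_, Or.inr (Or.inl h')⟩ hlong
        simp [Fin.ext_iff]
      · rw [← hjw, h']
        congr 2
        ext
        omega
    | succ c ih =>
      intro b hb
      have hb' : (b : ℕ) + 1 < l := by omega
      have h1 := ih ⟨b + 1, hb'⟩ (by simp; omega)
      have hs : simpleRoot (Fin.natAdd k b) =
          (e (Fin.natAdd k b) - e (Fin.natAdd k ⟨b + 1, hb'⟩) : E (k + l)) := by
        rw [simpleRoot, dif_pos (by simp; omega)]
        congr 2
      obtain ⟨j, hj, hjw⟩ := hsimple _ (natAdd_mem_levi κ l b)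
      rw [hs, map_sub, h1] at hjw
      have hcoord : (simpleRoot j : E (k + l)) (Fin.natAdd k ⟨b + 1, hb'⟩) = -1 := by
        have h2 : inner ℝ (w (e (Fin.natAdd k b))) (e (Fin.natAdd k ⟨b + 1, hb'⟩)) = (0 : ℝ) := by
          rw [← h1]
          rw [w.inner_map_map, inner_e_left, e_apply, if_neg]
          simp [Fin.ext_iff]
        rw [hjw, ← inner_e_right, inner_sub_left, h2, inner_e_left, e_apply, if_pos rfl]
        norm_num
      rcases simpleRoot_cases κ l hj with ⟨i, a, ha, -, h'⟩ | ⟨c', hc', -, h'⟩ | ⟨c', -, -, h'⟩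
      · rw [h', PiLp.sub_apply, e_apply, e_apply, if_neg (pos_ne_natAdd κ l i _ _).symm,
          if_neg (pos_ne_natAdd κ l i _ _).symm] at hcoord
        norm_num at hcoord
      · have hbc : c' = b := by
          rw [h'] at hcoord
          simp only [PiLp.sub_apply, e_apply, Fin.ext_iff, Fin.val_natAdd] at hcoord
          split_ifs at hcoord <;> first | omega | norm_num at hcoord
        subst hbc
        rw [h'] at hjw
        exact (sub_left_injective hjw).symm
      · rw [h'] at hcoord
        rw [e_apply] at hcoord
        split_ifs at hcoord <;> norm_num at hcoord
  exact key (l - 1 - b) b (by omega)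

lemma res_map {w : E (k + l) ≃ₗᵢ[ℝ] E (k + l)}
    (hw : w '' simples (levi κ l) = simples (levi κ l)) (x : E (k + l)) :
    res (levi κ l) (w x) = w (res (levi κ l) x) := by
  have hspan : ∀ y ∈ spanL (levi κ l), w y ∈ spanL (levi κ l) := by
    intro y hy
    have h : (spanL (levi κ l)).map w.toLinearEquiv.toLinearMap = spanL (levi κ l) := by
      rw [spanL, Submodule.map_span]
      exact congrArg _ hw
    rw [← h]
    exact ⟨y, hy, rfl⟩
  have hspan' : ∀ y ∈ spanL (levi κ l), ∃ z ∈ spanL (levi κ l), w z = y := by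
    intro y hy
    have h : (spanL (levi κ l)).map w.toLinearEquiv.toLinearMap = spanL (levi κ l) := by
      rw [spanL, Submodule.map_span]
      exact congrArg _ hw
    rw [← h] at hy
    exact hy
  refine Submodule.eq_starProjection_of_mem_orthogonal ?_ ?_
  · rw [Submodule.mem_orthogonal]
    intro u hu
    obtain ⟨z, hz, rfl⟩ := hspan' u hu
    rw [w.inner_map_map]
    exact Submodule.inner_right_of_mem_orthogonal hz (Submodule.starProjection_apply_mem _ _)
  · refine Submodule.le_orthogonal_orthogonal _ ?_
    rw [← map_sub, ← projL_eq]
    exact hspan _ (Submodule.starProjection_apply_mem _ _)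

/-- The value of `∑ (N - i) x_i` on a combination `∑ x_i c_i` of the centers `c_i` of the blocks,
where `N` is the number of blocks. It is positive on the positive restricted roots. -/
def height (l : ℕ) (κ : Composition k) : E (k + l) →ₗ[ℝ] ℝ :=
  ∑ i : Fin κ.length, ((κ.length : ℝ) - (i : ℕ)) • blockSum κ l i

lemma height_center (i : Fin κ.length) :
    height l κ (center κ l i) = (κ.length : ℝ) - (i : ℕ) := by
  simp [height, blockSum_center]

lemma height_center_pos (i : Fin κ.length) : 0 < height l κ (center κ l i) := by
  rw [height_center, sub_pos]
  exact_mod_cast i.2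

lemma height_center_lt {i j : Fin κ.length} :
    height l κ (center κ l j) < height l κ (center κ l i) ↔ i < j := by
  rw [height_center, height_center, sub_lt_sub_iff_left, Nat.cast_lt, Fin.lt_def]

/-- A signed permutation that preserves the simple roots of the Levi and the positive system of
`R_0(ξ)` is a flip of last blocks of their length. It sends centers of blocks to centers up to
sign, and on blocks of one length it has to preserve the order and, but for the last block, the
sign, because otherwise it would make one of the vectors `c_i ± c_j` negative. -/
lemma exists_eq_flip (hq₁ : D.q₁ ≠ 1) (hm : D.q₂ = D.q₁ ^ m)
    (hr : ∀ x, r x = ((D.q₁ ^ (∑ j, (x : E (k + l)) j * exponent κ l m num j) : ℝ) : ℂ))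
    {w : E (k + l) ≃ₗᵢ[ℝ] E (k + l)} (hsigned : IsSigned w)
    (hw : w '' simples (levi κ l) = simples (levi κ l))
    (hR : w '' R0xiPos D (levi κ l) r 1 = R0xiPos D (levi κ l) r 1) :
    ∃ A ⊆ flippable κ m μ, w = flip l A := by
  have hpos : ∀ β ∈ R0xiPos D (levi κ l) r 1, 0 < height l κ (w β) := by
    intro β hβ
    have h : w β ∈ R0xiPos D (levi κ l) r 1 := hR ▸ ⟨β, hβ, rfl⟩
    rcases (mem_R0xiPos_iff num hq₁ hm hr).1 h with ⟨i, hi, -⟩ | ⟨i, j, hij, -, hi | hi⟩ <;> rw [hi]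
    · exact height_center_pos i
    · rw [map_add]
      exact add_pos (height_center_pos i) (height_center_pos j)
    · rw [map_sub, sub_pos]
      exact height_center_lt.2 hij
  have hpm : ∀ i d, ∃ j, ∃ s : ℝ, (s = 1 ∨ s = -1) ∧
      ∃ d', w (e (pos κ l i d)) = s • e (pos κ l j d') := by
    intro i d
    obtain ⟨a, ha⟩ := hsigned (pos κ l i d)
    rcases pos_or_natAdd κ l a with ⟨j, d', rfl⟩ | ⟨b, rfl⟩
    · rcases ha with ha | ha
      · exact ⟨j, 1, Or.inl rfl, d', by rw [ha, one_smul]⟩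
      · exact ⟨j, -1, Or.inr rfl, d', by rw [ha, neg_one_smul]⟩
    · exfalso
      rw [← map_e_natAdd hw b, ← map_neg] at ha
      rcases ha with ha | ha
      · exact pos_ne_natAdd κ l i d b (e_injective (w.injective ha))
      · exact e_ne_neg _ _ (w.injective ha)
  have hcenter : ∀ i, ∃ j, ∃ s : ℝ, (s = 1 ∨ s = -1) ∧ w (center κ l i) = s • center κ l j := by
    intro i
    obtain ⟨j, s, hs, d', h⟩ := hpm i ⟨0, blocksFun_pos κ i⟩
    refine ⟨j, s, hs, ?_⟩
    rw [← res_e_pos κ l i ⟨0, blocksFun_pos κ i⟩, ← res_map hw, h, ← res_e_pos κ l j d']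
    exact map_smul _ s _
  choose σ s hs hσ using hcenter
  have hsize : ∀ i, κ.blocksFun (σ i) = κ.blocksFun i := by
    intro i
    have h := w.inner_map_map (center κ l i) (center κ l i)
    have hs2 : s i * s i = 1 := by rcases hs i with h | h <;> rw [h] <;> norm_num
    rw [hσ, inner_smul_left, inner_smul_right, inner_center_center, inner_center_center,
      ← mul_assoc] at h
    simp only [conj_trivial] at h
    rw [hs2, one_mul, inv_inj] at h
    exact_mod_cast h
  have hpair : ∀ i j, i < j → κ.blocksFun i = κ.blocksFun j → s i = 1 ∧ σ i < σ j := by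
    intro i j hij hκ
    have h1 := hpos _ ((mem_R0xiPos_iff num hq₁ hm hr).2 (Or.inr ⟨i, j, hij, hκ, Or.inl rfl⟩))
    have h2 := hpos _ ((mem_R0xiPos_iff num hq₁ hm hr).2 (Or.inr ⟨i, j, hij, hκ, Or.inr rfl⟩))
    rw [map_add, map_add, hσ, hσ, map_smul, map_smul, smul_eq_mul, smul_eq_mul] at h1
    rw [map_sub, map_sub, hσ, hσ, map_smul, map_smul, smul_eq_mul, smul_eq_mul] at h2
    have h3 := height_center_pos (l := l) (σ i)
    have h4 := height_center_pos (l := l) (σ j)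
    have hsi : s i = 1 := by
      rcases hs i with h | h
      · exact h
      · rw [h] at h1 h2
        linarith
    refine ⟨hsi, height_center_lt (l := l).1 ?_⟩
    rw [hsi] at h1 h2
    rcases hs j with h | h <;> rw [h] at h1 h2 <;> linarith
  have hσ1 : ∀ i, σ i = i := by
    intro i
    let f : {j // κ.blocksFun j = κ.blocksFun i} → {j // κ.blocksFun j = κ.blocksFun i} :=
      fun j => ⟨σ j, (hsize j).trans j.2⟩
    have hf : StrictMono f := fun a b hab => (hpair a b hab (a.2.trans b.2.symm)).2
    exact congrArg Subtype.val
      (le_antisymm (hf.le_id ⟨i, rfl⟩) (hf.id_le ⟨i, rfl⟩) : f ⟨i, rfl⟩ = ⟨i, rfl⟩)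
  have hblock : ∀ i d, ∃ d', w (e (pos κ l i d)) = s i • e (pos κ l i d') := by
    intro i d
    obtain ⟨j, t, ht, d', h⟩ := hpm i d
    have h1 : t • center κ l j = s i • center κ l i := by
      have := hσ i
      rw [hσ1 i, ← res_e_pos κ l i d, ← res_map hw, h, res_e_pos] at this
      rw [← this, ← res_e_pos κ l j d']
      exact (map_smul _ t _).symm
    have h2 := congrArg (blockSum κ l i) h1
    have hne : s i ≠ 0 := by rcases hs i with h | h <;> rw [h] <;> norm_num
    rw [map_smul, map_smul, blockSum_center, blockSum_center, if_pos rfl, smul_eq_mul,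
      smul_eq_mul, mul_one] at h2
    split_ifs at h2 with hij
    · subst hij
      rw [mul_one] at h2
      exact ⟨d', h2 ▸ h⟩
    · exact absurd h2.symm (by rwa [mul_zero])
  choose f hf using hblock
  have hinj : ∀ i, Function.Injective (f i) := by
    intro i a b hab
    have : w (e (pos κ l i a)) = w (e (pos κ l i b)) := by rw [hf, hf, hab]
    exact (pos_inj κ l).1 (e_injective (w.injective this))
  have hsimple : ∀ i (a : ℕ) (ha : a + 1 < κ.blocksFun i),
      s i • (e (pos κ l i (f i ⟨a, by omega⟩)) - e (pos κ l i (f i ⟨a + 1, ha⟩)) : E (k + l)) ∈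
        simples (levi κ l) := by
    intro i a ha
    rw [smul_sub, ← hf, ← hf, ← map_sub, ← simpleRoot_pos κ l i a ha, ← hw]
    exact ⟨_, ⟨_, pos_mem_levi κ l i a ha, rfl⟩, rfl⟩
  have hfne : ∀ i (a : ℕ) (ha : a + 1 < κ.blocksFun i), f i ⟨a, by omega⟩ ≠ f i ⟨a + 1, ha⟩ := by
    intro i a ha h
    have := Fin.mk.inj (hinj i h)
    omega
  refine ⟨{i | s i = -1}, fun i hi => ⟨fun i' hi' => ?_, ?_⟩, eq_flip (fun i hi d => ?_)
    (fun i hi d => ?_) (map_e_natAdd hw)⟩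
  · by_contra h
    have h1 := (hpair i i' (not_le.1 h) hi'.symm).1
    rw [show s i = -1 from hi] at h1
    norm_num at h1
  · by_contra h
    have h1 := hpos _ ((mem_R0xiPos_iff num hq₁ hm hr).2 (Or.inl ⟨i, rfl, h⟩))
    have h2 := height_center_pos (l := l) i
    rw [hσ, hσ1, show s i = -1 from hi, map_smul, smul_eq_mul] at h1
    linarith
  · have hi : s i = -1 := hi
    rw [hf, hi, neg_one_smul]
    have h : ∀ d, (f i d).rev = d := by
      refine eq_self_of_succ_step (f := fun d => (f i d).rev) fun a ha => ?_
      have h := hsimple i a ha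
      rw [hi, neg_one_smul, neg_sub] at h
      have h1 := eq_succ_of_e_sub_e_mem_simples (hfne i a ha).symm h
      have h2 := (f i ⟨a, by omega⟩).2
      simp only [Fin.val_rev]
      omega
    rw [← h d, Fin.rev_rev, h d]
  · have hi : s i = 1 := (hs i).resolve_right hi
    rw [hf, hi, one_smul]
    have h : ∀ d, f i d = d := by
      refine eq_self_of_succ_step fun a ha => ?_
      have h := hsimple i a ha
      rw [hi, one_smul] at h
      exact eq_succ_of_e_sub_e_mem_simples (hfne i a ha) h
    rw [h d]

variable {V : Type*} [AddCommGroup V] [Module ℂ V] {δ : Hecke D (levi κ l) →ₐ[ℂ] Module.End ℂ V}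

/-- The `R`-group consists of the flips of flippable blocks. -/
theorem mem_RGroup_iff (hq₁ : D.q₁ ≠ 1) (hm : D.q₂ = D.q₁ ^ m)
    (hr : ∀ x, r x = ((D.q₁ ^ (∑ j, (x : E (k + l)) j * exponent κ l m num j) : ℝ) : ℂ))
    (hirr : IsIrreducible δ) (hcc : HasCentralChar δ r) (hds : IsDiscreteSeries δ) {g : TW D} :
    g ∈ RGroup D (levi κ l) δ r 1 ↔ g.left = 1 ∧
      ∃ A ⊆ flippable κ m μ, (g.right : E (k + l) ≃ₗᵢ[ℝ] E (k + l)) = flip l A := by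
  constructor
  · rintro ⟨⟨-, hw, -, hfix⟩, hR⟩
    rw [map_one, mul_one] at hfix
    exact ⟨hfix, exists_eq_flip num hq₁ hm hr (isSigned_of_mem_W0 g.right.2) hw hR⟩
  · rintro ⟨hleft, A, hA, hg⟩
    refine ⟨⟨⟨fun x _ => ?_, fun x _ => ?_⟩, ?_, ?_, ?_⟩, ?_⟩
    · rw [hleft, AddChar.one_apply]
    · rw [hleft, AddChar.one_apply]
    · rw [hg, flip_image_simples]
    · exact fixesRep_flip num hr hirr hcc hds hq₁ hleft hg
    · rw [hleft, map_one, mul_one]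
    · rw [hg]
      exact flip_image_R0xiPos num hq₁ hm hr hA

end Determination

/-! ### The group of flips -/

section FlipGroup

variable {k l : ℕ} {κ : Composition k} {D : Datum (k + l)} {m : ℝ} {μ : YoungDiagram}

lemma exists_last {p : ℕ} (hp : p ∈ κ.blocks) :
    ∃ i, κ.blocksFun i = p ∧ ∀ i', κ.blocksFun i' = p → i' ≤ i := by
  obtain ⟨i, hi⟩ := List.mem_iff_get.1 hp
  obtain ⟨i, hi, hmax⟩ := ({j : Fin κ.length | κ.blocksFun j = p} : Set _).toFinite.exists_maximal
    ⟨i, hi⟩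
  refine ⟨i, hi, fun j hj => ?_⟩
  rcases le_total j i with h | h
  · exact h
  · exact hmax hj h

/-- The last block of length `p`. -/
def lastBlock (p : gluable κ m μ) : Fin κ.length := (exists_last p.2.1).choose

lemma blocksFun_lastBlock (p : gluable κ m μ) : κ.blocksFun (lastBlock p) = p :=
  (exists_last p.2.1).choose_spec.1

lemma le_lastBlock (p : gluable κ m μ) {i : Fin κ.length} (hi : κ.blocksFun i = p) :
    i ≤ lastBlock p := (exists_last p.2.1).choose_spec.2 i hi

lemma lastBlock_injective : Function.Injective (lastBlock : gluable κ m μ → Fin κ.length) := by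
  intro p p' h
  refine Subtype.ext ?_
  rw [← blocksFun_lastBlock p, ← blocksFun_lastBlock p', h]

lemma range_lastBlock : Set.range (lastBlock : gluable κ m μ → _) = flippable κ m μ := by
  ext i
  constructor
  · rintro ⟨p, rfl⟩
    refine ⟨fun i' hi' => le_lastBlock p (hi'.trans (blocksFun_lastBlock p)), ?_⟩
    rw [blocksFun_lastBlock]
    exact p.2.2
  · rintro ⟨h1, h2⟩
    let p : gluable κ m μ := ⟨κ.blocksFun i, κ.blocksFun_mem_blocks i, h2⟩
    exact ⟨p, le_antisymm (h1 _ (blocksFun_lastBlock p)) (le_lastBlock p rfl)⟩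

/-- The blocks to be flipped for a vector `f` of elements of `ℤ/2`. -/
def flipSet (f : gluable κ m μ → ZMod 2) : Set (Fin κ.length) := lastBlock '' {p | f p = 1}

lemma flipSet_add (f g : gluable κ m μ → ZMod 2) :
    flipSet (f + g) = symmDiff (flipSet f) (flipSet g) := by
  rw [flipSet, flipSet, flipSet, ← Set.image_symmDiff lastBlock_injective]
  congr 1
  ext p
  have h : ∀ a b : ZMod 2, a + b = 1 ↔ (a = 1 ∧ ¬ b = 1) ∨ (b = 1 ∧ ¬ a = 1) := by decide
  exact h (f p) (g p)

lemma flipSet_injective : Function.Injective (flipSet : (gluable κ m μ → ZMod 2) → _) := by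
  intro f g h
  have h1 : {p | f p = 1} = {p | g p = 1} := (Set.image_injective.2 lastBlock_injective) h
  have h2 : ∀ a b : ZMod 2, (a = 1 ↔ b = 1) → a = b := by decide
  exact funext fun p => h2 _ _ (Set.ext_iff.1 h1 p)

variable (D κ m μ) in
/-- The homomorphism from `(ℤ/2)^d` to `T ⋊ W_0` given by the flips. -/
def flipHom : Multiplicative (gluable κ m μ → ZMod 2) →* TW D :=
  SemidirectProduct.inr.comp
    { toFun := fun f => ⟨flip l (flipSet f.toAdd), flip_mem_W0 _⟩
      map_one' := Subtype.ext (by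
        have : flipSet (0 : gluable κ m μ → ZMod 2) = ∅ := by simp [flipSet]
        exact (congrArg (flip l) this).trans flip_empty)
      map_mul' := fun f g => Subtype.ext
        ((congrArg (flip l) (flipSet_add f.toAdd g.toAdd)).trans (flip_mul _ _).symm) }

lemma flipHom_left (f) : (flipHom κ D m μ f).left = 1 := rfl

lemma coe_flipHom_right (f) : ((flipHom κ D m μ f).right : E (k + l) ≃ₗᵢ[ℝ] E (k + l)) =
    flip l (flipSet f.toAdd) := rfl

lemma flipHom_injective : Function.Injective (flipHom κ D m μ) := fun _ _ h =>
  Multiplicative.toAdd.injective (flipSet_injective (flip_injective (l := l)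
    (congrArg (fun x : TW D => (x.right : E (k + l) ≃ₗᵢ[ℝ] E (k + l))) h)))

lemma mem_range_flipHom {g : TW D} : g ∈ (flipHom κ D m μ).range ↔ g.left = 1 ∧
    ∃ A ⊆ flippable κ m μ, (g.right : E (k + l) ≃ₗᵢ[ℝ] E (k + l)) = flip l A := by
  classical
  constructor
  · rintro ⟨f, rfl⟩
    refine ⟨rfl, _, ?_, coe_flipHom_right f⟩
    rw [← range_lastBlock]
    exact Set.image_subset_range _ _
  · rintro ⟨h1, A, hA, h2⟩
    have hA' : flipSet (fun p : gluable κ m μ => if lastBlock p ∈ A then (1 : ZMod 2) else 0) =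
        A := by
      rw [← range_lastBlock] at hA
      rw [flipSet]
      refine Eq.trans ?_ (Set.image_preimage_eq_of_subset hA)
      congr 1
      ext p
      simp
    refine ⟨Multiplicative.ofAdd fun p => if lastBlock p ∈ A then 1 else 0,
      SemidirectProduct.ext h1.symm (Subtype.ext ?_)⟩
    rw [coe_flipHom_right, toAdd_ofAdd, hA', h2]

instance finite_gluable : Finite (gluable κ m μ) :=
  (κ.blocks.finite_toSet.subset fun _ hp => hp.1)

open Classical in
variable (D κ m μ) in
/-- The flip of the last block of length `p`. -/
def lastFlip (p : gluable κ m μ) : TW D :=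
  flipHom κ D m μ (Multiplicative.ofAdd (Pi.single p 1))

lemma lastFlip_ne_one (p : gluable κ m μ) : lastFlip κ D m μ p ≠ 1 := by
  classical
  intro h
  have h1 := flipHom_injective (h.trans (map_one (flipHom κ D m μ)).symm)
  have h2 := congrFun (congrArg Multiplicative.toAdd h1) p
  rw [toAdd_ofAdd, Pi.single_eq_same] at h2
  exact one_ne_zero h2

lemma lastFlip_mul_self (p : gluable κ m μ) : lastFlip κ D m μ p * lastFlip κ D m μ p = 1 := by
  rw [lastFlip, ← map_mul, ← ofAdd_add, ← Pi.single_add, CharTwo.add_self_eq_zero,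
    Pi.single_zero, ofAdd_zero, map_one]

lemma lastFlip_comm (p p' : gluable κ m μ) :
    lastFlip κ D m μ p * lastFlip κ D m μ p' = lastFlip κ D m μ p' * lastFlip κ D m μ p := by
  rw [lastFlip, lastFlip, ← map_mul, mul_comm, map_mul]

lemma closure_lastFlip :
    Subgroup.closure (Set.range (lastFlip κ D m μ)) = (flipHom κ D m μ).range := by
  classical
  refine le_antisymm ((Subgroup.closure_le _).2 ?_) ?_
  · rintro _ ⟨p, rfl⟩
    exact ⟨_, rfl⟩
  · rintro _ ⟨f, rfl⟩
    have := Fintype.ofFinite (gluable κ m μ)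
    have hf : f = ∏ p, Multiplicative.ofAdd (Pi.single p (f.toAdd p)) := by
      rw [← ofAdd_sum, Finset.univ_sum_single]
      rfl
    rw [← Subgroup.mem_comap, hf]
    refine Subgroup.prod_mem _ fun p _ => ?_
    rw [Subgroup.mem_comap]
    have h2 : ∀ a : ZMod 2, a = 0 ∨ a = 1 := by decide
    rcases h2 (f.toAdd p) with h | h <;> rw [h]
    · rw [Pi.single_zero, ofAdd_zero, map_one]
      exact one_mem _
    · exact Subgroup.subset_closure ⟨p, rfl⟩

lemma isBlockFlip_lastFlip (p : gluable κ m μ) : IsBlockFlip κ l (lastBlock p)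
    ((lastFlip κ D m μ p).right : E (k + l) ≃ₗᵢ[ℝ] E (k + l)) := by
  classical
  have h : ((lastFlip κ D m μ p).right : E (k + l) ≃ₗᵢ[ℝ] E (k + l)) = flip l {lastBlock p} := by
    rw [lastFlip, coe_flipHom_right, toAdd_ofAdd, flipSet]
    congr 1
    rw [← Set.image_singleton]
    congr 1
    ext p'
    by_cases hp : p' = p <;> simp [Pi.single_apply, hp]
  rw [h]
  exact ⟨flip_pos_of_mem rfl, fun i' hi' => flip_pos_of_notMem hi', flip_natAdd _⟩

variable (κ m μ) in
/-- Reindexing of the coordinates of `(ℤ/2)^d`. -/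
def reindexGluable : Multiplicative (gluable κ m μ → ZMod 2) ≃*
    Multiplicative (Fin (gluable κ m μ).ncard → ZMod 2) :=
  AddEquiv.toMultiplicative (AddEquiv.arrowCongr (Finite.equivFin _) (AddEquiv.refl _))

end FlipGroup

end HeckeB

end

theorem theorem5 {k l : ℕ} (κ : Composition k) (D : HeckeB.Datum (k + l)) (m : ℝ)
    (hq₁ : D.q₁ ≠ 1) (hm : D.q₂ = D.q₁ ^ m)
    (μ : YoungDiagram) (num : Fin l ≃ μ.cells)
    {V : Type*} [AddCommGroup V] [Module ℂ V]
    (δ : HeckeB.Hecke D (HeckeB.levi κ l) →ₐ[ℂ] Module.End ℂ V)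
    (hirr : HeckeB.IsIrreducible δ) (hds : HeckeB.IsDiscreteSeries δ)
    (r : AddChar (HeckeB.XL D (HeckeB.levi κ l)) ℂ)
    (hr : ∀ x, r x =
      ((D.q₁ ^ (∑ j, (x : HeckeB.E (k + l)) j * HeckeB.exponent κ l m num j) : ℝ) : ℂ))
    (hcc : HeckeB.HasCentralChar δ r) :
    ∃ H : Subgroup (HeckeB.TW D),
      (H : Set (HeckeB.TW D)) = HeckeB.RGroup D (HeckeB.levi κ l) δ r 1 ∧
      Nonempty (H ≃* Multiplicative (Fin (HeckeB.gluable κ m μ).ncard → ZMod 2)) ∧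
      ∃ w : HeckeB.gluable κ m μ → HeckeB.TW D,
        (∀ p, w p ≠ 1 ∧ w p * w p = 1) ∧ (∀ p p', w p * w p' = w p' * w p) ∧
        Subgroup.closure (Set.range w) = H ∧
        ∀ p, (w p).left = 1 ∧ ∃ i : Fin κ.length, κ.blocksFun i = p ∧
          (∀ i', κ.blocksFun i' = p → i' ≤ i) ∧
          HeckeB.IsBlockFlip κ l i ((w p).right : HeckeB.E (k + l) ≃ₗᵢ[ℝ] HeckeB.E (k + l)) := by
  refine ⟨(HeckeB.flipHom κ D m μ).range, ?_, ?_, HeckeB.lastFlip κ D m μ,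
    fun p => ⟨HeckeB.lastFlip_ne_one p, HeckeB.lastFlip_mul_self p⟩, HeckeB.lastFlip_comm,
    HeckeB.closure_lastFlip, fun p => ⟨HeckeB.flipHom_left _, HeckeB.lastBlock p,
      HeckeB.blocksFun_lastBlock p, fun _ => HeckeB.le_lastBlock p,
      HeckeB.isBlockFlip_lastFlip p⟩⟩
  · ext g
    exact HeckeB.mem_range_flipHom.trans
      (HeckeB.mem_RGroup_iff num hq₁ hm hr hirr hcc hds).symm
  · exact ⟨(MonoidHom.ofInjective HeckeB.flipHom_injective).symm.trans
      (HeckeB.reindexGluable κ m μ)⟩
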